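/- **Conventions.** For a real matrix $A$ let $\mathrm{nnz}(A)$ be its number of nonzero entries. For $\varepsilon:\mathbb N\to[0,1]$, the $\varepsilon(n)$-Approximate Linear Decision problem asks, for a system $(A,b)$ with $A\in\mathbb R^{m\times n}$, to distinguish YES instances (there is $x$ with $Ax=b$) from NO instances ($\|Ax-b\|_2>\varepsilon(n)\|b\|_2$ for all $x\in\mathbb R^n$), under the promise that one of the two holds; an oracle for the problem may answer arbitrarily when the promise fails. $\tilde O(f)$ means $O(f\cdot\mathrm{polylog}(f))$. A RealRAM has storage cells holding real numbers, with $+,-,\times,\div$ and comparison at unit cost, and cells holding natural-number counters and addresses; a randomized RealRAM can also draw, at unit cost, a fresh standard Gaussian or a fresh uniform element of $\{0,\dots,k-1\}$. Matrices are given by a list of their nonzero entries, in any order, and are passed to the oracle as a list of triples (row, column, value), where values at the same position add up. **Theorem.** For every constant $c>0$ there is a randomized Turing reduction on the RealRAM from computing the rank of a matrix to the $(1-1/n^c)$-Approximate Linear Decision problem on square systems with the all-ones right-hand side. That is, there is a single randomized RealRAM program (depending only on $c$) such that, for all $m,n\ge 1$, every $A\in\mathbb R^{m\times n}$ with $\mathrm{nnz}(A)\ge\max(m,n)$,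 and every oracle for that problem, the following hold, with the constants hidden in $O$, $\tilde O$ and $\mathrm{polylog}$ depending only on $c$. 1. The program halts within $\tilde O(\mathrm{nnz}(A))$ steps and makes $\mathrm{polylog}(mn)$ oracle calls. Each call is on a system $(A',\mathbf 1^{n'})$ with $A'\in\mathbb R^{n'\times n'}$, $n'=O(\max(m,n))$ and $\mathrm{nnz}(A')=\tilde O(\mathrm{nnz}(A))$ (the list passed to the oracle also has length $\tilde O(\mathrm{nnz}(A))$). 2. With probability at least $1-N^{-\log_2 N}$, where $N=\mathrm{nnz}(A)$, the program outputs $\mathrm{rank}(A)$, and each system $(A',\mathbf 1^{n'})$ on which it calls the oracle is either a YES instance in which $A'$ has full rank, or a NO instance, that is, $\|A'x-\mathbf 1^{n'}\|_2>(1-1/n'^{\,c})\,\|\mathbf 1^{n'}\|_2$ for all $x\in\mathbb R^{n'}$. -/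

import Mathlib

/-- The sparsity of a matrix: the number of its nonzero entries. -/
noncomputable def nnz {m n : ℕ} (A : Matrix (Fin m) (Fin n) ℝ) : ℕ :=
  Nat.card {p : Fin m × Fin n // A p.1 p.2 ≠ 0}

/-- The linear system `A x = b` is satisfiable. -/
def ALDYes {m n : ℕ} (A : Matrix (Fin m) (Fin n) ℝ) (b : Fin m → ℝ) : Prop :=
  ∃ x : Fin n → ℝ, A.mulVec x = b

/-- Every `x` has Euclidean error `‖A x - b‖ > ε(n) ‖b‖`, where `n` is the number of columns. -/
def ALDNo (ε : ℕ → ℝ) {m n : ℕ} (A : Matrix (Fin m) (Fin n) ℝ) (b : Fin m → ℝ) : Prop :=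
  ∀ x : Fin n → ℝ, ε n * ‖WithLp.toLp 2 b‖ < ‖WithLp.toLp 2 (A.mulVec x - b)‖

/-- An oracle for square systems `(A, 𝟏)`; it is handed the matrix `A` and returns one bit. -/
abbrev SquareOracle : Type := (d : ℕ) → Matrix (Fin d) (Fin d) ℝ → Bool

/-- The oracle solves the promise problem "`ε`-approximate linear decision" on square systems with
right-hand side the all-ones vector: it says `true` on YES instances and `false` on NO instances.
On a matrix that violates the promise its answer is arbitrary. -/
def SolvesALD (ε : ℕ → ℝ) (O : SquareOracle) : Prop :=
  ∀ (d : ℕ) (A : Matrix (Fin d) (Fin d) ℝ),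
    (ALDYes A 1 → O d A = true) ∧ (ALDNo ε A 1 → O d A = false)

/-! A randomized oracle Real RAM. There are two sorts of storage cells. Value cells hold real
numbers, which can be added, subtracted, multiplied, divided and compared at unit cost. Index cells
hold natural numbers used as counters and addresses; they can only be copied, incremented,
decremented and compared, so that after `T` steps every index is at most the largest initial index
or program constant plus `T`. An index can be turned into a real number, but not conversely. -/
namespace RealRAM

/-- The elementary instructions. All arguments are fixed natural numbers: names of index registers,
value registers, index arrays or value arrays (a program uses finitely many of them), apart from
the constant `a` in `idxConst`. -/
inductive Instr : Type
  | idxConst (i a : ℕ)            -- index register `i` receives the constant `a`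
  | idxCopy (i j : ℕ)             -- index register `i` receives the content of `j`
  | idxSucc (i : ℕ)               -- increment index register `i`
  | idxPred (i : ℕ)               -- decrement index register `i` (zero stays zero)
  | idxLoad (i arr a : ℕ)         -- `i` receives cell number `a` (content of `a`) of index array
  | idxStore (arr a i : ℕ)        -- that cell of the index array receives the content of `i`
  | ofIdx (r i : ℕ)               -- value register `r` receives the content of index register `i`
  | add (r p q : ℕ)               -- value registers: `r := p + q`
  | sub (r p q : ℕ)               -- `r := p - q`
  | mul (r p q : ℕ)               -- `r := p * q`
  | div (r p q : ℕ)               -- `r := p / q` (and `r := 0` if `q` holds zero)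
  | valLoad (r arr a : ℕ)         -- as `idxLoad`, for value registers and value arrays
  | valStore (arr a r : ℕ)        -- as `idxStore`, for value registers and value arrays
  | gauss (r : ℕ)                 -- `r` receives a fresh sample of the law N(0,1)
  | randIdx (i j : ℕ)             -- `i` receives a fresh uniform sample of `{0, …, (content of j) - 1}`
  | query (out dim len rows cols vals : ℕ)
    -- oracle call on the square matrix whose dimension is the content of index register `dim` and
    -- which is listed in coordinate form in the index arrays `rows`, `cols` and the value array
    -- `vals`, of length the content of `len`; the answer bit is put in index register `out`

/-- Comparison of two index registers or of two value registers. -/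
inductive Test : Type
  | idxLt (i j : ℕ)
  | valLt (p q : ℕ)

/-- Programs: `loop b p` repeats `p` as long as `b` holds. -/
inductive Prog : Type
  | op (a : Instr)
  | seq (p q : Prog)
  | ite (b : Test) (p q : Prog)
  | loop (b : Test) (p : Prog)

/-- A query to the oracle, in coordinate form: `len` triples `(row t, col t, val t)`. -/
structure Query : Type where
  dim : ℕ
  len : ℕ
  row : ℕ → ℕ
  col : ℕ → ℕ
  val : ℕ → ℝ

/-- The matrix given in coordinate form: triples with the same position add up (triples whose
position lies outside the matrix do not contribute). -/
def Query.matrix (q : Query) : Matrix (Fin q.dim) (Fin q.dim) ℝ :=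
  fun i j => ∑ t ∈ Finset.range q.len,
    if q.row t = (i : ℕ) ∧ q.col t = (j : ℕ) then q.val t else 0

/-- The store. The last two fields cannot be read by a program: the number of random samples drawn
so far, and the list of the oracle queries made so far (most recent first). -/
structure State : Type where
  idx : ℕ → ℕ
  val : ℕ → ℝ
  idxArr : ℕ → ℕ → ℕ
  valArr : ℕ → ℕ → ℝ
  drawn : ℕ
  queries : List Query

/-- The random tape. Its cells are independent; each holds a real number and an independent point
of `[0,1]`. A random instruction consumes the next cell. -/
abbrev Tape : Type := ℕ → ℝ × unitInterval

/-- The law of the tape: independent cells, in each the law N(0,1) times the uniform law. -/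
noncomputable def tapeLaw : MeasureTheory.Measure Tape :=
  MeasureTheory.Measure.infinitePi fun _ =>
    (ProbabilityTheory.gaussianReal 0 1).prod (MeasureTheory.volume : MeasureTheory.Measure unitInterval)

/-- The point `⌊k u⌋` of `{0, …, k-1}`, which is uniformly distributed if `u` is uniform in `[0,1]`
(the minimum matters for `u = 1` only). -/
noncomputable def uniformIdx (k : ℕ) (u : unitInterval) : ℕ :=
  min ⌊(k : ℝ) * (u : ℝ)⌋₊ (k - 1)

/-- Effect of one elementary instruction. -/
noncomputable def Instr.exec (O : SquareOracle) (ω : Tape) (s : State) : Instr → State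
  | .idxConst i a => { s with idx := Function.update s.idx i a }
  | .idxCopy i j => { s with idx := Function.update s.idx i (s.idx j) }
  | .idxSucc i => { s with idx := Function.update s.idx i (s.idx i + 1) }
  | .idxPred i => { s with idx := Function.update s.idx i (s.idx i - 1) }
  | .idxLoad i arr a => { s with idx := Function.update s.idx i (s.idxArr arr (s.idx a)) }
  | .idxStore arr a i =>
      { s with idxArr := Function.update s.idxArr arr
                (Function.update (s.idxArr arr) (s.idx a) (s.idx i)) }
  | .ofIdx r i => { s with val := Function.update s.val r (s.idx i : ℝ) }
  | .add r p q => { s with val := Function.update s.val r (s.val p + s.val q) }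
  | .sub r p q => { s with val := Function.update s.val r (s.val p - s.val q) }
  | .mul r p q => { s with val := Function.update s.val r (s.val p * s.val q) }
  | .div r p q => { s with val := Function.update s.val r (s.val p / s.val q) }
  | .valLoad r arr a => { s with val := Function.update s.val r (s.valArr arr (s.idx a)) }
  | .valStore arr a r =>
      { s with valArr := Function.update s.valArr arr
                (Function.update (s.valArr arr) (s.idx a) (s.val r)) }
  | .gauss r =>
      { s with val := Function.update s.val r (ω s.drawn).1, drawn := s.drawn + 1 }
  | .randIdx i j =>
      { s with idx := Function.update s.idx i (uniformIdx (s.idx j) (ω s.drawn).2)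
               drawn := s.drawn + 1 }
  | .query out dim len rows cols vals =>
      let q : Query := ⟨s.idx dim, s.idx len, s.idxArr rows, s.idxArr cols, s.valArr vals⟩
      { s with idx := Function.update s.idx out (if O q.dim q.matrix = true then 1 else 0)
               queries := q :: s.queries }

/-- The condition expressed by a test. -/
def Test.Holds (s : State) : Test → Prop
  | .idxLt i j => s.idx i < s.idx j
  | .valLt p q => s.val p < s.val q

/-- A configuration: the program pieces still to be carried out, in order, and the store. The
machine has halted when nothing is left to be carried out. -/
abbrev Config : Type := List Prog × State

open Classical in
/-- One step of the machine. A halted configuration does not change. -/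
noncomputable def step (O : SquareOracle) (ω : Tape) : Config → Config
  | ([], s) => ([], s)
  | (.op a :: K, s) => (K, a.exec O ω s)
  | (.seq p q :: K, s) => (p :: q :: K, s)
  | (.ite b p q :: K, s) => if b.Holds s then (p :: K, s) else (q :: K, s)
  | (.loop b p :: K, s) => if b.Holds s then (p :: .loop b p :: K, s) else (K, s)

/-- On the store `s`, with oracle `O` and random tape `ω`, the program `P` has halted after `T`
steps with final store `s'`. -/
def HaltsIn (O : SquareOracle) (ω : Tape) (P : Prog) (s : State) (T : ℕ) (s' : State) : Prop :=
  (step O ω)^[T] ([P], s) = ([], s')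

/-- A listing of the nonzero entries of `A`, each exactly once, in an arbitrary order. -/
abbrev Listing {m n : ℕ} (A : Matrix (Fin m) (Fin n) ℝ) : Type :=
  Fin (nnz A) ≃ {p : Fin m × Fin n // A p.1 p.2 ≠ 0}

/-- The initial store for the input `A`, given in sparse form: the index registers `0`, `1`, `2`
hold `m`, `n` and `nnz A`; the positions of the nonzero entries (counted from zero) are in the index
arrays `0` (rows) and `1` (columns), their values in the value array `0`. All else is zero. -/
noncomputable def inputState {m n : ℕ} (A : Matrix (Fin m) (Fin n) ℝ) (e : Listing A) : State where
  idx := fun i => if i = 0 then m else if i = 1 then n else if i = 2 then nnz A else 0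
  val := fun _ => 0
  idxArr := fun arr t =>
    if h : t < nnz A then
      if arr = 0 then ((e ⟨t, h⟩).1.1 : ℕ) else if arr = 1 then ((e ⟨t, h⟩).1.2 : ℕ) else 0
    else 0
  valArr := fun arr t =>
    if h : t < nnz A then
      if arr = 0 then A (e ⟨t, h⟩).1.1 (e ⟨t, h⟩).1.2 else 0
    else 0
  drawn := 0
  queries := []

end RealRAM

/-- The bound `C · f · (log (f + 2)) ^ k`, for fixed `C` and `k`, expresses `Õ(f)`, that is,
`O(f · polylog f)`. -/
noncomputable def softO (C : ℝ) (k : ℕ) (f : ℝ) : ℝ := C * f * Real.log (f + 2) ^ k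

/-! The rank is found by binary search, where each question "is `r` at most the rank of `A`?" costs
one oracle call. Put n₀ = 2(m + n) and κ = n₀ - 2r. The input is padded to a symmetric matrix M of
order n₀ that carries `A` and its transpose, so that M has rank 2 rank(A), and M is bordered by a
sparse random n₀ × κ matrix W to B = [[M, W], [Wᵀ, 0]].

If r > rank(A), counting dimensions gives u ≠ 0 with uM = 0 and uW = 0 (`exists_left_kernel`). If r
≤ rank(A), fix a nonvanishing minor of order r. Exactly κ positions of M lie outside its rows and
columns. If W is the matrix of a perfect matching between these positions and the κ border columns,
then B is nonsingular (`det_bordered_ne_zero`). A row of W receives d Gaussians in random columns,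
with d of order log² N. By Hall's theorem the support then contains a matching with high probability
(`tapeLaw_not_matching_le`), and in that case det B is a nonzero polynomial in the Gaussians, hence
almost surely nonzero (`tapeLaw_det_eq_zero_le`).

Singularity has to be amplified to a gap for the right-hand side 𝟏. A row and a column with index 0
are added: the corner is 1, column 0 also carries Gaussians g_x scaled by the huge number H = 2^d,
and each entry v at (i, j) other than the corner is compensated by -v at (0, j). A row vector w then
acts through the differences w_i - w_0, except for the corner. So the new matrix is nonsingular if B
is (`det_matrix_ne_zero`). A kernel vector u as above yields the left kernel vector that equals 1 -
u_x/(GH) at the positions of M and 1 elsewhere, where G = ∑ g_x u_x. Since u can be chosen from W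
alone, it is independent of g, so |G| is unlikely to be tiny. The kernel vector is then nearly 𝟏,
and 𝟏 is nearly orthogonal to the column space (`aldNo_matrix`).

The failure events depend on the tape and not on the oracle, so a union bound over all rounds and
all r handles the adaptive choice of r. What remains is the verification of the program, by a
calculus `Spec` of postconditions with time bounds. -/

/-! ### The random tape: resampling, anticoncentration, zeros of polynomials -/

section

open MeasureTheory ProbabilityTheory
namespace RealRAM

instance : IsProbabilityMeasure tapeLaw := by unfold tapeLaw; infer_instance

open Classical in
/-- The tape `ω` with the contents of the cells in `G` replaced by those of `x`. -/
noncomputable def resample (G : Set ℕ) (x ω : Tape) : Tape := fun i => if i ∈ G then x i else ω i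

theorem resample_of_mem {G : Set ℕ} {i : ℕ} (h : i ∈ G) (x ω : Tape) : resample G x ω i = x i :=
  if_pos h

theorem resample_of_notMem {G : Set ℕ} {i : ℕ} (h : i ∉ G) (x ω : Tape) :
    resample G x ω i = ω i := if_neg h

theorem measurable_resample (G : Set ℕ) :
    Measurable (fun z : Tape × Tape => resample G z.2 z.1) := by
  refine measurable_pi_lambda _ fun i => ?_
  by_cases hi : i ∈ G
  · simp only [resample, hi, if_true]; fun_prop
  · simp only [resample, hi, if_false]; fun_prop

/-- By independence of the cells. On a finite box the preimage is the product of a box in the cells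
outside `G` and a box in the cells of `G`, and the two finite products of probabilities recombine.
-/
theorem map_resample_tapeLaw (G : Set ℕ) :
    (tapeLaw.prod tapeLaw).map (fun z : Tape × Tape => resample G z.2 z.1) = tapeLaw := by
  classical
  refine Measure.eq_infinitePi _ fun s t ht => ?_
  rw [Measure.map_apply (measurable_resample G) (MeasurableSet.pi s.countable_toSet fun i hi => ht i)]
  have hset : (fun z : Tape × Tape => resample G z.2 z.1) ⁻¹' (Set.pi s t) =
      (Set.pi (s.filter (· ∉ G)) t) ×ˢ (Set.pi (s.filter (· ∈ G)) t) := by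
    ext ⟨x, y⟩
    simp only [Set.mem_preimage, Set.mem_pi, Set.mem_prod, Finset.mem_coe, Finset.mem_filter]
    constructor
    · intro h
      refine ⟨fun i hi => ?_, fun i hi => ?_⟩
      · simpa [resample, hi.2] using h i hi.1
      · simpa [resample, hi.2] using h i hi.1
    · rintro ⟨h1, h2⟩ i hi
      by_cases hG : i ∈ G
      · simpa [resample, hG] using h2 i ⟨hi, hG⟩
      · simpa [resample, hG] using h1 i ⟨hi, hG⟩
  rw [hset, Measure.prod_prod]
  unfold tapeLaw
  rw [Measure.infinitePi_pi _ fun i _ => ht i, Measure.infinitePi_pi _ fun i _ => ht i, mul_comm]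
  exact Finset.prod_filter_mul_prod_filter_not s (· ∈ G) _

/-- Resampling the cells in `G`: a bound for every fixed content of the other cells suffices. -/
theorem tapeLaw_le_of_resample (G : Set ℕ) {E : Set Tape} (hE : MeasurableSet E)
    {p : ENNReal} (h : ∀ ω, tapeLaw {x | resample G x ω ∈ E} ≤ p) : tapeLaw E ≤ p := by
  rw [← map_resample_tapeLaw G, Measure.map_apply (measurable_resample G) hE,
    Measure.prod_apply (measurable_resample G hE)]
  calc _ ≤ ∫⁻ _, p ∂tapeLaw := lintegral_mono fun ω => h ω
    _ = p := by simp

/-- The density is at most 1/√(2π) < 1. -/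
theorem gaussianReal_le_volume (s : Set ℝ) : gaussianReal 0 1 s ≤ volume s := by
  rw [gaussianReal_apply 0 one_ne_zero]
  calc _ ≤ ∫⁻ _ in s, 1 := by
        refine lintegral_mono fun x => ?_
        rw [gaussianPDF, ENNReal.ofReal_le_one, gaussianPDFReal]
        have h1 : (1 : ℝ) ≤ √(2 * Real.pi * (1 : NNReal)) := by
          rw [Real.one_le_sqrt]
          have := Real.pi_gt_three
          push_cast; linarith
        have h2 : Real.exp (-(x - 0) ^ 2 / (2 * (1 : NNReal))) ≤ 1 := by
          rw [Real.exp_le_one_iff]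
          have := sq_nonneg (x - 0)
          push_cast; linarith
        calc _ ≤ (1 : ℝ) * 1 := mul_le_mul (inv_le_one_of_one_le₀ h1) h2 (Real.exp_nonneg _) zero_le_one
          _ = 1 := one_mul 1
    _ = volume s := by simp

theorem tapeLaw_fst_mem_le (i : ℕ) {s : Set ℝ} (hs : MeasurableSet s) :
    tapeLaw {ω | (ω i).1 ∈ s} ≤ volume s := by
  have h := (measurePreserving_eval_infinitePi (fun _ : ℕ =>
    (gaussianReal 0 1).prod (volume : Measure unitInterval)) i).measure_preimage
      (measurable_fst hs).nullMeasurableSet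
  calc tapeLaw {ω | (ω i).1 ∈ s} = ((gaussianReal 0 1).prod (volume : Measure unitInterval)) (Prod.fst ⁻¹' s) := h
    _ = gaussianReal 0 1 s := by
      rw [← Measure.map_apply measurable_fst hs, Measure.map_fst_prod]; simp
    _ ≤ volume s := gaussianReal_le_volume s

/-- A linear form with a coefficient `±1` in independent Gaussians is small with small probability. -/
theorem tapeLaw_abs_sum_lt {ι : Type*} [Fintype ι] (cell : ι → ℕ) (hc : Function.Injective cell)
    (u : ι → ℝ) (i : ι) (hu : |u i| = 1) (δ : ℝ) :
    tapeLaw {ω | |∑ k, (ω (cell k)).1 * u k| < δ} ≤ ENNReal.ofReal (2 * δ) := by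
  classical
  -- With all cells but `cell i` frozen, the rest of the sum is a constant `a`, and the coefficient
  -- ±1 forces the Gaussian into an interval of length 2δ.
  refine tapeLaw_le_of_resample {cell i} ?_ fun ω => ?_
  · exact measurableSet_lt (by fun_prop) measurable_const
  · set a := ∑ k ∈ Finset.univ.erase i, (ω (cell k)).1 * u k with ha
    have hui : u i * u i = 1 := by
      rw [← abs_mul_abs_self, hu, one_mul]
    have hsub : {x : Tape | resample {cell i} x ω ∈ {ω : Tape | |∑ k, (ω (cell k)).1 * u k| < δ}} ⊆
        {x | (x (cell i)).1 ∈ Set.Ioo (- a * u i - δ) (- a * u i + δ)} := by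
      intro x hx
      change |∑ k, (resample {cell i} x ω (cell k)).1 * u k| < δ at hx
      rw [← Finset.add_sum_erase _ _ (Finset.mem_univ i)] at hx
      have : ∑ k ∈ Finset.univ.erase i, (resample {cell i} x ω (cell k)).1 * u k = a := by
        refine Finset.sum_congr rfl fun k hk => ?_
        rw [resample_of_notMem]
        simpa using fun h => (Finset.ne_of_mem_erase hk) (hc h)
      rw [this, resample_of_mem (Set.mem_singleton _)] at hx
      have h2 : |(x (cell i)).1 + a * u i| < δ := by
        have : (x (cell i)).1 + a * u i = ((x (cell i)).1 * u i + a) * u i := by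
          linear_combination (-(x (cell i)).1) * hui
        rw [this, abs_mul, hu, mul_one]; exact hx
      rw [abs_lt] at h2
      constructor <;> linarith [h2.1, h2.2]
    refine (measure_mono hsub).trans ((tapeLaw_fst_mem_le _ measurableSet_Ioo).trans ?_)
    rw [Real.volume_Ioo]
    apply ENNReal.ofReal_le_ofReal; linarith

theorem measurable_eval_tape (P : MvPolynomial ℕ ℝ) :
    Measurable fun ω : Tape => MvPolynomial.eval (fun k => (ω k).1) P :=
  (MvPolynomial.continuous_eval P).measurable.comp (by fun_prop)

theorem exists_polynomial_eval_update (P : MvPolynomial ℕ ℝ) (x : ℕ → ℝ) (a : ℕ) :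
    ∃ p : Polynomial ℝ, ∀ t, p.eval t = MvPolynomial.eval (Function.update x a t) P := by
  classical
  refine ⟨MvPolynomial.aeval (fun i => if i = a then Polynomial.X else Polynomial.C (x i)) P, fun t => ?_⟩
  have h : (Polynomial.evalRingHom t).comp
      (MvPolynomial.aeval (R := ℝ) (fun i => if i = a then Polynomial.X else Polynomial.C (x i))).toRingHom =
      MvPolynomial.eval (Function.update x a t) := by
    apply MvPolynomial.ringHom_ext
    · intro r; simp
    · intro i; by_cases h : i = a <;> simp [h]
  exact congrArg (fun f => f P) h

/-- Starting from a point where `P` does not vanish, the cells are randomized one at a time. In the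
newly randomized cell `P` is a univariate polynomial, nonzero because it does not vanish at the old
content, so its roots form a finite and hence null set. -/
theorem ae_eval_resample_ne_zero (P : MvPolynomial ℕ ℝ) (F : Finset ℕ) (x : Tape)
    (hx : MvPolynomial.eval (fun k => (x k).1) P ≠ 0) :
    tapeLaw {ω | MvPolynomial.eval (fun k => (resample F ω x k).1) P = 0} = 0 := by
  classical
  induction F using Finset.induction_on with
  | empty =>
    have : ∀ ω, resample ((∅ : Finset ℕ) : Set ℕ) ω x = x := fun ω => by ext1 k; simp [resample]
    simp only [this, hx, Set.ofPred_false, measure_empty]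
  | insert a F ha ih =>
    have hmeas : ∀ S : Set ℕ, MeasurableSet
        {ω : Tape | MvPolynomial.eval (fun k => (resample S ω x k).1) P = 0} := by
      intro S
      have h := (measurable_eval_tape P).comp
        ((measurable_resample S).comp (measurable_prodMk_left (x := x)))
      exact measurableSet_eq_fun h measurable_const
    set Z : Set Tape := {ω | MvPolynomial.eval (fun k => (resample F ω x k).1) P = 0} with hZ
    set E : Set Tape :=
      {ω | MvPolynomial.eval (fun k => (resample (insert a F : Finset ℕ) ω x k).1) P = 0} with hE
    have hupd : ∀ ω z : Tape,
        (fun k => (resample (insert a F : Finset ℕ) (resample {a} z ω) x k).1) =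
        Function.update (fun k => (resample F ω x k).1) a (z a).1 := by
      intro ω z; ext k
      by_cases hk : k = a
      · subst hk; simp [resample]
      · simp [resample, hk]
    have hsame : ∀ ω z : Tape, (fun k => (resample F (resample {a} z ω) x k).1) =
        fun k => (resample F ω x k).1 := by
      intro ω z; ext k
      by_cases hk : k = a
      · subst hk; simp [resample, ha]
      · simp [resample, hk]
    -- Off `Z` the value with only `F` randomized is nonzero. Membership in `Z` does not depend on
    -- cell `a`, so that cell can be resampled with `Z` fixed.
    have key : tapeLaw (E \ Z) ≤ 0 := by
      refine tapeLaw_le_of_resample {a} ((hmeas _).diff (hmeas _)) fun ω => ?_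
      by_cases hω : ω ∈ Z
      · have : {z : Tape | resample {a} z ω ∈ E \ Z} = ∅ := by
          refine Set.eq_empty_of_forall_notMem fun z hz => hz.2 ?_
          change MvPolynomial.eval _ P = 0
          rw [hsame]; exact hω
        rw [this]; simp
      · obtain ⟨p, hp⟩ := exists_polynomial_eval_update P (fun k => (resample F ω x k).1) a
        have hp0 : p ≠ 0 := by
          rintro rfl
          apply hω
          have h := hp (x a).1
          rw [Polynomial.eval_zero] at h
          change MvPolynomial.eval _ P = 0
          have h2 : (fun k => (resample F ω x k).1) =
              Function.update (fun k => (resample F ω x k).1) a (x a).1 := by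
            ext k
            by_cases hk : k = a
            · subst hk; simp [resample, ha]
            · simp [hk]
          rw [h2, ← h]
        have hfin := Polynomial.finite_setOfPred_isRoot hp0
        refine (measure_mono (t := {z : Tape | (z a).1 ∈ {t | p.IsRoot t}}) ?_).trans
          ((tapeLaw_fst_mem_le a hfin.measurableSet).trans (hfin.measure_zero _).le)
        intro z hz
        have h1 : MvPolynomial.eval _ P = 0 := hz.1
        rw [hupd, ← hp] at h1
        exact h1
    refine le_antisymm ?_ zero_le
    calc tapeLaw E ≤ tapeLaw (E \ Z) + tapeLaw Z := by
          refine (measure_mono (fun ω hω => ?_)).trans (measure_union_le _ _)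
          by_cases h : ω ∈ Z
          · exact Or.inr h
          · exact Or.inl ⟨hω, h⟩
      _ ≤ 0 := by rw [ih]; simpa using key

/-- A polynomial in the Gaussian cells that does not vanish identically is almost surely nonzero. -/
theorem tapeLaw_eval_eq_zero (P : MvPolynomial ℕ ℝ) (x : ℕ → ℝ) (hx : MvPolynomial.eval x P ≠ 0) :
    tapeLaw {ω | MvPolynomial.eval (fun k => (ω k).1) P = 0} = 0 := by
  classical
  -- Randomizing all variables that occur in `P` erases the base point `x`.
  rw [← ae_eval_resample_ne_zero P P.vars (fun k => (x k, 0)) hx]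
  congr 1; ext ω
  have : MvPolynomial.eval (fun k => (ω k).1) P =
      MvPolynomial.eval (fun k => (resample P.vars ω (fun k => (x k, 0)) k).1) P := by
    refine MvPolynomial.hom_congr_vars (by ext; simp) (fun i hi _ => ?_) rfl
    simp [resample, hi]
  change _ = _ ↔ _ = _
  rw [this]
end RealRAM

end

/-! ### Linear algebra of the bordered symmetric padding -/

section

open Matrix

namespace Matrix

theorem exists_linearIndependent_rows {K ι κ : Type*} [Field K] [Fintype ι] [Fintype κ]
    (A : Matrix ι κ K) {r : ℕ} (hr : r ≤ A.rank) :
    ∃ σ : Fin r → ι, LinearIndependent K (A.submatrix σ id).row := by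
  rw [Matrix.rank_eq_finrank_span_row] at hr
  obtain ⟨f, hf, -, hli⟩ := Submodule.exists_fun_fin_finrank_span_eq K (Set.range A.row)
  choose σ hσ using hf
  refine ⟨fun k => σ (Fin.castLE hr k), ?_⟩
  have h : (A.submatrix (fun k => σ (Fin.castLE hr k)) id).row = f ∘ Fin.castLE hr :=
    funext fun k => hσ (Fin.castLE hr k)
  rw [h]
  exact hli.comp (Fin.castLE hr) (Fin.castLE_injective hr)

/-- A matrix of rank at least `r` has a nonvanishing minor of order `r`. -/
theorem exists_det_submatrix_ne_zero {K ι κ : Type*} [Field K] [Fintype ι] [Fintype κ]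
    (A : Matrix ι κ K) {r : ℕ} (hr : r ≤ A.rank) :
    ∃ (σ : Fin r → ι) (τ : Fin r → κ), (A.submatrix σ τ).det ≠ 0 := by
  obtain ⟨σ, hσ⟩ := A.exists_linearIndependent_rows hr
  have h1 : r ≤ (A.submatrix σ id)ᵀ.rank := by
    rw [Matrix.rank_transpose, hσ.rank_matrix, Fintype.card_fin]
  obtain ⟨τ, hτ⟩ := (A.submatrix σ id)ᵀ.exists_linearIndependent_rows h1
  refine ⟨σ, τ, ?_⟩
  have h2 : IsUnit (A.submatrix σ τ)ᵀ := by
    rw [← Matrix.linearIndependent_rows_iff_isUnit]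
    exact hτ
  rw [← Matrix.det_transpose]
  exact ((Matrix.isUnit_iff_isUnit_det _).1 h2).ne_zero

variable {ι κ μ ν : Type*} [Fintype ι] [Fintype κ] [Fintype μ] [Fintype ν] [DecidableEq ι]

/-- The symmetric matrix that carries `A` in the rows `f` and columns `g`, and its transpose in the
rows `g` and columns `f`. -/
def symmPad (f : μ → ι) (g : ν → ι) (A : Matrix μ ν ℝ) : Matrix ι ι ℝ :=
  fun i j => ∑ a, ∑ b, ((if f a = i ∧ g b = j then A a b else 0) +
    if g b = i ∧ f a = j then A a b else 0)

theorem vecMul_symmPad (f : μ → ι) (g : ν → ι) (A : Matrix μ ν ℝ) (u : ι → ℝ) (j : ι) :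
    (u ᵥ* symmPad f g A) j = ∑ a, ∑ b, ((if g b = j then u (f a) * A a b else 0) +
      if f a = j then u (g b) * A a b else 0) := by
  simp only [vecMul, dotProduct, symmPad, Finset.mul_sum]
  rw [Finset.sum_comm]
  refine Finset.sum_congr rfl fun a _ => ?_
  rw [Finset.sum_comm]
  refine Finset.sum_congr rfl fun b _ => ?_
  simp only [mul_add, Finset.sum_add_distrib, ite_and, mul_ite, mul_zero]
  simp

theorem vecMul_symmPad_left {f : μ → ι} {g : ν → ι} (hf : Function.Injective f)
    (hfg : ∀ a b, f a ≠ g b) (A : Matrix μ ν ℝ) (u : ι → ℝ) (a : μ) :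
    (u ᵥ* symmPad f g A) (f a) = (A *ᵥ (u ∘ g)) a := by
  classical
  rw [vecMul_symmPad]
  simp only [hf.eq_iff, (hfg _ _).symm, if_false, zero_add]
  rw [Finset.sum_eq_single a (fun c _ h => by simp [h]) (by simp)]
  simp [mulVec, dotProduct, mul_comm]

theorem vecMul_symmPad_right {f : μ → ι} {g : ν → ι} (hg : Function.Injective g)
    (hfg : ∀ a b, f a ≠ g b) (A : Matrix μ ν ℝ) (u : ι → ℝ) (b : ν) :
    (u ᵥ* symmPad f g A) (g b) = ((u ∘ f) ᵥ* A) b := by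
  classical
  rw [vecMul_symmPad]
  simp only [hg.eq_iff, (hfg _ _), if_false, add_zero]
  simp [vecMul, dotProduct]

theorem vecMul_symmPad_eq_zero {f : μ → ι} {g : ν → ι} (hf : Function.Injective f)
    (hg : Function.Injective g) (hfg : ∀ a b, f a ≠ g b) (A : Matrix μ ν ℝ) (u : ι → ℝ)
    (h1 : A *ᵥ (u ∘ g) = 0) (h2 : (u ∘ f) ᵥ* A = 0) : u ᵥ* symmPad f g A = 0 := by
  classical
  ext j
  by_cases hj : ∃ a, f a = j
  · obtain ⟨a, rfl⟩ := hj
    rw [vecMul_symmPad_left hf hfg, h1]; rfl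
  by_cases hj' : ∃ b, g b = j
  · obtain ⟨b, rfl⟩ := hj'
    rw [vecMul_symmPad_right hg hfg, h2]; rfl
  push Not at hj hj'
  rw [vecMul_symmPad]
  simp [hj, hj']

/-- The symmetric matrix bordered by `W`. -/
abbrev bordered (M : Matrix ι ι ℝ) (W : Matrix ι κ ℝ) : Matrix (ι ⊕ κ) (ι ⊕ κ) ℝ :=
  fromBlocks M W Wᵀ 0

/-- The requirements A(u ∘ g) = 0, (u ∘ f)A = 0 and uW = 0 amount to at most rank(A) + rank(A) + |κ|
linear conditions. Taking the ranges of `A` and its transpose as codomains makes the count use ranks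
instead of sizes. The norm is the maximum norm, so the normalized `u` has an entry ±1. -/
theorem exists_left_kernel {f : μ → ι} {g : ν → ι} (hf : Function.Injective f)
    (hg : Function.Injective g) (hfg : ∀ a b, f a ≠ g b) (A : Matrix μ ν ℝ) (W : Matrix ι κ ℝ)
    (h : 2 * A.rank + Fintype.card κ < Fintype.card ι) :
    ∃ u : ι → ℝ, ‖u‖ = 1 ∧ u ᵥ* symmPad f g A = 0 ∧ u ᵥ* W = 0 := by
  classical
  let L : (ι → ℝ) →ₗ[ℝ] (LinearMap.range A.mulVecLin) × (LinearMap.range Aᵀ.mulVecLin) × (κ → ℝ) :=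
    (A.mulVecLin.rangeRestrict ∘ₗ LinearMap.funLeft ℝ ℝ g).prod
      ((Aᵀ.mulVecLin.rangeRestrict ∘ₗ LinearMap.funLeft ℝ ℝ f).prod Wᵀ.mulVecLin)
  have hL : LinearMap.ker L ≠ ⊥ := by
    apply LinearMap.ker_ne_bot_of_finrank_lt
    rw [Module.finrank_prod, Module.finrank_prod, Module.finrank_fintype_fun_eq_card,
      Module.finrank_fintype_fun_eq_card]
    change A.rank + (Aᵀ.rank + _) < _
    rw [rank_transpose]; omega
  obtain ⟨u, hu, hu0⟩ := (Submodule.ne_bot_iff _).1 hL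
  have hn : ‖u‖ ≠ 0 := norm_ne_zero_iff.2 hu0
  rw [LinearMap.mem_ker] at hu
  have e1 : A *ᵥ (u ∘ g) = 0 := congrArg (fun z => (z.1 : μ → ℝ)) hu
  have e2 : Aᵀ *ᵥ (u ∘ f) = 0 := congrArg (fun z => (z.2.1 : ν → ℝ)) hu
  have e3 : Wᵀ *ᵥ u = 0 := congrArg (fun z => z.2.2) hu
  rw [mulVec_transpose] at e2 e3
  refine ⟨‖u‖⁻¹ • u, ?_, ?_, ?_⟩
  · rw [norm_smul, norm_inv, norm_norm, inv_mul_cancel₀ hn]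
  · rw [smul_vecMul, vecMul_symmPad_eq_zero hf hg hfg A u e1 e2, smul_zero]
  · rw [smul_vecMul, e3, smul_zero]

/-- Let S be the set of positions outside the chosen minor; `φ` matches S bijectively with the
border columns, and W is the matrix of this matching. For a left kernel vector (u, z), uW = 0 kills
u on S. Off S the rows of W vanish, so there the remaining equations say that the nonsingular minor
annihilates the two surviving parts of u, one from each side. Hence u = 0, and then zWᵀ = 0 gives z
= 0 because every border column is matched. -/
theorem det_bordered_ne_zero [DecidableEq κ] {f : μ → ι} {g : ν → ι} (hf : Function.Injective f)
    (hg : Function.Injective g) (hfg : ∀ a b, f a ≠ g b) (A : Matrix μ ν ℝ) {r : ℕ}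
    (σ : Fin r → μ) (τ : Fin r → ν) (hdet : (A.submatrix σ τ).det ≠ 0)
    (W : Matrix ι κ ℝ) (φ : ι → κ)
    (hW : ∀ i c, W i c = if (∀ k, f (σ k) ≠ i) ∧ (∀ k, g (τ k) ≠ i) ∧ φ i = c then 1 else 0)
    (hinj : ∀ i j, (∀ k, f (σ k) ≠ i) → (∀ k, g (τ k) ≠ i) → (∀ k, f (σ k) ≠ j) →
      (∀ k, g (τ k) ≠ j) → φ i = φ j → i = j)
    (hφ : ∀ c, ∃ i, (∀ k, f (σ k) ≠ i) ∧ (∀ k, g (τ k) ≠ i) ∧ φ i = c) :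
    (bordered (symmPad f g A) W).det ≠ 0 := by
  intro h0
  obtain ⟨v, hv, hv0⟩ := exists_vecMul_eq_zero_iff.2 h0
  apply hv
  have hσ : Function.Injective σ := fun k l hkl => by
    by_contra hne
    exact hdet (det_zero_of_row_eq hne (by ext j; simp [hkl]))
  have hτ : Function.Injective τ := fun k l hkl => by
    by_contra hne
    exact hdet (det_zero_of_column_eq hne (by simp [hkl]))
  set u : ι → ℝ := v ∘ Sum.inl with hu
  set z : κ → ℝ := v ∘ Sum.inr with hz
  have h1 : u ᵥ* symmPad f g A + z ᵥ* Wᵀ = 0 := by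
    ext i
    have := congrFun hv0 (Sum.inl i)
    simpa [vecMul_fromBlocks] using this
  have h2 : u ᵥ* W = 0 := by
    ext c
    have := congrFun hv0 (Sum.inr c)
    simpa [vecMul_fromBlocks] using this
  have hS : ∀ i, (∀ k, f (σ k) ≠ i) → (∀ k, g (τ k) ≠ i) → u i = 0 := by
    intro i hi hi'
    have h := congrFun h2 (φ i)
    simp only [vecMul, dotProduct, Pi.zero_apply] at h
    rw [Finset.sum_eq_single i] at h
    · simpa [hW, hi, hi'] using h
    · intro j _ hji
      rw [hW, if_neg, mul_zero]
      rintro ⟨ha, hb, hc⟩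
      exact hji (hinj j i ha hb hi hi' hc)
    · simp
  have hT : ∀ i, ((∃ k, f (σ k) = i) ∨ ∃ k, g (τ k) = i) → (u ᵥ* symmPad f g A) i = 0 := by
    intro i hi
    have h := congrFun h1 i
    rw [Pi.add_apply, vecMul_transpose] at h
    have : (W *ᵥ z) i = 0 := by
      refine Finset.sum_eq_zero fun c _ => ?_
      change W i c * z c = 0
      rw [hW, if_neg, zero_mul]
      rintro ⟨ha, hb, -⟩
      rcases hi with ⟨k, hk⟩ | ⟨k, hk⟩
      exacts [ha k hk, hb k hk]
    simpa [this] using h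
  have hgz : (A.submatrix σ τ) *ᵥ (u ∘ g ∘ τ) = 0 := by
    ext k
    have h := hT (f (σ k)) (Or.inl ⟨k, rfl⟩)
    rw [vecMul_symmPad_left hf hfg] at h
    rw [Pi.zero_apply, ← h]
    -- Columns outside `τ` sit at positions of S, where `u` is already zero, so the full sum shrinks
    -- to the minor.
    refine Fintype.sum_of_injective τ hτ _ _ (fun b hb => ?_) fun _ => rfl
    have : u (g b) = 0 := hS _ (fun k => hfg _ _) fun k hk => hb ⟨k, hg hk⟩
    simp [this]
  have hfz : (u ∘ f ∘ σ) ᵥ* (A.submatrix σ τ) = 0 := by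
    ext k
    have h := hT (g (τ k)) (Or.inr ⟨k, rfl⟩)
    rw [vecMul_symmPad_right hg hfg] at h
    rw [Pi.zero_apply, ← h]
    refine Fintype.sum_of_injective σ hσ _ _ (fun b hb => ?_) fun _ => rfl
    have : u (f b) = 0 := hS _ (fun k hk => hb ⟨k, hf hk⟩) fun k => (hfg _ _).symm
    simp [this]
  have hg0 := eq_zero_of_mulVec_eq_zero hdet hgz
  have hf0 := eq_zero_of_vecMul_eq_zero hdet hfz
  have hu0 : u = 0 := by
    ext i
    by_cases hi : ∃ k, f (σ k) = i
    · obtain ⟨k, rfl⟩ := hi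
      exact congrFun hf0 k
    by_cases hi' : ∃ k, g (τ k) = i
    · obtain ⟨k, rfl⟩ := hi'
      exact congrFun hg0 k
    push Not at hi hi'
    exact hS i hi hi'
  have hz0 : z = 0 := by
    ext c
    obtain ⟨i, hi, hi', hic⟩ := hφ c
    have h := congrFun h1 i
    rw [hu0, zero_vecMul, zero_add, vecMul_transpose] at h
    refine Eq.trans ?_ h
    change z c = ∑ d, W i d * z d
    rw [Finset.sum_eq_single c]
    · rw [hW, if_pos ⟨hi, hi', hic⟩, one_mul]
    · intro d _ hd
      rw [hW, if_neg, zero_mul]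
      rintro ⟨-, -, hd'⟩
      exact hd (hd' ▸ hic)
    · simp
  ext x
  cases x with
  | inl i => exact congrFun hu0 i
  | inr c => exact congrFun hz0 c

end Matrix

end

/-! ### NO instances from left kernel vectors, and the test matrix as a list of triples -/

section

open Matrix

/-- Since wQ = 0, the inner product of w with Qx - 𝟏 is -∑ wᵢ whatever x is. Cauchy–Schwarz then
bounds the residual below by √D (1 - η)/(1 + η), which exceeds (1 - ε)√D once 2η < ε. -/
theorem aldNo_of_left_kernel {D : ℕ} (Q : Matrix (Fin D) (Fin D) ℝ) (hD : 0 < D) (w : Fin D → ℝ)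
    (hw : w ᵥ* Q = 0) {η ε : ℝ} (hη : ∀ i, |w i - 1| ≤ η) (hε : 2 * η < ε) (E : ℕ → ℝ)
    (hE : E D = 1 - ε) : ALDNo E Q 1 := by
  intro x
  have hη0 : 0 ≤ η := (abs_nonneg _).trans (hη ⟨0, hD⟩)
  have hDpos : (0 : ℝ) < √D := Real.sqrt_pos.2 (by exact_mod_cast hD)
  have hone : ‖WithLp.toLp 2 (1 : Fin D → ℝ)‖ = √D := by
    rw [EuclideanSpace.norm_eq]; simp
  have hnw : ‖WithLp.toLp 2 w‖ ≤ (1 + η) * √D := by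
    rw [EuclideanSpace.norm_eq]
    refine Real.sqrt_le_iff.2 ⟨by positivity, ?_⟩
    rw [mul_pow, Real.sq_sqrt (Nat.cast_nonneg _)]
    calc ∑ i, ‖w i‖ ^ 2 ≤ ∑ _i : Fin D, (1 + η) ^ 2 := by
          refine Finset.sum_le_sum fun i _ => ?_
          have h1 := abs_le.1 (hη i)
          have : |w i| ≤ 1 + η := abs_le.2 ⟨by linarith [h1.1], by linarith [h1.2]⟩
          exact pow_le_pow_left₀ (norm_nonneg _) this 2
      _ = _ := by simp; ring
  set z : Fin D → ℝ := Q *ᵥ x - 1 with hz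
  have hdot : w ⬝ᵥ z = - ∑ i, w i := by
    rw [hz, dotProduct_sub, dotProduct_mulVec, hw, zero_dotProduct, dotProduct_one]; simp
  have hsum : (1 - η) * D ≤ ∑ i, w i := by
    calc (1 - η) * D = ∑ _i : Fin D, (1 - η) := by simp; ring
      _ ≤ _ := Finset.sum_le_sum fun i _ => by linarith [(abs_le.1 (hη i)).1]
  have hcs : |w ⬝ᵥ z| ≤ ‖WithLp.toLp 2 w‖ * ‖WithLp.toLp 2 z‖ := by
    have := abs_real_inner_le_norm (WithLp.toLp 2 w) (WithLp.toLp 2 z)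
    rwa [EuclideanSpace.inner_toLp_toLp, star_trivial, dotProduct_comm] at this
  rw [hdot, abs_neg] at hcs
  rw [hone, hE]
  by_contra! hle
  have h1 : (1 - η) * D ≤ (1 + η) * √D * ‖WithLp.toLp 2 z‖ :=
    (hsum.trans (le_abs_self _)).trans (hcs.trans (mul_le_mul_of_nonneg_right hnw (norm_nonneg _)))
  have h2 : (1 + η) * √D * ‖WithLp.toLp 2 z‖ ≤ (1 + η) * √D * ((1 - ε) * √D) :=
    mul_le_mul_of_nonneg_left hle (by positivity)
  have h3 : (D : ℝ) = √D * √D := (Real.mul_self_sqrt (Nat.cast_nonneg _)).symm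
  have h4 : 0 < √D * √D := by positivity
  have h5 : 0 < (1 - η) - (1 + η) * (1 - ε) := by nlinarith [mul_nonneg hη0 hη0]
  have h1' : (1 - η) * (√D * √D) ≤ (1 + η) * √D * ‖WithLp.toLp 2 z‖ := by rwa [← h3]
  nlinarith [mul_pos h4 h5]

namespace RealRAM

/-- An entry `(row, column, value)` of a matrix in coordinate form. -/
abbrev Triple : Type := ℕ × ℕ × ℝ

def Query.triples (q : Query) : List Triple :=
  (List.range q.len).map fun t => (q.row t, q.col t, q.val t)

theorem Query.length_triples (q : Query) : q.triples.length = q.len := by simp [Query.triples]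

/-- Column `j` of the product of the row vector `w` and the matrix listed in `l`. -/
noncomputable def colSum (w : ℕ → ℝ) (j : ℕ) (l : List Triple) : ℝ :=
  (l.map fun t => if t.2.1 = j then w t.1 * t.2.2 else 0).sum

theorem colSum_append (w : ℕ → ℝ) (j : ℕ) (l l' : List Triple) :
    colSum w j (l ++ l') = colSum w j l + colSum w j l' := by simp [colSum]

theorem colSum_flatMap_range (w : ℕ → ℝ) (j : ℕ) (f : ℕ → List Triple) (k : ℕ) :
    colSum w j ((List.range k).flatMap f) = ∑ x ∈ Finset.range k, colSum w j (f x) := by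
  induction k with
  | zero => simp [colSum]
  | succ k ih => rw [List.range_succ, List.flatMap_append, colSum_append, ih,
      Finset.sum_range_succ, List.flatMap_singleton]

theorem sum_map_range {M : Type*} [AddCommMonoid M] (f : ℕ → M) (k : ℕ) :
    ((List.range k).map f).sum = ∑ x ∈ Finset.range k, f x := rfl

/-- Only row indices need to be in range: a triple whose column is out of range contributes to
neither side. -/
theorem Query.vecMul_matrix (q : Query) (hq : ∀ t ∈ q.triples, t.1 < q.dim) (w : ℕ → ℝ)
    (j : Fin q.dim) :
    ((fun i : Fin q.dim => w i) ᵥ* q.matrix) j = colSum w j q.triples := by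
  have h : ∀ t ∈ Finset.range q.len, q.row t < q.dim := fun t ht =>
    hq (q.row t, q.col t, q.val t)
      (List.mem_map.2 ⟨t, List.mem_range.2 (Finset.mem_range.1 ht), rfl⟩)
  rw [colSum, Query.triples, List.map_map, sum_map_range]
  simp only [vecMul, dotProduct, Query.matrix, Finset.mul_sum]
  rw [Finset.sum_comm]
  refine Finset.sum_congr rfl fun t ht => ?_
  rw [Finset.sum_eq_single (⟨q.row t, h t ht⟩ : Fin q.dim)]
  · simp
  · intro i _ hi
    rw [if_neg, mul_zero]
    rintro ⟨h1, -⟩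
    exact hi (Fin.ext h1.symm)
  · simp

/-- The entry `v` at `(i, j)` together with its compensation in row `0`. -/
noncomputable def balanced (i j : ℕ) (v : ℝ) : List Triple := [(i, j, v), (0, j, 0 - v)]

/-- This is the purpose of the compensation: a constant vector `w` annihilates each balanced pair,
so only the differences from `w 0` matter. -/
theorem colSum_balanced (w : ℕ → ℝ) (j i k : ℕ) (v : ℝ) :
    colSum w j (balanced i k v) = if k = j then (w i - w 0) * v else 0 := by
  by_cases h : k = j <;> simp [balanced, colSum, h]
  ring

/-- The entries that the row `x` of the bordered matrix contributes: its Gaussian `g`, and the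
random entries `y k` in the random columns `c k`. -/
noncomputable def borderTriples (n₀ d : ℕ) (H : ℝ) (x : ℕ) (g : ℝ) (c : ℕ → ℕ) (y : ℕ → ℝ) :
    List Triple :=
  balanced (x + 1) 0 (g * H) ++ (List.range d).flatMap fun k =>
    balanced (x + 1) (c k + 1 + n₀) (y k) ++ balanced (c k + 1 + n₀) (x + 1) (y k)

/-- The two entries contributed by a nonzero entry of the input matrix. -/
noncomputable def entryTriples (s : ℕ) (row col : ℕ) (v : ℝ) : List Triple :=
  balanced (row + 1) (col + 1 + s) v ++ balanced (col + 1 + s) (row + 1) v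

/-- The matrix of the rank test, in coordinate form. -/
noncomputable def testTriples (N s n₀ d : ℕ) (H : ℝ) (row col : ℕ → ℕ) (v : ℕ → ℝ) (g : ℕ → ℝ)
    (c : ℕ → ℕ → ℕ) (y : ℕ → ℕ → ℝ) : List Triple :=
  (0, 0, 1) :: ((List.range N).flatMap (fun t => entryTriples s (row t) (col t) (v t)) ++
    (List.range n₀).flatMap fun x => borderTriples n₀ d H x (g x) (c x) (y x))

section testTriples
variable {N s n₀ d : ℕ} {H : ℝ} {row col : ℕ → ℕ} {v : ℕ → ℝ} {g : ℕ → ℝ}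
    {c : ℕ → ℕ → ℕ} {y : ℕ → ℕ → ℝ}

theorem colSum_testTriples (w : ℕ → ℝ) (j : ℕ) :
    colSum w j (testTriples N s n₀ d H row col v g c y) = (if j = 0 then w 0 else 0) +
      (∑ t ∈ Finset.range N, ((if col t + 1 + s = j then (w (row t + 1) - w 0) * v t else 0) +
        if row t + 1 = j then (w (col t + 1 + s) - w 0) * v t else 0) +
      ∑ x ∈ Finset.range n₀, ((if 0 = j then (w (x + 1) - w 0) * (g x * H) else 0) +
        ∑ k ∈ Finset.range d,
          ((if c x k + 1 + n₀ = j then (w (x + 1) - w 0) * y x k else 0) +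
            if x + 1 = j then (w (c x k + 1 + n₀) - w 0) * y x k else 0))) := by
  have h0 : ∀ l, colSum w j ((0, 0, 1) :: l) = (if j = 0 then w 0 else 0) + colSum w j l := by
    intro l; simp [colSum, eq_comm]
  rw [testTriples, h0, colSum_append, colSum_flatMap_range, colSum_flatMap_range]
  simp only [entryTriples, borderTriples, colSum_append, colSum_balanced, colSum_flatMap_range]

theorem length_flatMap_range (f : ℕ → List Triple) (a k : ℕ) (h : ∀ x, (f x).length = a) :
    ((List.range k).flatMap f).length = k * a := by
  simp [List.length_flatMap, h]

theorem length_testTriples :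
    (testTriples N s n₀ d H row col v g c y).length = N * 4 + n₀ * (2 + d * 4) + 1 := by
  have hb : ∀ i j v, (balanced i j v).length = 2 := fun _ _ _ => rfl
  rw [testTriples, List.length_cons, List.length_append, length_flatMap_range _ 4,
    length_flatMap_range _ (2 + d * 4)]
  · intro x
    rw [borderTriples, List.length_append, length_flatMap_range _ 4, hb]
    intro k; simp [hb]
  · intro t; simp [entryTriples, hb]

theorem lt_of_mem_testTriples {D : ℕ} (hD : n₀ < D) (hrow : ∀ t < N, row t < n₀)
    (hcol : ∀ t < N, col t + s < n₀) (hc : ∀ x k, c x k + 1 + n₀ < D) :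
    ∀ t ∈ testTriples N s n₀ d H row col v g c y, t.1 < D := by
  intro t ht
  simp only [testTriples, entryTriples, borderTriples, balanced, List.mem_cons, List.mem_append,
    List.mem_flatMap, List.mem_range, List.not_mem_nil, or_false] at ht
  rcases ht with rfl | ⟨x, hx, h⟩ | ⟨x, hx, h⟩
  · exact lt_of_le_of_lt (Nat.zero_le _) hD
  · have := hrow x hx
    have := hcol x hx
    rcases h with (rfl | rfl) | rfl | rfl <;> dsimp only <;> omega
  · rcases h with (rfl | rfl) | ⟨k, hk, h⟩
    · dsimp only; omega
    · dsimp only; omega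
    · have := hc x k
      rcases h with (rfl | rfl) | rfl | rfl <;> dsimp only <;> omega

end testTriples

/-- The listing runs through each nonzero position once, and `hF` discards the zero entries; the
order of the list plays no role. -/
theorem sum_listing {m n : ℕ} (A : Matrix (Fin m) (Fin n) ℝ) (e : Listing A)
    (F : ℕ → ℕ → ℝ → ℝ) (hF : ∀ a b, F a b 0 = 0) :
    ∑ t ∈ Finset.range (nnz A), F ((inputState A e).idxArr 0 t) ((inputState A e).idxArr 1 t)
      ((inputState A e).valArr 0 t) = ∑ a : Fin m, ∑ b : Fin n, F a b (A a b) := by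
  classical
  rw [Finset.sum_range, ← Fintype.sum_prod_type' (f := fun (a : Fin m) (b : Fin n) => F a b (A a b))]
  have h1 : ∀ t : Fin (nnz A), F ((inputState A e).idxArr 0 t) ((inputState A e).idxArr 1 t)
      ((inputState A e).valArr 0 t) = F (e t).1.1 (e t).1.2 (A (e t).1.1 (e t).1.2) := by
    intro t; simp [inputState]
  rw [Finset.sum_congr rfl fun t _ => h1 t]
  refine Fintype.sum_of_injective (fun t => (e t).1)
    (Subtype.val_injective.comp e.injective) _ _ (fun p hp => ?_) fun _ => rfl
  have : A p.1 p.2 = 0 := by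
    by_contra h
    exact hp ⟨e.symm ⟨p, h⟩, by simp⟩
  rw [this, hF]

/-- Each nonzero position is hit by some triple, and a triple has only one position. -/
theorem nnz_matrix_le (q : Query) : nnz q.matrix ≤ q.len := by
  classical
  have h : ∀ p : {p : Fin q.dim × Fin q.dim // q.matrix p.1 p.2 ≠ 0},
      ∃ t : Fin q.len, q.row t = p.1.1 ∧ q.col t = p.1.2 := by
    rintro ⟨p, hp⟩
    obtain ⟨t, ht, hne⟩ := Finset.exists_ne_zero_of_sum_ne_zero hp
    refine ⟨⟨t, Finset.mem_range.1 ht⟩, ?_⟩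
    by_contra hcon
    exact hne (if_neg hcon)
  choose f hf using h
  have hinj : Function.Injective f := by
    intro p p' hpp
    have h1 := hf p
    have h2 := hf p'
    rw [hpp] at h1
    ext
    · exact h1.1.symm.trans h2.1
    · exact h1.2.symm.trans h2.2
  simpa [nnz] using Nat.card_le_card_of_injective f hinj

end RealRAM

end

/-! ### The test matrix inherits regularity or a near-constant kernel vector -/

section

open Matrix
namespace RealRAM

/-- The position of row `a` of an `m × n` matrix in its symmetric padding. -/
def rowPos {m n : ℕ} (a : Fin m) : Fin ((m + n) + (m + n)) := ⟨a, by omega⟩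

/-- The position of column `b` of an `m × n` matrix in its symmetric padding. -/
def colPos {m n : ℕ} (b : Fin n) : Fin ((m + n) + (m + n)) := ⟨b + (m + n), by omega⟩

theorem rowPos_injective {m n : ℕ} : Function.Injective (rowPos (m := m) (n := n)) := by
  intro a b h; simpa [rowPos, Fin.ext_iff] using h

theorem colPos_injective {m n : ℕ} : Function.Injective (colPos (m := m) (n := n)) := by
  intro a b h; simpa [colPos, Fin.ext_iff] using h

theorem rowPos_ne_colPos {m n : ℕ} (a : Fin m) (b : Fin n) : rowPos (n := n) a ≠ colPos b := by
  intro h; simp only [rowPos, colPos, Fin.mk.injEq] at h; omega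

/-- The symmetric padding of `A`. -/
noncomputable def pad {m n : ℕ} (A : Matrix (Fin m) (Fin n) ℝ) :
    Matrix (Fin ((m + n) + (m + n))) (Fin ((m + n) + (m + n))) ℝ :=
  symmPad rowPos colPos A

/-- The matrix with `d` entries `y x k` in the columns `c x k` of each row `x`. -/
def sparse (n₀ κ d : ℕ) (c : ℕ → ℕ → ℕ) (y : ℕ → ℕ → ℝ) : Matrix (Fin n₀) (Fin κ) ℝ :=
  fun x z => ∑ k ∈ Finset.range d, if c x k = z then y x k else 0

section
variable {m n : ℕ} (A : Matrix (Fin m) (Fin n) ℝ) (e : Listing A) (d κ : ℕ) (H : ℝ)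
  (g : ℕ → ℝ) (c : ℕ → ℕ → ℕ) (y : ℕ → ℕ → ℝ) (w : ℕ → ℝ)

/-- The test list for the input matrix `A`. -/
noncomputable def matrixTriples : List Triple :=
  testTriples (nnz A) (m + n) ((m + n) + (m + n)) d H ((inputState A e).idxArr 0)
    ((inputState A e).idxArr 1) ((inputState A e).valArr 0) g c y

/-- The columns fall into three blocks: column 0, the columns of M, and the border columns. Column 0
is the only one that sees `w 0` itself, through the corner entry; the other two blocks reproduce the
action of the bordered matrix on the differences. -/
theorem colSum_matrixTriples_zero :
    colSum w 0 (matrixTriples A e d H g c y) =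
      w 0 + (∑ x : Fin ((m + n) + (m + n)), g x * (w (x + 1) - w 0)) * H := by
  rw [matrixTriples, colSum_testTriples]
  simp only [Nat.add_eq_zero_iff, one_ne_zero, and_false, false_and, if_false, if_true, add_zero,
    Finset.sum_const_zero, zero_add]
  rw [← Fin.sum_univ_eq_sum_range (fun x => (w (x + 1) - w 0) * (g x * H)), Finset.sum_mul]
  congr 1
  refine Finset.sum_congr rfl fun x _ => by ring

theorem colSum_matrixTriples_entry (hc : ∀ x k, c x k < κ) (j : Fin ((m + n) + (m + n))) :
    colSum w (j + 1) (matrixTriples A e d H g c y) =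
      ((fun x : Fin ((m + n) + (m + n)) => w (x + 1) - w 0) ᵥ* pad A) j +
      ((fun z : Fin κ => w (z + 1 + ((m + n) + (m + n))) - w 0) ᵥ*
        (sparse ((m + n) + (m + n)) κ d c y)ᵀ) j := by
  rw [matrixTriples, colSum_testTriples, if_neg (Nat.succ_ne_zero _), zero_add]
  congr 1
  · rw [sum_listing A e (fun a b v => ((if b + 1 + (m + n) = j + 1 then (w (a + 1) - w 0) * v else 0) +
        if a + 1 = j + 1 then (w (b + 1 + (m + n)) - w 0) * v else 0)) (by simp)]
    rw [pad, vecMul_symmPad]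
    refine Finset.sum_congr rfl fun a _ => Finset.sum_congr rfl fun b _ => ?_
    have e1 : ((b : ℕ) + 1 + (m + n) = j + 1) ↔ colPos b = j := by
      rw [Fin.ext_iff, colPos]; dsimp only; omega
    have e2 : ((a : ℕ) + 1 = j + 1) ↔ rowPos a = j := by
      rw [Fin.ext_iff, rowPos]; dsimp only; omega
    simp only [e1, e2]
    have e3 : ((rowPos (n := n) a : Fin _) : ℕ) = a := rfl
    have e4 : ((colPos (m := m) b : Fin _) : ℕ) + 1 = b + 1 + (m + n) := by
      rw [colPos]; dsimp only; omega
    rw [e3, e4]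
  · rw [Finset.sum_eq_single (j : ℕ)]
    · rw [if_neg (Nat.succ_ne_zero _).symm, zero_add, vecMul_transpose]
      simp only [mulVec, dotProduct, sparse, Finset.sum_mul]
      rw [Finset.sum_comm]
      refine Finset.sum_congr rfl fun k _ => ?_
      rw [if_neg (by omega), zero_add, if_pos trivial, Finset.sum_eq_single ⟨c j k, hc j k⟩]
      · simp [mul_comm]
      · intro z _ hz
        rw [if_neg, zero_mul]
        intro h; exact hz (Fin.ext h.symm)
      · simp
    · intro x _ hx
      rw [if_neg (Nat.succ_ne_zero _).symm, zero_add]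
      refine Finset.sum_eq_zero fun k _ => ?_
      rw [if_neg (by omega), if_neg (by omega), add_zero]
    · intro h; exact absurd (Finset.mem_range.2 j.2) h

theorem colSum_matrixTriples_border (z : Fin κ) :
    colSum w (z + 1 + ((m + n) + (m + n))) (matrixTriples A e d H g c y) =
      ((fun x : Fin ((m + n) + (m + n)) => w (x + 1) - w 0) ᵥ*
        sparse ((m + n) + (m + n)) κ d c y) z := by
  rw [matrixTriples, colSum_testTriples, if_neg (by omega), zero_add]
  rw [sum_listing A e (fun a b v => ((if b + 1 + (m + n) = z + 1 + ((m + n) + (m + n)) then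
        (w (a + 1) - w 0) * v else 0) +
        if a + 1 = z + 1 + ((m + n) + (m + n)) then (w (b + 1 + (m + n)) - w 0) * v else 0)) (by simp)]
  rw [Finset.sum_eq_zero, zero_add]
  · simp only [vecMul, dotProduct, sparse, Finset.mul_sum]
    rw [← Fin.sum_univ_eq_sum_range (fun x => ((if 0 = z + 1 + ((m + n) + (m + n)) then
      (w (x + 1) - w 0) * (g x * H) else 0) + ∑ k ∈ Finset.range d,
          ((if c x k + 1 + ((m + n) + (m + n)) = z + 1 + ((m + n) + (m + n)) then
            (w (x + 1) - w 0) * y x k else 0) +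
            if x + 1 = z + 1 + ((m + n) + (m + n)) then
              (w (c x k + 1 + ((m + n) + (m + n))) - w 0) * y x k else 0)))]
    refine Finset.sum_congr rfl fun x _ => ?_
    rw [if_neg (by omega), zero_add]
    refine Finset.sum_congr rfl fun k _ => ?_
    have h1 : ¬ ((x : ℕ) + 1 = z + 1 + ((m + n) + (m + n))) := by omega
    have h2 : (c x k + 1 + ((m + n) + (m + n)) = z + 1 + ((m + n) + (m + n))) ↔ c x k = z := by omega
    simp only [h1, h2, if_false, add_zero, mul_ite, mul_zero]
  · intro a _
    refine Finset.sum_eq_zero fun b _ => ?_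
    rw [if_neg (by omega), if_neg (by omega), add_zero]

variable {A e d κ H g c y} {q : Query}

theorem fst_lt_of_mem_triples (hdim : q.dim = κ + 1 + ((m + n) + (m + n)))
    (hq : q.triples = matrixTriples A e d H g c y) (hc : ∀ x k, c x k < κ) :
    ∀ t ∈ q.triples, t.1 < q.dim := by
  rw [hq, hdim]
  refine lt_of_mem_testTriples (by omega) (fun t ht => ?_) (fun t ht => ?_)
    (fun x k => by have := hc x k; omega)
  · have := (e ⟨t, ht⟩).1.1.2
    simp only [inputState, ht, dif_pos, if_true]; omega
  · have := (e ⟨t, ht⟩).1.2.2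
    simp only [inputState, ht, dif_pos, if_true, one_ne_zero, if_false]; omega

/-- If the bordered matrix is nonsingular, so is the matrix of the rank test. -/
theorem det_matrix_ne_zero (hdim : q.dim = κ + 1 + ((m + n) + (m + n)))
    (hq : q.triples = matrixTriples A e d H g c y) (hc : ∀ x k, c x k < κ)
    (h : (bordered (pad A) (sparse ((m + n) + (m + n)) κ d c y)).det ≠ 0) :
    q.matrix.det ≠ 0 := by
  intro h0
  obtain ⟨v, hv, hv0⟩ := exists_vecMul_eq_zero_iff.2 h0
  set w : ℕ → ℝ := fun k => if h : k < q.dim then v ⟨k, h⟩ else 0 with hw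
  have hwv : (fun i : Fin q.dim => w i) = v := by ext i; simp [hw]
  have hcol : ∀ j < q.dim, colSum w j (matrixTriples A e d H g c y) = 0 := by
    intro j hj
    rw [← hq, ← q.vecMul_matrix (fst_lt_of_mem_triples hdim hq hc) w ⟨j, hj⟩, hwv, hv0]; rfl
  -- The columns other than 0 say that the differences `(u, z)` form a left kernel vector of the
  -- bordered matrix. So `w` is constant, and column 0 then reduces to `w 0 = 0`.
  set u : Fin ((m + n) + (m + n)) → ℝ := fun x => w (x + 1) - w 0 with hu
  set z : Fin κ → ℝ := fun z => w (z + 1 + ((m + n) + (m + n))) - w 0 with hz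
  have hB : Sum.elim u z ᵥ* bordered (pad A) (sparse ((m + n) + (m + n)) κ d c y) = 0 := by
    rw [vecMul_fromBlocks]
    ext j
    rcases j with j | j
    · have := colSum_matrixTriples_entry A e d κ H g c y w hc j
      rw [hcol _ (by omega)] at this
      simpa using this.symm
    · have := colSum_matrixTriples_border A e d κ H g c y w j
      rw [hcol _ (by omega)] at this
      simpa using this.symm
  have huz := eq_zero_of_vecMul_eq_zero h hB
  have hu0 : ∀ x, u x = 0 := fun x => congrFun huz (Sum.inl x)
  have hz0 : ∀ x, z x = 0 := fun x => congrFun huz (Sum.inr x)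
  have hw0 : w 0 = 0 := by
    have := colSum_matrixTriples_zero A e d H g c y w
    rw [hcol _ (by omega), Finset.sum_eq_zero fun x _ => by rw [show w (x + 1) - w 0 = 0 from hu0 x, mul_zero]] at this
    linarith
  apply hv
  rw [← hwv]
  ext ⟨i, hi⟩
  change w i = 0
  rcases Nat.eq_zero_or_pos i with rfl | hpos
  · exact hw0
  by_cases hi' : i < 1 + ((m + n) + (m + n))
  · have := hu0 ⟨i - 1, by omega⟩
    simp only [hu] at this
    rw [Nat.sub_add_cancel hpos] at this
    linarith
  · have := hz0 ⟨i - 1 - ((m + n) + (m + n)), by omega⟩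
    simp only [hz] at this
    rw [show i - 1 - ((m + n) + (m + n)) + 1 + ((m + n) + (m + n)) = i by omega] at this
    linarith

/-- If a normalized vector in the left kernel is well detected by the Gaussians `g`, then the rank
test is a NO instance. -/
theorem aldNo_matrix (hdim : q.dim = κ + 1 + ((m + n) + (m + n)))
    (hq : q.triples = matrixTriples A e d H g c y) (hc : ∀ x k, c x k < κ)
    {u : Fin ((m + n) + (m + n)) → ℝ} (hu : ‖u‖ = 1) (huM : u ᵥ* pad A = 0)
    (huW : u ᵥ* sparse ((m + n) + (m + n)) κ d c y = 0) {δ ε : ℝ} (hδ : 0 < δ) (hH : 0 < H)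
    (hg : δ ≤ |∑ x : Fin ((m + n) + (m + n)), g x * u x|) (hε : 2 < ε * (H * δ)) (E : ℕ → ℝ)
    (hE : E q.dim = 1 - ε) : ALDNo E q.matrix 1 := by
  set G := ∑ x : Fin ((m + n) + (m + n)), g x * u x with hG
  have hG0 : G ≠ 0 := fun h => by rw [h, abs_zero] at hg; linarith
  -- The scaling makes column 0 vanish: the corner contributes 1 and the Gaussians contribute H · G
  -- · (-1/(GH)) = -1. It also keeps the entries of `t` below 1/(Hδ) in absolute value.
  set t : Fin ((m + n) + (m + n)) → ℝ := (-(G * H)⁻¹) • u with ht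
  -- The value 1 at index 0 and on the border makes the border part of the differences zero, so the
  -- differences are `(t, 0)`.
  set w : ℕ → ℝ := fun k => if h : 0 < k ∧ k - 1 < (m + n) + (m + n) then 1 + t ⟨k - 1, h.2⟩ else 1 with hw
  have hw0 : w 0 = 1 := by simp [hw]
  have hwt : (fun x : Fin ((m + n) + (m + n)) => w (x + 1) - w 0) = t := by
    ext x; rw [hw0]; simp [hw]
  have hwz : (fun z : Fin κ => w (z + 1 + ((m + n) + (m + n))) - w 0) = 0 := by
    ext x; rw [hw0]; simp only [hw]; rw [dif_neg (by omega)]; simp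
  have hGH : |(G * H)⁻¹| ≤ (H * δ)⁻¹ := by
    rw [abs_inv, abs_mul, abs_of_pos hH, mul_comm]
    exact inv_anti₀ (by positivity) (mul_le_mul_of_nonneg_left hg hH.le)
  refine aldNo_of_left_kernel q.matrix (by omega) (fun i => w i) ?_ (η := (H * δ)⁻¹) ?_ (ε := ε) ?_ E hE
  · ext j
    rw [q.vecMul_matrix (fst_lt_of_mem_triples hdim hq hc) w j, hq, Pi.zero_apply]
    obtain ⟨j, hj⟩ := j
    dsimp only
    rcases Nat.eq_zero_or_pos j with rfl | hpos
    · rw [colSum_matrixTriples_zero]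
      have : ∑ x : Fin ((m + n) + (m + n)), g x * (w (x + 1) - w 0) = -(G * H)⁻¹ * G := by
        rw [hG, Finset.mul_sum]
        refine Finset.sum_congr rfl fun x _ => ?_
        rw [congrFun hwt x, ht, Pi.smul_apply, smul_eq_mul]; ring
      rw [this, hw0]
      field_simp
      ring
    by_cases hi' : j < 1 + ((m + n) + (m + n))
    · have := colSum_matrixTriples_entry A e d κ H g c y w hc ⟨j - 1, by omega⟩
      dsimp only at this
      rw [Nat.sub_add_cancel hpos] at this
      rw [this, hwt, hwz, ht, smul_vecMul, huM]
      simp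
    · have := colSum_matrixTriples_border A e d κ H g c y w ⟨j - 1 - ((m + n) + (m + n)), by omega⟩
      dsimp only at this
      rw [show j - 1 - ((m + n) + (m + n)) + 1 + ((m + n) + (m + n)) = j by omega] at this
      rw [this, hwt, ht, smul_vecMul, huW]
      simp
  · intro i
    by_cases h : 0 < (i : ℕ) ∧ (i : ℕ) - 1 < (m + n) + (m + n)
    · simp only [hw, dif_pos h, ht, Pi.smul_apply, smul_eq_mul, add_sub_cancel_left]
      rw [abs_mul, abs_neg]
      have h1 : |u ⟨i - 1, h.2⟩| ≤ 1 := hu ▸ norm_le_pi_norm u _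
      calc _ ≤ (H * δ)⁻¹ * 1 := mul_le_mul hGH h1 (abs_nonneg _) (by positivity)
        _ = _ := mul_one _
    · simp only [hw, dif_neg h, sub_self, abs_zero]; positivity
  · rw [← div_eq_mul_inv, div_lt_iff₀ (by positivity)]; exact hε
end
end RealRAM

end

/-! ### Random perfect matchings by Hall's theorem -/

section

open MeasureTheory ProbabilityTheory

/-- For k ≤ j the factors are at most κ^k and κ^(k-1). Otherwise the symmetry of binomial
coefficients replaces these exponents by j - 1 and j. -/
theorem Nat.choose_mul_choose_pred_le {κ k j : ℕ} (hk : 0 < k) (hj : 0 < j) (h : k + j = κ + 1) :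
    κ.choose k * κ.choose (k - 1) ≤ κ ^ (2 * min k j) := by
  have hκ : 0 < κ := by omega
  rcases le_total k j with hkj | hkj
  · rw [min_eq_left hkj]
    calc _ ≤ κ ^ k * κ ^ (k - 1) := Nat.mul_le_mul (Nat.choose_le_pow _ _) (Nat.choose_le_pow _ _)
      _ = κ ^ (k + (k - 1)) := (pow_add _ _ _).symm
      _ ≤ _ := Nat.pow_le_pow_right hκ (by omega)
  · rw [min_eq_right hkj, ← Nat.choose_symm (by omega : k ≤ κ),
      ← Nat.choose_symm (by omega : k - 1 ≤ κ)]
    calc _ ≤ κ ^ (κ - k) * κ ^ (κ - (k - 1)) :=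
          Nat.mul_le_mul (Nat.choose_le_pow _ _) (Nat.choose_le_pow _ _)
      _ = κ ^ (κ - k + (κ - (k - 1))) := (pow_add _ _ _).symm
      _ ≤ _ := Nat.pow_le_pow_right hκ (by omega)

/-- The k-th term of the union bound over violations of Hall's condition. With j = κ + 1 - k one has
(k-1)/κ = 1 - j/κ ≤ exp(-j/κ). Moreover kj/κ ≥ min(k, j)/2, because the larger of k and j is at
least (κ+1)/2. The term is thus at most the min(k, j)-th power of κ² exp(-d/2), a number not
exceeding 1. -/
theorem choose_mul_choose_mul_pow_le {κ k d : ℕ} (hk : 0 < k) (hkκ : k ≤ κ)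
    (hd : (κ : ℝ) ^ 2 * Real.exp (-(d / 2)) ≤ 1) :
    (κ.choose k : ℝ) * κ.choose (k - 1) * (((k - 1 : ℕ) : ℝ) / κ) ^ (k * d) ≤
      (κ : ℝ) ^ 2 * Real.exp (-(d / 2)) := by
  obtain ⟨j, hj⟩ : ∃ j, k + j = κ + 1 := ⟨κ + 1 - k, by omega⟩
  have hj0 : 0 < j := by omega
  have hκ : (0 : ℝ) < κ := by exact_mod_cast (by omega : 0 < κ)
  have hb : (((k - 1 : ℕ) : ℝ) / κ) ≤ Real.exp (-(j / κ)) := by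
    have : (((k - 1 : ℕ) : ℝ) / κ) = -(j / κ) + 1 := by
      have h1 : ((k - 1 : ℕ) : ℝ) + j = κ := by exact_mod_cast (by omega : k - 1 + j = κ)
      field_simp; linarith
    rw [this]; exact Real.add_one_le_exp _
  have hmin : (min k j : ℕ) * (κ + 1) ≤ 2 * (j * k) := by
    rcases le_total k j with h | h
    · rw [min_eq_left h, ← hj]; nlinarith
    · rw [min_eq_right h, ← hj]; nlinarith
  set μ := min k j with hμ
  have hpow : (((k - 1 : ℕ) : ℝ) / κ) ^ (k * d) ≤ Real.exp (-(d / 2)) ^ μ := by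
    calc _ ≤ Real.exp (-(j / κ)) ^ (k * d) := pow_le_pow_left₀ (by positivity) hb _
      _ = Real.exp ((k * d : ℕ) * (-(j / κ))) := (Real.exp_nat_mul _ _).symm
      _ ≤ Real.exp (μ * (-(d / 2))) := by
        apply Real.exp_le_exp.2
        have h1 : (μ : ℝ) * κ ≤ 2 * (j * k) := by
          have : μ * κ ≤ 2 * (j * k) := le_trans (Nat.mul_le_mul_left _ (Nat.le_succ _)) hmin
          exact_mod_cast this
        have h2 : (μ : ℝ) * (d / 2) ≤ (k * d : ℕ) * (j / κ) := by
          rw [← mul_div_assoc, ← mul_div_assoc, div_le_div_iff₀ two_pos hκ]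
          push_cast
          nlinarith [mul_le_mul_of_nonneg_right h1 (Nat.cast_nonneg (α := ℝ) d)]
        linarith
      _ = _ := Real.exp_nat_mul _ _
  have hch : (κ.choose k : ℝ) * κ.choose (k - 1) ≤ ((κ : ℝ) ^ 2) ^ μ := by
    rw [← pow_mul]; exact_mod_cast Nat.choose_mul_choose_pred_le hk hj0 hj
  calc _ ≤ ((κ : ℝ) ^ 2) ^ μ * Real.exp (-(d / 2)) ^ μ :=
        mul_le_mul hch hpow (by positivity) (by positivity)
    _ = ((κ : ℝ) ^ 2 * Real.exp (-(d / 2))) ^ μ := (mul_pow _ _ _).symm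
    _ ≤ _ := pow_le_of_le_one (by positivity) hd (by omega)

namespace RealRAM

theorem uniformIdx_lt {κ : ℕ} (hκ : 0 < κ) (u : unitInterval) : uniformIdx κ u < κ :=
  lt_of_le_of_lt (min_le_right _ _) (by omega)

theorem measurable_uniformIdx (κ : ℕ) : Measurable (uniformIdx κ) := by
  unfold uniformIdx
  exact (Nat.measurable_floor.comp (by fun_prop)).min measurable_const

theorem volume_uniformIdx_eq_le (κ : ℕ) (hκ : 0 < κ) (c : ℕ) :
    volume {u : unitInterval | uniformIdx κ u = c} ≤ ENNReal.ofReal (1 / κ) := by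
  have hκ' : (0 : ℝ) < κ := by exact_mod_cast hκ
  rw [unitInterval.volume_apply]
  -- The closed interval also covers the point u = 1, which the minimum in `uniformIdx` sends to κ -
  -- 1.
  calc _ ≤ volume (Set.Icc ((c : ℝ) / κ) ((c + 1) / κ)) := by
        refine measure_mono ?_
        rintro _ ⟨u, hu, rfl⟩
        have hu0 := u.2.1
        have hu1 := u.2.2
        have hpos : (0 : ℝ) ≤ κ * u := by positivity
        simp only [Set.mem_ofPred_eq, uniformIdx] at hu
        rw [Set.mem_Icc, div_le_iff₀ hκ', le_div_iff₀ hκ', mul_comm]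
        rcases le_total ⌊(κ : ℝ) * u⌋₊ (κ - 1) with h | h
        · rw [min_eq_left h] at hu
          rw [← hu]
          exact ⟨Nat.floor_le hpos, (Nat.lt_floor_add_one _).le⟩
        · rw [min_eq_right h] at hu
          have h1 : (c : ℝ) + 1 = κ := by exact_mod_cast (by omega : c + 1 = κ)
          refine ⟨?_, ?_⟩
          · rw [hu] at h
            exact (Nat.le_floor_iff hpos).1 h
          · rw [h1]; nlinarith
    _ = ENNReal.ofReal (1 / κ) := by rw [Real.volume_Icc]; congr 1; ring

theorem volume_uniformIdx_mem_le (κ : ℕ) (hκ : 0 < κ) (T : Finset ℕ) :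
    volume {u : unitInterval | uniformIdx κ u ∈ T} ≤ ENNReal.ofReal (T.card / κ) := by
  calc _ ≤ volume (⋃ c ∈ T, {u : unitInterval | uniformIdx κ u = c}) :=
        measure_mono fun u hu => Set.mem_iUnion₂.2 ⟨_, hu, rfl⟩
    _ ≤ ∑ c ∈ T, volume {u : unitInterval | uniformIdx κ u = c} := measure_biUnion_finset_le _ _
    _ ≤ ∑ _c ∈ T, ENNReal.ofReal (1 / κ) := Finset.sum_le_sum fun c _ => volume_uniformIdx_eq_le κ hκ c
    _ = _ := by
      rw [Finset.sum_const, nsmul_eq_mul, ← ENNReal.ofReal_natCast, ← ENNReal.ofReal_mul (by positivity)]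
      congr 1; ring

theorem tapeLaw_forall_uniformIdx_mem_le (κ : ℕ) (hκ : 0 < κ) (F : Finset ℕ) (T : Finset ℕ) :
    tapeLaw {ω | ∀ i ∈ F, uniformIdx κ (ω i).2 ∈ T} ≤ ENNReal.ofReal ((T.card / κ) ^ F.card) := by
  have hm : MeasurableSet {p : ℝ × unitInterval | uniformIdx κ p.2 ∈ T} :=
    ((measurable_uniformIdx κ).comp measurable_snd) (MeasurableSet.of_discrete (s := (T : Set ℕ)))
  have h1 : ((gaussianReal 0 1).prod (volume : Measure unitInterval))
      {p | uniformIdx κ p.2 ∈ T} ≤ ENNReal.ofReal (T.card / κ) := by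
    calc _ = volume {u : unitInterval | uniformIdx κ u ∈ T} := by
          have h := Measure.map_apply (μ := (gaussianReal 0 1).prod (volume : Measure unitInterval))
            measurable_snd ((measurable_uniformIdx κ) (MeasurableSet.of_discrete (s := (T : Set ℕ))))
          rw [Measure.map_snd_prod] at h
          rw [measure_univ, one_smul] at h
          exact h.symm
      _ ≤ _ := volume_uniformIdx_mem_le κ hκ T
  have hset : {ω : Tape | ∀ i ∈ F, uniformIdx κ (ω i).2 ∈ T} =
      Set.pi (F : Set ℕ) fun _ => {p : ℝ × unitInterval | uniformIdx κ p.2 ∈ T} := rfl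
  rw [hset, tapeLaw, Measure.infinitePi_pi _ fun i _ => hm, Finset.prod_const,
    ENNReal.ofReal_pow (by positivity)]
  exact pow_le_pow_left' h1 _

/-- The elements of `ι` draw `d` random points of `{0, …, κ-1}` each, where `κ = |ι|`. With high
probability there is a perfect matching. -/
theorem tapeLaw_not_matching_le {ι : Type*} [Fintype ι] [DecidableEq ι] (d : ℕ)
    (cell : ι → Fin d → ℕ) (hcell : ∀ x k x' k', cell x k = cell x' k' → x = x' ∧ k = k')
    (hκ : 0 < Fintype.card ι)
    (hd : (Fintype.card ι : ℝ) ^ 2 * Real.exp (-(d / 2)) ≤ 1) :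
    tapeLaw {ω | ¬ ∃ φ : ι → ℕ, Function.Injective φ ∧
        ∀ x, ∃ k, uniformIdx (Fintype.card ι) (ω (cell x k)).2 = φ x} ≤
      ENNReal.ofReal ((Fintype.card ι : ℝ) ^ 3 * Real.exp (-(d / 2))) := by
  classical
  set κ := Fintype.card ι with hκdef
  -- The event that all draws made by members of `K` land in `T`. Without a matching, Hall's theorem
  -- yields such a pair with `T` smaller than `K`.
  let B : Finset ι → Finset ℕ → Set Tape := fun K T =>
    {ω | ∀ i ∈ (K ×ˢ (Finset.univ : Finset (Fin d))).image (fun p => cell p.1 p.2),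
      uniformIdx κ (ω i).2 ∈ T}
  have hsub : {ω | ¬ ∃ φ : ι → ℕ, Function.Injective φ ∧
        ∀ x, ∃ k, uniformIdx κ (ω (cell x k)).2 = φ x} ⊆
      ⋃ k ∈ Finset.Icc 1 κ, ⋃ K ∈ Finset.powersetCard k (Finset.univ : Finset ι),
        ⋃ T ∈ Finset.powersetCard (k - 1) (Finset.range κ), B K T := by
    intro ω hω
    let t : ι → Finset ℕ := fun x => Finset.univ.image fun k => uniformIdx κ (ω (cell x k)).2
    have hall : ¬ ∀ K : Finset ι, K.card ≤ (K.biUnion t).card := by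
      intro h
      obtain ⟨φ, hφ, hφt⟩ := (Finset.all_card_le_biUnion_card_iff_exists_injective t).1 h
      refine hω ⟨φ, hφ, fun x => ?_⟩
      simpa [t] using hφt x
    push Not at hall
    obtain ⟨K, hK⟩ := hall
    have hKc : K.card ≤ κ := Finset.card_le_univ K
    -- The neighbourhood of `K` is enlarged to exactly |K| - 1 points, so that the union bound runs
    -- over sets of one fixed size.
    obtain ⟨T, hT1, hT2, hT3⟩ := Finset.exists_subsuperset_card_eq
      (s := K.biUnion t) (t := Finset.range κ) (n := K.card - 1) (by
        intro c hc
        simp only [t, Finset.mem_biUnion, Finset.mem_image] at hc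
        obtain ⟨x, -, k, -, rfl⟩ := hc
        exact Finset.mem_range.2 (uniformIdx_lt hκ _)) (by omega) (by rw [Finset.card_range]; omega)
    simp only [Set.mem_iUnion]
    refine ⟨K.card, Finset.mem_Icc.2 ⟨by omega, hKc⟩, K,
      Finset.mem_powersetCard.2 ⟨Finset.subset_univ _, rfl⟩, T,
      Finset.mem_powersetCard.2 ⟨hT2, hT3⟩, ?_⟩
    intro i hi
    obtain ⟨p, hp, rfl⟩ := Finset.mem_image.1 hi
    exact hT1 (Finset.mem_biUnion.2 ⟨p.1, (Finset.mem_product.1 hp).1,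
      Finset.mem_image.2 ⟨p.2, Finset.mem_univ _, rfl⟩⟩)
  have hB : ∀ k, ∀ K ∈ Finset.powersetCard k (Finset.univ : Finset ι),
      ∀ T ∈ Finset.powersetCard (k - 1) (Finset.range κ),
      tapeLaw (B K T) ≤ ENNReal.ofReal ((((k - 1 : ℕ) : ℝ) / κ) ^ (k * d)) := by
    intro k K hK T hT
    refine (tapeLaw_forall_uniformIdx_mem_le κ hκ _ T).trans (le_of_eq ?_)
    rw [Finset.card_image_of_injective _ (fun p p' h => by
        obtain ⟨h1, h2⟩ := hcell _ _ _ _ h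
        exact Prod.ext h1 h2),
      Finset.card_product, Finset.card_univ, Fintype.card_fin, (Finset.mem_powersetCard.1 hK).2,
      (Finset.mem_powersetCard.1 hT).2]
  calc _ ≤ ∑ k ∈ Finset.Icc 1 κ, tapeLaw (⋃ K ∈ Finset.powersetCard k (Finset.univ : Finset ι),
        ⋃ T ∈ Finset.powersetCard (k - 1) (Finset.range κ), B K T) :=
        (measure_mono hsub).trans (measure_biUnion_finset_le _ _)
    _ ≤ ∑ _k ∈ Finset.Icc 1 κ, ENNReal.ofReal ((κ : ℝ) ^ 2 * Real.exp (-(d / 2))) := by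
      refine Finset.sum_le_sum fun k hk => ?_
      obtain ⟨hk1, hk2⟩ := Finset.mem_Icc.1 hk
      calc _ ≤ ∑ K ∈ Finset.powersetCard k (Finset.univ : Finset ι),
            ∑ T ∈ Finset.powersetCard (k - 1) (Finset.range κ), tapeLaw (B K T) :=
            (measure_biUnion_finset_le _ _).trans
              (Finset.sum_le_sum fun K _ => measure_biUnion_finset_le _ _)
        _ ≤ ∑ K ∈ Finset.powersetCard k (Finset.univ : Finset ι),
            ∑ T ∈ Finset.powersetCard (k - 1) (Finset.range κ),
              ENNReal.ofReal ((((k - 1 : ℕ) : ℝ) / κ) ^ (k * d)) :=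
            Finset.sum_le_sum fun K hK => Finset.sum_le_sum fun T hT => hB k K hK T hT
        _ = ENNReal.ofReal ((κ.choose k : ℝ) * κ.choose (k - 1) *
              (((k - 1 : ℕ) : ℝ) / κ) ^ (k * d)) := by
            rw [Finset.sum_const, Finset.sum_const, Finset.card_powersetCard,
              Finset.card_powersetCard, Finset.card_range, Finset.card_univ, ← hκdef, smul_smul,
              nsmul_eq_mul, ENNReal.ofReal_mul (by positivity), ← Nat.cast_mul,
              ENNReal.ofReal_natCast]
        _ ≤ _ := ENNReal.ofReal_le_ofReal (choose_mul_choose_mul_pow_le hk1 hk2 hd)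
    _ = _ := by
      rw [Finset.sum_const, Nat.card_Icc, nsmul_eq_mul, ← ENNReal.ofReal_natCast,
        ← ENNReal.ofReal_mul (by positivity)]
      congr 1
      rw [Nat.add_sub_cancel]; ring

end RealRAM

end

/-! ### Failure probability of a single rank test -/

section

open MeasureTheory ProbabilityTheory Matrix
namespace RealRAM

/-- The tape cell of the Gaussian of row `x`, in a test that starts at cell `o`. -/
def gCell (o d x : ℕ) : ℕ := o + x * (d * 2 + 1)

/-- The tape cell of the `k`-th random column of row `x`. -/
def cCell (o d x k : ℕ) : ℕ := o + x * (d * 2 + 1) + 1 + k * 2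

/-- The tape cell of the `k`-th random entry of row `x`. -/
def yCell (o d x k : ℕ) : ℕ := o + x * (d * 2 + 1) + 1 + k * 2 + 1

/-- Uniqueness of division with remainder. A row uses 2d + 1 consecutive cells, one for its Gaussian
and then d pairs (column, entry); this lemma makes all these cells distinct. -/
theorem cell_aux {d x x' a a' : ℕ} (ha : a < d * 2 + 1) (ha' : a' < d * 2 + 1)
    (h : x * (d * 2 + 1) + a = x' * (d * 2 + 1) + a') : x = x' ∧ a = a' := by
  have h1 := congrArg (· / (d * 2 + 1)) h
  have h2 := congrArg (· % (d * 2 + 1)) h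
  simp only [mul_comm x, mul_comm x', Nat.mul_add_div (Nat.succ_pos (d * 2)),
    Nat.mul_add_mod, Nat.div_eq_of_lt ha, Nat.div_eq_of_lt ha', Nat.mod_eq_of_lt ha,
    Nat.mod_eq_of_lt ha', Nat.add_zero] at h1 h2
  exact ⟨h1, h2⟩

theorem gCell_inj {o d x x' : ℕ} (h : gCell o d x = gCell o d x') : x = x' := by
  unfold gCell at h
  exact (cell_aux (a := 0) (a' := 0) (d := d) (by omega) (by omega) (by omega)).1

theorem cCell_inj {o d x x' k k' : ℕ} (hk : k < d) (hk' : k' < d)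
    (h : cCell o d x k = cCell o d x' k') : x = x' ∧ k = k' := by
  unfold cCell at h
  have := cell_aux (a := 1 + k * 2) (a' := 1 + k' * 2) (d := d) (x := x) (x' := x')
    (by omega) (by omega) (by omega)
  exact ⟨this.1, by omega⟩

theorem yCell_inj {o d x x' k k' : ℕ} (hk : k < d) (hk' : k' < d)
    (h : yCell o d x k = yCell o d x' k') : x = x' ∧ k = k' := by
  unfold yCell at h
  have := cell_aux (a := 1 + k * 2 + 1) (a' := 1 + k' * 2 + 1) (d := d) (x := x) (x' := x')
    (by omega) (by omega) (by omega)
  exact ⟨this.1, by omega⟩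

theorem cCell_ne_yCell {o d x x' k k' : ℕ} (hk : k < d) (hk' : k' < d) :
    cCell o d x k ≠ yCell o d x' k' := by
  intro h
  unfold cCell yCell at h
  have := cell_aux (a := 1 + k * 2) (a' := 1 + k' * 2 + 1) (d := d) (x := x) (x' := x')
    (by omega) (by omega) (by omega)
  omega

theorem cCell_ne_gCell {o d x x' k : ℕ} (hk : k < d) : cCell o d x k ≠ gCell o d x' := by
  intro h
  unfold cCell gCell at h
  have := cell_aux (a := 1 + k * 2) (a' := 0) (d := d) (x := x) (x' := x')
    (by omega) (by omega) (by omega)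
  omega

theorem yCell_ne_gCell {o d x x' k : ℕ} (hk : k < d) : yCell o d x k ≠ gCell o d x' := by
  intro h
  unfold yCell gCell at h
  have := cell_aux (a := 1 + k * 2 + 1) (a' := 0) (d := d) (x := x) (x' := x')
    (by omega) (by omega) (by omega)
  omega

def gDraw (o d : ℕ) (ω : Tape) (x : ℕ) : ℝ := (ω (gCell o d x)).1

noncomputable def cDraw (o d κ : ℕ) (ω : Tape) (x k : ℕ) : ℕ := uniformIdx κ (ω (cCell o d x k)).2

def yDraw (o d : ℕ) (ω : Tape) (x k : ℕ) : ℝ := (ω (yCell o d x k)).1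

/-- The random matrix of a test that starts at tape cell `o`. -/
noncomputable def randomSparse (n₀ κ d o : ℕ) (ω : Tape) : Matrix (Fin n₀) (Fin κ) ℝ :=
  sparse n₀ κ d (cDraw o d κ ω) (yDraw o d ω)

theorem measurable_randomSparse (n₀ κ d o : ℕ) (x : Fin n₀) (z : Fin κ) :
    Measurable fun ω => randomSparse n₀ κ d o ω x z := by
  unfold randomSparse sparse cDraw yDraw
  refine Finset.measurable_fun_sum _ fun k _ => Measurable.ite ?_ (by fun_prop) measurable_const
  exact measurableSet_eq_fun ((measurable_uniformIdx κ).comp (by fun_prop)) measurable_const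

theorem measurable_det {ι : Type*} [Fintype ι] [DecidableEq ι] {B : Tape → Matrix ι ι ℝ}
    (h : ∀ i j, Measurable fun ω => B ω i j) : Measurable fun ω => (B ω).det := by
  simp only [det_apply]
  exact Finset.measurable_fun_sum _ fun σ _ =>
    (Finset.measurable_fun_prod _ fun i _ => h _ _).const_smul _

variable {m n : ℕ} (A : Matrix (Fin m) (Fin n) ℝ)

/-- The kernel vector can be chosen from the column and entry cells alone. With these frozen, `u` is
a fixed vector with an entry ±1, and the independent Gaussians of the rows give a linear form that
is rarely small. -/
theorem tapeLaw_abs_lt_of_rank_lt (κ d o : ℕ) (h : 2 * A.rank + κ < (m + n) + (m + n)) (δ : ℝ) :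
    tapeLaw {ω | ¬ ∃ u : Fin ((m + n) + (m + n)) → ℝ, ‖u‖ = 1 ∧ u ᵥ* pad A = 0 ∧
      u ᵥ* randomSparse ((m + n) + (m + n)) κ d o ω = 0 ∧
      δ ≤ |∑ x : Fin ((m + n) + (m + n)), gDraw o d ω x * u x|} ≤ ENNReal.ofReal (2 * δ) := by
  set n₀ := (m + n) + (m + n) with hn₀
  -- Resampling needs a measurable event, although `u` is not chosen measurably. The existential
  -- over `u` is a projection along the compact unit sphere, hence closed.
  let C : Set ((Fin n₀ → Fin κ → ℝ) × (Fin n₀ → ℝ)) := Prod.fst ''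
    {p : ((Fin n₀ → Fin κ → ℝ) × (Fin n₀ → ℝ)) × Metric.sphere (0 : Fin n₀ → ℝ) 1 |
      (p.2 : Fin n₀ → ℝ) ᵥ* pad A = 0 ∧ (∀ z, ∑ x, (p.2 : Fin n₀ → ℝ) x * p.1.1 x z = 0) ∧
      δ ≤ |∑ x, p.1.2 x * (p.2 : Fin n₀ → ℝ) x|}
  have hC : IsClosed C := by
    have hu : ∀ x, Continuous fun p : ((Fin n₀ → Fin κ → ℝ) × (Fin n₀ → ℝ)) ×
        Metric.sphere (0 : Fin n₀ → ℝ) 1 => (p.2 : Fin n₀ → ℝ) x := fun x =>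
      (continuous_apply x).comp (continuous_subtype_val.comp continuous_snd)
    refine isClosedMap_fst_of_compactSpace _ ?_
    refine IsClosed.inter (isClosed_eq ?_ continuous_const) (IsClosed.inter ?_ ?_)
    · exact Continuous.matrix_vecMul (by fun_prop) continuous_const
    · change IsClosed {p : ((Fin n₀ → Fin κ → ℝ) × (Fin n₀ → ℝ)) × Metric.sphere (0 : Fin n₀ → ℝ) 1 |
        ∀ z, ∑ x, (p.2 : Fin n₀ → ℝ) x * p.1.1 x z = 0}
      rw [Set.ofPred_forall]
      exact isClosed_iInter fun z => isClosed_eq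
        (continuous_finsetSum _ fun x _ => (hu x).mul (by fun_prop)) continuous_const
    · exact isClosed_le continuous_const
        (continuous_finsetSum _ fun x _ => Continuous.mul (by fun_prop) (hu x)).abs
  set E := {ω | ¬ ∃ u : Fin n₀ → ℝ, ‖u‖ = 1 ∧ u ᵥ* pad A = 0 ∧
      u ᵥ* randomSparse n₀ κ d o ω = 0 ∧ δ ≤ |∑ x : Fin n₀, gDraw o d ω x * u x|} with hE
  have hEC : E = (fun ω => ((fun x z => randomSparse n₀ κ d o ω x z, fun x => gDraw o d ω x) :
      (Fin n₀ → Fin κ → ℝ) × (Fin n₀ → ℝ))) ⁻¹' Cᶜ := by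
    ext ω
    refine not_congr ⟨?_, ?_⟩
    · rintro ⟨u, hu, h1, h2, h3⟩
      exact ⟨⟨(fun x z => randomSparse n₀ κ d o ω x z, fun x => gDraw o d ω x), ⟨u, by simpa using hu⟩⟩,
        ⟨h1, fun z => congrFun h2 z, h3⟩, rfl⟩
    · rintro ⟨⟨p, u⟩, ⟨h1, h2, h3⟩, rfl⟩
      exact ⟨u, by simp, h1, funext h2, h3⟩
  have hEm : MeasurableSet E := by
    rw [hEC]
    refine Measurable.prodMk ?_ ?_ hC.measurableSet.compl
    · exact measurable_pi_lambda _ fun x => measurable_pi_lambda _ fun z =>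
        measurable_randomSparse _ _ _ _ _ _
    · unfold gDraw; fun_prop
  refine tapeLaw_le_of_resample (Set.range fun x : Fin n₀ => gCell o d x) hEm fun ω => ?_
  obtain ⟨u, hu, hM, hW⟩ := exists_left_kernel (f := rowPos) (g := colPos) rowPos_injective
    colPos_injective rowPos_ne_colPos A (randomSparse n₀ κ d o ω) (by simpa using h)
  have hne : Nonempty (Fin n₀) := ⟨⟨0, by omega⟩⟩
  obtain ⟨i, hi⟩ : ∃ i, |u i| = 1 := by
    obtain ⟨i, hi⟩ := Finite.exists_max fun i => ‖u i‖
    refine ⟨i, le_antisymm (hu ▸ norm_le_pi_norm u i) ?_⟩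
    rw [← hu]
    exact (pi_norm_le_iff_of_nonneg (norm_nonneg _)).2 hi
  refine (measure_mono fun x hx => ?_).trans (tapeLaw_abs_sum_lt (fun x : Fin n₀ => gCell o d x)
    (fun a b hab => Fin.ext (gCell_inj hab)) u i hi δ)
  by_contra hlt
  refine hx ⟨u, hu, hM, ?_, ?_⟩
  · rw [← hW]
    congr 1
    unfold randomSparse sparse cDraw yDraw
    ext a z
    refine Finset.sum_congr rfl fun k hk => ?_
    have hk' := Finset.mem_range.1 hk
    rw [resample_of_notMem, resample_of_notMem]
    · rintro ⟨b, hb⟩; exact yCell_ne_gCell hk' hb.symm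
    · rintro ⟨b, hb⟩; exact cCell_ne_gCell hk' hb.symm
  · have : ∀ a : Fin n₀, gDraw o d (resample (Set.range fun x : Fin n₀ => gCell o d x) x ω) a =
        (x (gCell o d a)).1 := fun a => by
      rw [gDraw, resample_of_mem (Set.mem_range_self a)]
    simp only [this]
    exact not_lt.1 hlt

/-- With the random columns frozen, the determinant is a polynomial in the random entries. It does
not vanish at the 0/1 point that keeps just the entries of the matching, where `K i` is the number
of the draw by which row `i` hits `φ i`. -/
theorem tapeLaw_det_eq_zero_of_matching {r : ℕ} (σ : Fin r → Fin m) (τ : Fin r → Fin n)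
    (hdet : (A.submatrix σ τ).det ≠ 0) (κ d o : ℕ) (hκ0 : 0 < κ)
    (φ : {i : Fin ((m + n) + (m + n)) // (∀ k, rowPos (σ k) ≠ i) ∧ ∀ k, colPos (τ k) ≠ i} → Fin κ)
    (hφ : Function.Bijective φ)
    (K : {i : Fin ((m + n) + (m + n)) // (∀ k, rowPos (σ k) ≠ i) ∧ ∀ k, colPos (τ k) ≠ i} → Fin d) :
    tapeLaw {ω | (∀ i, cDraw o d κ ω i.1 (K i) = φ i) ∧
      (bordered (pad A) (randomSparse ((m + n) + (m + n)) κ d o ω)).det = 0} = 0 := by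
  classical
  set n₀ := (m + n) + (m + n) with hn₀
  have hmeas : MeasurableSet {ω | (∀ i, cDraw o d κ ω i.1 (K i) = φ i) ∧
      (bordered (pad A) (randomSparse n₀ κ d o ω)).det = 0} := by
    refine MeasurableSet.inter ?_ ?_
    · change MeasurableSet {ω | ∀ i, cDraw o d κ ω i.1 (K i) = φ i}
      rw [Set.ofPred_forall]
      refine MeasurableSet.iInter fun i => ?_
      exact measurableSet_eq_fun ((measurable_uniformIdx κ).comp (by fun_prop)) measurable_const
    · refine measurableSet_eq_fun (measurable_det fun i j => ?_) measurable_const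
      rcases i with i | i <;> rcases j with j | j <;>
        simp only [fromBlocks_apply₁₁, fromBlocks_apply₁₂, fromBlocks_apply₂₁, fromBlocks_apply₂₂,
          transpose_apply]
      · exact measurable_const
      · exact measurable_randomSparse _ _ _ _ _ _
      · exact measurable_randomSparse _ _ _ _ _ _
      · exact measurable_const
  refine le_antisymm ?_ zero_le
  -- Only the entry cells are resampled, so the columns, and with them the matching condition, stay
  -- fixed.
  refine tapeLaw_le_of_resample (Set.range fun p : Fin n₀ × Fin d => yCell o d p.1 p.2) hmeas
    fun ω => ?_
  set G := Set.range fun p : Fin n₀ × Fin d => yCell o d p.1 p.2 with hG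
  have hcG : ∀ x, ∀ a : Fin n₀, ∀ k < d, cDraw o d κ (resample G x ω) a k = cDraw o d κ ω a k := by
    intro x a k hk
    rw [cDraw, cDraw, resample_of_notMem]
    rintro ⟨p, hp⟩
    exact cCell_ne_yCell hk p.2.2 hp.symm
  by_cases hω : ∀ i, cDraw o d κ ω i.1 (K i) = φ i
  swap
  · have : {x | resample G x ω ∈ {ω | (∀ i, cDraw o d κ ω i.1 (K i) = φ i) ∧
        (bordered (pad A) (randomSparse n₀ κ d o ω)).det = 0}} = ∅ := by
      refine Set.eq_empty_of_forall_notMem fun x hx => hω fun i => ?_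
      rw [← hcG x _ _ (K i).2]; exact hx.1 i
    rw [this, measure_empty]
  let Wp : Matrix (Fin n₀) (Fin κ) (MvPolynomial ℕ ℝ) := fun x z =>
    ∑ k ∈ Finset.range d, if cDraw o d κ ω x k = z then MvPolynomial.X (yCell o d x k) else 0
  let P : MvPolynomial ℕ ℝ := (fromBlocks ((pad A).map MvPolynomial.C) Wp Wpᵀ 0).det
  have hP : ∀ v : ℕ → ℝ, MvPolynomial.eval v P = (bordered (pad A)
      (sparse n₀ κ d (cDraw o d κ ω) fun x k => v (yCell o d x k))).det := by
    intro v
    rw [RingHom.map_det, RingHom.mapMatrix_apply, fromBlocks_map, transpose_map]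
    have hWp : Wp.map (MvPolynomial.eval v) =
        sparse n₀ κ d (cDraw o d κ ω) fun x k => v (yCell o d x k) := by
      ext x z
      rw [Matrix.map_apply]
      simp only [Wp, sparse, map_sum, apply_ite (MvPolynomial.eval v),
        MvPolynomial.eval_X, map_zero]
    have hM : ((pad A).map MvPolynomial.C).map (MvPolynomial.eval v) = pad A := by
      ext i j; simp
    rw [hWp, hM, Matrix.map_zero _ (map_zero _)]
  -- The witness of nonvanishing: 1 at the matching draw of each row outside the minor, 0 at all
  -- other draws.
  let F : ℕ × ℕ → ℝ := fun p => if h : p.1 < n₀ then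
    if h' : (∀ k, rowPos (σ k) ≠ (⟨p.1, h⟩ : Fin n₀)) ∧ ∀ k, colPos (τ k) ≠ (⟨p.1, h⟩ : Fin n₀) then
      if p.2 = K ⟨⟨p.1, h⟩, h'⟩ then 1 else 0 else 0 else 0
  let cellMap : Fin n₀ × Fin d → ℕ := fun p => yCell o d p.1 p.2
  have hcell : Function.Injective cellMap := by
    rintro ⟨a, k⟩ ⟨a', k'⟩ h
    obtain ⟨h1, h2⟩ := yCell_inj k.2 k'.2 h
    exact Prod.ext (Fin.ext h1) (Fin.ext h2)
  let v₀ : ℕ → ℝ := Function.extend cellMap (fun p => F (p.1, p.2)) 0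
  have hv₀ : ∀ (a : Fin n₀) (k : ℕ), k < d → v₀ (yCell o d a k) = F (a, k) := fun a k hk =>
    hcell.extend_apply (fun p : Fin n₀ × Fin d => F (p.1, p.2)) 0 (a, ⟨k, hk⟩)
  have hFS : ∀ (i : Fin n₀) (hi : (∀ k, rowPos (σ k) ≠ i) ∧ ∀ k, colPos (τ k) ≠ i) (k : ℕ),
      F (i, k) = if k = K ⟨i, hi⟩ then 1 else 0 := by
    intro i hi k
    simp only [F]
    rw [dif_pos i.2, dif_pos hi]
  have hFN : ∀ (i : Fin n₀) (_ : ¬ ((∀ k, rowPos (σ k) ≠ i) ∧ ∀ k, colPos (τ k) ≠ i)) (k : ℕ),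
      F (i, k) = 0 := by
    intro i hi k
    simp only [F]
    rw [dif_pos i.2, dif_neg hi]
  have hP0 : MvPolynomial.eval v₀ P ≠ 0 := by
    rw [hP]
    let z₀ : Fin κ := ⟨0, hκ0⟩
    refine det_bordered_ne_zero rowPos_injective colPos_injective rowPos_ne_colPos A σ τ hdet _
      (fun i => if h : (∀ k, rowPos (σ k) ≠ i) ∧ ∀ k, colPos (τ k) ≠ i then φ ⟨i, h⟩ else z₀) ?_ ?_ ?_
    · intro i z
      simp only [sparse]
      by_cases hi : (∀ k, rowPos (σ k) ≠ i) ∧ ∀ k, colPos (τ k) ≠ i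
      · rw [dif_pos hi, Finset.sum_eq_single (K ⟨i, hi⟩ : ℕ)]
        · rw [hω ⟨i, hi⟩, hv₀ _ _ (K _).2, hFS i hi, if_pos rfl]
          simp only [hi.1, hi.2, Fin.ext_iff, implies_true, true_and, ne_eq, not_false_eq_true]
        · intro k hk hne
          rw [hv₀ _ _ (Finset.mem_range.1 hk), hFS i hi, if_neg hne, ite_self]
        · intro h; exact absurd (Finset.mem_range.2 (K _).2) h
      · rw [if_neg (fun h => hi ⟨h.1, h.2.1⟩)]
        refine Finset.sum_eq_zero fun k hk => ?_
        rw [hv₀ _ _ (Finset.mem_range.1 hk), hFN i hi, ite_self]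
    · intro i j h1 h2 h3 h4 h
      rw [dif_pos ⟨h1, h2⟩, dif_pos ⟨h3, h4⟩] at h
      exact congrArg Subtype.val (hφ.1 h)
    · intro z
      obtain ⟨⟨i, hi⟩, rfl⟩ := hφ.2 z
      exact ⟨i, hi.1, hi.2, by rw [dif_pos hi]⟩
  refine le_of_le_of_eq (measure_mono fun x hx => ?_) (tapeLaw_eval_eq_zero P v₀ hP0)
  change MvPolynomial.eval _ P = 0
  rw [hP, ← hx.2]
  congr 2
  ext a z
  unfold randomSparse sparse
  refine Finset.sum_congr rfl fun k hk => ?_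
  have hk' := Finset.mem_range.1 hk
  have hmem : yCell o d a k ∈ G := ⟨(a, ⟨k, hk'⟩), rfl⟩
  rw [hcG x a k hk', yDraw, resample_of_mem hmem]

/-- A test for a number `r` that does not exceed the rank of `A` leads to a nonsingular matrix with
high probability. -/
theorem tapeLaw_det_eq_zero_le {r : ℕ} (hr : r ≤ A.rank) (κ d o : ℕ) (hκ0 : 0 < κ)
    (hκ : κ + 2 * r = (m + n) + (m + n)) (hd : (κ : ℝ) ^ 2 * Real.exp (-(d / 2)) ≤ 1) :
    tapeLaw {ω | (bordered (pad A) (randomSparse ((m + n) + (m + n)) κ d o ω)).det = 0} ≤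
      ENNReal.ofReal ((κ : ℝ) ^ 3 * Real.exp (-(d / 2))) := by
  classical
  obtain ⟨σ, τ, hdet⟩ := A.exists_det_submatrix_ne_zero hr
  have hσ : Function.Injective σ := fun k l hkl => by
    by_contra hne
    exact hdet (det_zero_of_row_eq hne (by ext j; simp [hkl]))
  have hτ : Function.Injective τ := fun k l hkl => by
    by_contra hne
    exact hdet (det_zero_of_column_eq hne (by simp [hkl]))
  let ι := {i : Fin ((m + n) + (m + n)) // (∀ k, rowPos (σ k) ≠ i) ∧ ∀ k, colPos (τ k) ≠ i}
  -- The minor occupies r row positions and r column positions, all distinct, so an injection of the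
  -- remaining positions into the border columns is a bijection.
  have hcard : Fintype.card ι = κ := by
    have h1 : (Finset.univ.filter fun i : Fin ((m + n) + (m + n)) =>
        (∀ k, rowPos (σ k) ≠ i) ∧ ∀ k, colPos (τ k) ≠ i) =
        (Finset.univ.image (fun k => rowPos (n := n) (σ k)) ∪
          Finset.univ.image fun k => colPos (m := m) (τ k))ᶜ := by
      ext i; simp
    have h2 : Disjoint (Finset.univ.image (fun k => rowPos (n := n) (σ k)))
        (Finset.univ.image fun k => colPos (m := m) (τ k)) := by
      rw [Finset.disjoint_left]
      intro i hi hi'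
      obtain ⟨k, -, rfl⟩ := Finset.mem_image.1 hi
      obtain ⟨l, -, h⟩ := Finset.mem_image.1 hi'
      exact rowPos_ne_colPos _ _ h.symm
    rw [Fintype.card_subtype, h1, Finset.card_compl, Finset.card_union_of_disjoint h2,
      Finset.card_image_of_injective _ (fun _ _ h => hσ (rowPos_injective h)),
      Finset.card_image_of_injective _ (fun _ _ h => hτ (colPos_injective h)), Finset.card_univ,
      Fintype.card_fin, Fintype.card_fin]
    omega
  set E := {ω | (bordered (pad A) (randomSparse ((m + n) + (m + n)) κ d o ω)).det = 0} with hE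
  set X := {ω : Tape | ¬ ∃ φ : ι → ℕ, Function.Injective φ ∧
    ∀ x, ∃ k : Fin d, uniformIdx κ (ω (cCell o d x.1 k)).2 = φ x} with hX
  have hX' : tapeLaw X ≤ ENNReal.ofReal ((κ : ℝ) ^ 3 * Real.exp (-(d / 2))) := by
    have := tapeLaw_not_matching_le (ι := ι) d (fun x k => cCell o d x.1 k) (by
      intro x k x' k' h
      obtain ⟨h1, h2⟩ := cCell_inj k.2 k'.2 h
      exact ⟨Subtype.ext (Fin.ext h1), Fin.ext h2⟩) (by omega) (by rwa [hcard])
    rwa [hcard] at this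
  let J := {φ : ι → Fin κ // Function.Bijective φ}
  let Y : J × (ι → Fin d) → Set Tape := fun p =>
    {ω | (∀ i, cDraw o d κ ω i.1 (p.2 i) = p.1.1 i) ∧
      (bordered (pad A) (randomSparse ((m + n) + (m + n)) κ d o ω)).det = 0}
  -- Either there is no matching, or one of the finitely many pairs of a matching and a choice of
  -- draws occurs; for each pair the determinant vanishes with probability zero.
  have hsub : E ⊆ X ∪ ⋃ p, Y p := by
    intro ω hω
    by_cases hωX : ω ∈ X
    · exact Or.inl hωX
    · right
      rw [hX, Set.mem_ofPred_eq, not_not] at hωX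
      obtain ⟨φ, hφ, hk⟩ := hωX
      choose K hK using hk
      have hlt : ∀ i, φ i < κ := fun i => hK i ▸ uniformIdx_lt hκ0 _
      have hinj : Function.Injective fun i => (⟨φ i, hlt i⟩ : Fin κ) := fun i j h =>
        hφ (Fin.mk.inj_iff.1 h)
      have hbij := (Fintype.bijective_iff_injective_and_card _).2
        ⟨hinj, hcard.trans (Fintype.card_fin κ).symm⟩
      exact Set.mem_iUnion.2 ⟨(⟨_, hbij⟩, K), hK, hω⟩
  calc tapeLaw E ≤ tapeLaw X + tapeLaw (⋃ p, Y p) :=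
        (measure_mono hsub).trans (measure_union_le _ _)
    _ = tapeLaw X := by
      rw [measure_iUnion_null fun p => ?_, add_zero]
      exact tapeLaw_det_eq_zero_of_matching A σ τ hdet κ d o hκ0 p.1.1 p.1.2 p.2
    _ ≤ _ := hX'

end RealRAM

end

/-! ### A program calculus with time bounds -/

section

namespace RealRAM

variable {O : SquareOracle} {ω : Tape}

/-- Within `t` steps `P` carries the store `s` to a store that satisfies `Q`, whatever remains to be
carried out afterwards. -/
def Spec (O : SquareOracle) (ω : Tape) (P : Prog) (s : State) (t : ℕ) (Q : State → Prop) : Prop :=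
  ∃ T ≤ t, ∃ s', (∀ K, (step O ω)^[T] (P :: K, s) = (K, s')) ∧ Q s'

namespace Spec
variable {P p q : Prog} {s : State} {t t₁ t₂ : ℕ} {Q R : State → Prop}

theorem haltsIn (h : Spec O ω P s t Q) : ∃ T ≤ t, ∃ s', HaltsIn O ω P s T s' ∧ Q s' := by
  obtain ⟨T, hT, s', hs, hQ⟩ := h
  exact ⟨T, hT, s', hs [], hQ⟩

theorem mono (h : Spec O ω P s t₁ R) (ht : t₁ ≤ t) (hQ : ∀ s', R s' → Q s') :
    Spec O ω P s t Q := by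
  obtain ⟨T, hT, s', hs, hR⟩ := h
  exact ⟨T, hT.trans ht, s', hs, hQ _ hR⟩

theorem op {a : Instr} (h : Q (a.exec O ω s)) (ht : 1 ≤ t := by omega) :
    Spec O ω (.op a) s t Q :=
  ⟨1, ht, _, fun _ => rfl, h⟩

theorem seq (t₁ t₂ : ℕ) (h : Spec O ω p s t₁ fun s' => Spec O ω q s' t₂ Q)
    (ht : 1 + t₁ + t₂ ≤ t := by omega) : Spec O ω (.seq p q) s t Q := by
  obtain ⟨T₁, hT₁, s₁, hs₁, T₂, hT₂, s₂, hs₂, hQ⟩ := h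
  refine ⟨T₂ + (T₁ + 1), by omega, s₂, fun K => ?_, hQ⟩
  rw [Function.iterate_add_apply, Function.iterate_succ_apply]
  change (step O ω)^[T₂] ((step O ω)^[T₁] (p :: q :: K, s)) = _
  rw [hs₁, hs₂]

theorem ite {b : Test} (t₁ : ℕ) (h : b.Holds s → Spec O ω p s t₁ Q)
    (h' : ¬ b.Holds s → Spec O ω q s t₁ Q) (ht : 1 + t₁ ≤ t := by omega) :
    Spec O ω (.ite b p q) s t Q := by
  by_cases hb : b.Holds s
  · obtain ⟨T, hT, s', hs, hQ⟩ := h hb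
    refine ⟨T + 1, by omega, s', fun K => ?_, hQ⟩
    rw [Function.iterate_succ_apply, ← hs K]
    simp [step, hb]
  · obtain ⟨T, hT, s', hs, hQ⟩ := h' hb
    refine ⟨T + 1, by omega, s', fun K => ?_, hQ⟩
    rw [Function.iterate_succ_apply, ← hs K]
    simp [step, hb]

theorem loop_of_not {b : Test} (hb : ¬ b.Holds s) (h : Q s) (ht : 1 ≤ t := by omega) :
    Spec O ω (.loop b p) s t Q :=
  ⟨1, ht, s, fun K => by simp [step, hb], h⟩

theorem loop_of_holds {b : Test} (t₁ t₂ : ℕ) (hb : b.Holds s)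
    (h : Spec O ω p s t₁ fun s' => Spec O ω (.loop b p) s' t₂ Q)
    (ht : 1 + t₁ + t₂ ≤ t := by omega) : Spec O ω (.loop b p) s t Q := by
  obtain ⟨T₁, hT₁, s₁, hs₁, T₂, hT₂, s₂, hs₂, hQ⟩ := h
  refine ⟨T₂ + (T₁ + 1), by omega, s₂, fun K => ?_, hQ⟩
  rw [Function.iterate_add_apply, Function.iterate_succ_apply]
  have : step O ω (.loop b p :: K, s) = (p :: .loop b p :: K, s) := by simp [step, hb]
  rw [this, hs₁, hs₂]

/-- A loop whose `i`-th round takes the invariant from `i` to `i + 1`, and that ends at `k`. -/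
theorem loop {b : Test} (Inv : ℕ → State → Prop) (k τ : ℕ)
    (hcont : ∀ i < k, ∀ s, Inv i s → b.Holds s ∧ Spec O ω p s τ (Inv (i + 1)))
    (hend : ∀ s, Inv k s → ¬ b.Holds s) (h0 : Inv 0 s) (ht : k * (τ + 1) + 1 ≤ t := by omega) :
    Spec O ω (.loop b p) s t (Inv k) := by
  suffices ∀ j i s, i + j = k → Inv i s → Spec O ω (.loop b p) s (j * (τ + 1) + 1) (Inv k) from
    (this k 0 s (by omega) h0).mono ht fun _ h => h
  intro j
  induction j with
  | zero =>
    intro i s hi hs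
    obtain rfl : i = k := by omega
    exact loop_of_not (hend s hs) hs
  | succ j ih =>
    intro i s hi hs
    obtain ⟨hb, hp⟩ := hcont i (by omega) s hs
    refine loop_of_holds τ (j * (τ + 1) + 1) hb (hp.mono le_rfl fun s' hs' => ?_) (by
      rw [Nat.succ_mul]; omega)
    exact ih (i + 1) s' (by omega) hs'

end Spec

/-- Straight-line code. -/
def block : List Instr → Prog
  | [] => .op (.idxCopy 0 0)
  | a :: l => .seq (.op a) (block l)

/-- Effect of straight-line code. -/
noncomputable def execs (O : SquareOracle) (ω : Tape) : List Instr → State → State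
  | [], s => s
  | a :: l, s => execs O ω l (a.exec O ω s)

theorem execs_append (l l' : List Instr) (s : State) :
    execs O ω (l ++ l') s = execs O ω l' (execs O ω l s) := by
  induction l generalizing s with
  | nil => rfl
  | cons a l ih => exact ih _

theorem Spec.block {l : List Instr} {s : State} {t : ℕ} {Q : State → Prop}
    (h : Q (execs O ω l s)) (ht : 2 * l.length + 1 ≤ t := by simp) :
    Spec O ω (block l) s t Q := by
  induction l generalizing s t with
  | nil =>
    refine Spec.op ?_ (by simpa using ht)
    simpa [Instr.exec, execs] using h
  | cons a l ih =>
    refine Spec.seq 1 (2 * l.length + 1) (Spec.op (ih h le_rfl)) ?_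
    rw [List.length_cons] at ht; omega

/-- Repeat `p` with the counter register `ctr` running from zero to the content of `bd`. -/
def forLoop (ctr bd : ℕ) (p : Prog) : Prog :=
  .seq (.op (.idxConst ctr 0)) (.loop (.idxLt ctr bd) (.seq p (.op (.idxSucc ctr))))

/-- The invariant is required after the counter has been incremented. The 3 in `τ + 3` pays for the
loop test, the sequencing and the increment. -/
theorem Spec.forLoop {ctr bd : ℕ} {p : Prog} {s : State} {t : ℕ} (hne : ctr ≠ bd)
    (Inv : ℕ → State → Prop) (k τ : ℕ) (hk : s.idx bd = k)
    (h0 : Inv 0 ((Instr.idxConst ctr 0).exec O ω s))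
    (hstep : ∀ i < k, ∀ s, Inv i s → s.idx ctr = i → s.idx bd = k → Spec O ω p s τ fun s' =>
      s'.idx ctr = i ∧ s'.idx bd = k ∧ Inv (i + 1) ((Instr.idxSucc ctr).exec O ω s'))
    (ht : k * (τ + 3) + 3 ≤ t := by omega) :
    Spec O ω (forLoop ctr bd p) s t (Inv k) := by
  refine Spec.seq 1 (k * (τ + 3) + 1) (Spec.op ?_) (by omega)
  refine (Spec.loop (fun i s => s.idx ctr = i ∧ s.idx bd = k ∧ Inv i s) k (τ + 2) ?_ ?_ ?_ le_rfl).mono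
    le_rfl fun s' h => h.2.2
  · rintro i hi s ⟨h1, h2, h3⟩
    refine ⟨by simp only [Test.Holds]; omega, Spec.seq τ 1 ((hstep i hi s h3 h1 h2).mono le_rfl ?_)⟩
    rintro s' ⟨h1, h2, h3⟩
    exact Spec.op ⟨by simp [Instr.exec, h1], by simp [Instr.exec, Function.update_of_ne hne.symm, h2], h3⟩
  · rintro s ⟨h1, h2, -⟩
    simp only [Test.Holds]; omega
  · exact ⟨by simp [Instr.exec], by simp [Instr.exec, Function.update_of_ne hne.symm, hk], h0⟩

/-- The list under construction: index arrays `2` and `3`, value array `1`, length in index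
register `40`. -/
def State.triples (s : State) : List Triple :=
  (List.range (s.idx 40)).map fun t => (s.idxArr 2 t, s.idxArr 3 t, s.valArr 1 t)

/-- From `s` to `s'` the index registers in `I`, the value registers in `V` and the arrays outside the
list under construction are preserved, `l` is appended to that list, and `k` samples are drawn. -/
structure Eff (I V : ℕ → Prop) (s s' : State) (l : List Triple) (k : ℕ) : Prop where
  idx : ∀ i, I i → s'.idx i = s.idx i
  val : ∀ r, V r → s'.val r = s.val r
  idxArr : ∀ a, a ≠ 2 → a ≠ 3 → s'.idxArr a = s.idxArr a
  valArr : s'.valArr 0 = s.valArr 0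
  triples : s'.triples = s.triples ++ l
  drawn : s'.drawn = s.drawn + k
  queries : s'.queries = s.queries

namespace Eff
variable {I V I' V' : ℕ → Prop} {s s' s'' : State} {l l' : List Triple} {k k' : ℕ}

theorem refl (I V : ℕ → Prop) (s : State) : Eff I V s s [] 0 :=
  ⟨fun _ _ => rfl, fun _ _ => rfl, fun _ _ _ => rfl, rfl, by simp, rfl, rfl⟩

theorem trans (h : Eff I V s s' l k) (h' : Eff I V s' s'' l' k') :
    Eff I V s s'' (l ++ l') (k + k') where
  idx i hi := (h'.idx i hi).trans (h.idx i hi)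
  val i hi := (h'.val i hi).trans (h.val i hi)
  idxArr a h2 h3 := (h'.idxArr a h2 h3).trans (h.idxArr a h2 h3)
  valArr := h'.valArr.trans h.valArr
  triples := by rw [h'.triples, h.triples, List.append_assoc]
  drawn := by rw [h'.drawn, h.drawn, Nat.add_assoc]
  queries := h'.queries.trans h.queries

theorem weaken (h : Eff I V s s' l k) (hI : ∀ i, I' i → I i) (hV : ∀ i, V' i → V i) :
    Eff I' V' s s' l k :=
  { h with idx := fun i hi => h.idx i (hI i hi), val := fun i hi => h.val i (hV i hi) }

end Eff

/-- The instruction `a` writes neither the preserved registers nor the list under construction. -/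
def Instr.Keeps (I V : ℕ → Prop) : Instr → Prop
  | .idxConst i _ | .idxCopy i _ | .idxSucc i | .idxPred i | .idxLoad i _ _ => ¬ I i ∧ i ≠ 40
  | .ofIdx r _ | .add r _ _ | .sub r _ _ | .mul r _ _ | .div r _ _ | .valLoad r _ _ => ¬ V r
  | _ => False

/-- The parameter `k` lets one statement cover deterministic instructions (`k = 0`) and random ones
(`k = 1`). Register 40 is excluded as it holds the length of the list. -/
theorem eff_update_idx {I V : ℕ → Prop} (s : State) {i : ℕ} (hi : ¬ I i) (hi' : i ≠ 40) (x k : ℕ) :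
    Eff I V s { s with idx := Function.update s.idx i x, drawn := s.drawn + k } [] k where
  idx j hj := Function.update_of_ne (by rintro rfl; exact hi hj) _ _
  val _ _ := rfl
  idxArr _ _ _ := rfl
  valArr := rfl
  triples := by simp [State.triples, Function.update_of_ne hi'.symm]
  drawn := rfl
  queries := rfl

theorem eff_update_val {I V : ℕ → Prop} (s : State) {i : ℕ} (hi : ¬ V i) (x : ℝ) (k : ℕ) :
    Eff I V s { s with val := Function.update s.val i x, drawn := s.drawn + k } [] k where
  idx _ _ := rfl
  val j hj := Function.update_of_ne (by rintro rfl; exact hi hj) _ _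
  idxArr _ _ _ := rfl
  valArr := rfl
  triples := by simp [State.triples]
  drawn := rfl
  queries := rfl

theorem eff_exec {I V : ℕ → Prop} {a : Instr} (h : a.Keeps I V) (s : State) :
    Eff I V s (a.exec O ω s) [] 0 := by
  cases a <;> first
    | exact eff_update_idx s h.1 h.2 _ 0
    | exact eff_update_val s h _ 0
    | exact h.elim

theorem eff_execs {I V : ℕ → Prop} {l : List Instr} (h : ∀ a ∈ l, a.Keeps I V) (s : State) :
    Eff I V s (execs O ω l s) [] 0 := by
  induction l generalizing s with
  | nil => exact Eff.refl I V s
  | cons a l ih =>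
    exact (eff_exec (h a (by simp)) s).trans (ih (fun b hb => h b (by simp [hb])) _)

theorem eff_gauss {I V : ℕ → Prop} {r : ℕ} (hr : ¬ V r) (s : State) :
    Eff I V s ((Instr.gauss r).exec O ω s) [] 1 := eff_update_val s hr _ 1

theorem eff_randIdx {I V : ℕ → Prop} {i j : ℕ} (hi : ¬ I i) (hi' : i ≠ 40) (s : State) :
    Eff I V s ((Instr.randIdx i j).exec O ω s) [] 1 := eff_update_idx s hi hi' _ 1

/-- Append an entry to the list under construction. -/
def emit (i j r : ℕ) : List Instr :=
  [.idxStore 2 40 i, .idxStore 3 40 j, .valStore 1 40 r, .idxSucc 40]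

theorem eff_emit {I V : ℕ → Prop} (hI : ¬ I 40) (i j r : ℕ) (s : State) :
    Eff I V s (execs O ω (emit i j r) s) [(s.idx i, s.idx j, s.val r)] 0 where
  idx k hk := by
    simp only [emit, execs, Instr.exec]
    exact Function.update_of_ne (fun h : k = 40 => hI (h ▸ hk)) _ _
  val _ _ := rfl
  idxArr a h2 h3 := by simp [emit, execs, Instr.exec, h2, h3]
  valArr := by simp [emit, execs, Instr.exec]
  triples := by
    simp only [emit, execs, Instr.exec, State.triples]
    simp only [Function.update_self, List.range_succ, List.map_append, List.map_cons, List.map_nil]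
    congr 1
    · refine List.map_congr_left fun t ht => ?_
      have : t ≠ s.idx 40 := (List.mem_range.1 ht).ne
      simp [Function.update_of_ne this]
    · simp
  drawn := rfl
  queries := rfl

/-- Append a balanced pair of entries; index register `12` and value register `1` hold zero. -/
def emitBalanced (i j r : ℕ) : List Instr := emit i j r ++ (.sub 9 1 r :: emit 12 j 9)

/-- The condition `j ≠ 40` matters because `j` is read again after the first emission has
incremented register 40. -/
theorem eff_emitBalanced {I V : ℕ → Prop} (hI : ¬ I 40) (hV : ¬ V 9) {i j r : ℕ} {s : State}
    (h0 : s.idx 12 = 0) (h1 : s.val 1 = 0) (hj : j ≠ 40) :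
    Eff I V s (execs O ω (emitBalanced i j r) s) (balanced (s.idx i) (s.idx j) (s.val r)) 0 := by
  rw [emitBalanced, execs_append]
  have e1 := eff_emit (O := O) (ω := ω) (I := fun i => i ≠ 40) (V := fun r => r ≠ 9) (by simp) i j r s
  set s₁ := execs O ω (emit i j r) s
  have hv : s₁.val = s.val := rfl
  have e2 := eff_exec (O := O) (ω := ω) (I := fun i => i ≠ 40) (V := fun r => r ≠ 9)
    (a := .sub 9 1 r) (by simp [Instr.Keeps]) s₁
  set s₂ := (Instr.sub 9 1 r).exec O ω s₁
  have e3 := eff_emit (O := O) (ω := ω) (I := fun i => i ≠ 40) (V := fun r => r ≠ 9) (by simp) 12 j 9 s₂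
  have h := (e1.trans e2).trans e3
  have h12 : s₂.idx 12 = 0 := ((e1.trans e2).idx 12 (by simp)).trans h0
  have hj' : s₂.idx j = s.idx j := (e1.trans e2).idx j hj
  have h9 : s₂.val 9 = 0 - s.val r := by
    simp only [s₂, Instr.exec, Function.update_self, hv, h1]
  rw [h12, hj', h9] at h
  exact h.weaken (fun i hi => fun h => hI (h ▸ hi)) (fun i hi => fun h => hV (h ▸ hi))

end RealRAM

end

/-! ### Code that lists the entries of the test matrix -/

section

namespace RealRAM

variable {O : SquareOracle} {ω : Tape}

/-- The indices below `b`. -/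
abbrev Below (b : ℕ) : ℕ → Prop := fun i => i < b

/-- What the preparation establishes and every rank test relies on. -/
structure Ready (N s n₀ d : ℕ) (H : ℝ) (row col : ℕ → ℕ) (v : ℕ → ℝ) (st : State) : Prop where
  idx2 : st.idx 2 = N
  idx3 : st.idx 3 = n₀
  idx5 : st.idx 5 = d
  idx12 : st.idx 12 = 0
  val0 : st.val 0 = H
  val1 : st.val 1 = 0
  idxArr0 : st.idxArr 0 = row
  idxArr1 : st.idxArr 1 = col
  valArr0 : st.valArr 0 = v
  idxArr4 : ∀ x < n₀ + n₀, st.idxArr 4 x = x + s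

theorem Ready.of_eff {N s n₀ d : ℕ} {H : ℝ} {row col : ℕ → ℕ} {v : ℕ → ℝ} {st st' : State}
    {I V : ℕ → Prop} {l : List Triple} {k : ℕ} (h : Ready N s n₀ d H row col v st)
    (he : Eff I V st st' l k) (hI : I 2 ∧ I 3 ∧ I 5 ∧ I 12) (hV : V 0 ∧ V 1) :
    Ready N s n₀ d H row col v st' where
  idx2 := (he.idx 2 hI.1).trans h.idx2
  idx3 := (he.idx 3 hI.2.1).trans h.idx3
  idx5 := (he.idx 5 hI.2.2.1).trans h.idx5
  idx12 := (he.idx 12 hI.2.2.2).trans h.idx12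
  val0 := (he.val 0 hV.1).trans h.val0
  val1 := (he.val 1 hV.2).trans h.val1
  idxArr0 := (he.idxArr 0 (by decide) (by decide)).trans h.idxArr0
  idxArr1 := (he.idxArr 1 (by decide) (by decide)).trans h.idxArr1
  valArr0 := he.valArr.trans h.valArr0
  idxArr4 x hx := by rw [he.idxArr 4 (by decide) (by decide)]; exact h.idxArr4 x hx

section
variable {N s n₀ d κ : ℕ} {H : ℝ} {row col : ℕ → ℕ} {v : ℕ → ℝ} {st : State}

/-- Append the entries contributed by the nonzero entry whose number is in index register `20`. -/
def entryCode : List Instr :=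
  [.idxLoad 21 0 20, .idxSucc 21, .idxLoad 22 1 20, .idxSucc 22, .idxLoad 22 4 22, .valLoad 5 0 20] ++
    (emitBalanced 21 22 5 ++ emitBalanced 22 21 5)

/-- Adding two index registers is not a unit-cost operation, so the shift by `s` is a lookup in
array 4; `hcol` keeps the argument inside the tabulated range. -/
theorem eff_entryCode (h : Ready N s n₀ d H row col v st)
    (hcol : col (st.idx 20) + 1 < n₀ + n₀) :
    Eff (Below 21) (Below 5) st (execs O ω entryCode st)
      (entryTriples s (row (st.idx 20)) (col (st.idx 20)) (v (st.idx 20))) 0 := by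
  rw [entryCode, execs_append, execs_append]
  have e1 : Eff (Below 21) (Below 5) st (execs O ω [.idxLoad 21 0 20, .idxSucc 21, .idxLoad 22 1 20,
      .idxSucc 22, .idxLoad 22 4 22, .valLoad 5 0 20] st) [] 0 :=
    eff_execs (by simp [Instr.Keeps]) st
  have h21 : (execs O ω [.idxLoad 21 0 20, .idxSucc 21, .idxLoad 22 1 20,
      .idxSucc 22, .idxLoad 22 4 22, .valLoad 5 0 20] st).idx 21 = row (st.idx 20) + 1 := by
    simp [execs, Instr.exec, h.idxArr0]
  have h22 : (execs O ω [.idxLoad 21 0 20, .idxSucc 21, .idxLoad 22 1 20,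
      .idxSucc 22, .idxLoad 22 4 22, .valLoad 5 0 20] st).idx 22 = col (st.idx 20) + 1 + s := by
    simp [execs, Instr.exec, h.idxArr1, h.idxArr4 _ hcol]
  have h5 : (execs O ω [.idxLoad 21 0 20, .idxSucc 21, .idxLoad 22 1 20,
      .idxSucc 22, .idxLoad 22 4 22, .valLoad 5 0 20] st).val 5 = v (st.idx 20) := by
    simp [execs, Instr.exec, h.valArr0]
  set s₁ := execs O ω [.idxLoad 21 0 20, .idxSucc 21, .idxLoad 22 1 20,
      .idxSucc 22, .idxLoad 22 4 22, .valLoad 5 0 20] st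
  have r1 := h.of_eff e1 (by simp [Below]) (by simp [Below])
  have e2 := eff_emitBalanced (O := O) (ω := ω) (I := Below 25) (V := Below 6) (by simp [Below])
    (by simp [Below]) (i := 21) (j := 22) (r := 5) r1.idx12 r1.val1 (by decide)
  set s₂ := execs O ω (emitBalanced 21 22 5) s₁
  have r2 := r1.of_eff e2 (by simp [Below]) (by simp [Below])
  have e3 := eff_emitBalanced (O := O) (ω := ω) (I := Below 25) (V := Below 6) (by simp [Below])
    (by simp [Below]) (i := 22) (j := 21) (r := 5) r2.idx12 r2.val1 (by decide)
  rw [e2.idx 21 (by simp [Below]), e2.idx 22 (by simp [Below]), e2.val 5 (by simp [Below])] at e3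
  rw [h21, h22, h5] at e2 e3
  exact e1.trans ((e2.trans e3).weaken (fun i hi => hi.trans (by decide)) fun i hi => hi.trans (by decide))

theorem spec_entries (h : Ready N s n₀ d H row col v st) (hcol : ∀ t < N, col t + 1 < n₀ + n₀) :
    Spec O ω (forLoop 20 2 (block entryCode)) st (N * 100 + 3) fun st' =>
      Eff (Below 20) (Below 5) st st'
        ((List.range N).flatMap fun t => entryTriples s (row t) (col t) (v t)) 0 := by
  refine Spec.forLoop (by decide) (fun i st' => Eff (Below 20) (Below 5) st st'
    ((List.range i).flatMap fun t => entryTriples s (row t) (col t) (v t)) 0) N 90 h.idx2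
    (eff_exec (by simp [Instr.Keeps]) st) ?_
  intro i hi s₁ hs₁ h20 h2
  refine Spec.block ?_ (by simp [entryCode, emitBalanced, emit])
  have e := eff_entryCode (O := O) (ω := ω) (h.of_eff hs₁ (by simp [Below]) (by simp [Below]))
    (by rw [h20]; exact hcol i hi)
  rw [h20] at e
  refine ⟨(e.idx 20 (by simp [Below])).trans h20, (e.idx 2 (by simp [Below])).trans h2, ?_⟩
  have := (hs₁.trans (e.weaken (fun i hi => hi.trans (by decide)) fun _ h => h)).trans
    (eff_exec (O := O) (ω := ω) (a := .idxSucc 20) (by simp [Instr.Keeps]) _)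
  rwa [List.append_nil, ← List.flatMap_singleton
    (fun t => entryTriples s (row t) (col t) (v t)) i, ← List.flatMap_append, ← List.range_succ] at this

/-- Append one random entry of the row whose position is in index register `21`. -/
def pickCode : List Instr :=
  [.randIdx 31 10, .idxSucc 31, .idxLoad 31 4 31, .idxLoad 31 4 31, .gauss 6] ++
    (emitBalanced 21 31 6 ++ emitBalanced 31 21 6)

/-- Two lookups in succession shift the random column by `s + s`, and `hκ` keeps the second one in
the table. The column consumes the first of the two cells, the entry the second. -/
theorem eff_pickCode (h : Ready N s n₀ d H row col v st)
    (hκ : uniformIdx (st.idx 10) (ω st.drawn).2 + 1 + s < n₀ + n₀) :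
    Eff (Below 31) (Below 5) st (execs O ω pickCode st)
      (balanced (st.idx 21) (uniformIdx (st.idx 10) (ω st.drawn).2 + 1 + (s + s)) (ω (st.drawn + 1)).1 ++
        balanced (uniformIdx (st.idx 10) (ω st.drawn).2 + 1 + (s + s)) (st.idx 21)
          (ω (st.drawn + 1)).1) 2 := by
  rw [pickCode, execs_append, execs_append]
  have e1 : Eff (Below 31) (Below 5) st (execs O ω [.randIdx 31 10, .idxSucc 31, .idxLoad 31 4 31,
      .idxLoad 31 4 31, .gauss 6] st) [] 2 := by
    have e2 := eff_randIdx (ω := ω) (O := O) (I := Below 31) (V := Below 5) (i := 31) (j := 10)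
      (by simp [Below]) (by decide) st
    have e3 := eff_execs (O := O) (ω := ω) (I := Below 31) (V := Below 5)
      (l := [.idxSucc 31, .idxLoad 31 4 31, .idxLoad 31 4 31]) (by simp [Instr.Keeps])
      ((Instr.randIdx 31 10).exec O ω st)
    exact (e2.trans e3).trans (eff_gauss (O := O) (ω := ω) (by simp [Below]) _)
  have h31 : (execs O ω [.randIdx 31 10, .idxSucc 31, .idxLoad 31 4 31,
      .idxLoad 31 4 31, .gauss 6] st).idx 31 =
      uniformIdx (st.idx 10) (ω st.drawn).2 + 1 + (s + s) := by
    simp [execs, Instr.exec, h.idxArr4 _ (lt_of_le_of_lt (Nat.le_add_right _ s) hκ), h.idxArr4 _ hκ]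
    omega
  have h6 : (execs O ω [.randIdx 31 10, .idxSucc 31, .idxLoad 31 4 31,
      .idxLoad 31 4 31, .gauss 6] st).val 6 = (ω (st.drawn + 1)).1 := by
    simp [execs, Instr.exec]
  set s₁ := execs O ω [.randIdx 31 10, .idxSucc 31, .idxLoad 31 4 31,
      .idxLoad 31 4 31, .gauss 6] st
  have r1 := h.of_eff e1 (by simp [Below]) (by simp [Below])
  have h21 : s₁.idx 21 = st.idx 21 := e1.idx 21 (by simp [Below])
  have e2 := eff_emitBalanced (O := O) (ω := ω) (I := Below 35) (V := Below 7) (by simp [Below])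
    (by simp [Below]) (i := 21) (j := 31) (r := 6) r1.idx12 r1.val1 (by decide)
  set s₂ := execs O ω (emitBalanced 21 31 6) s₁
  have r2 := r1.of_eff e2 (by simp [Below]) (by simp [Below])
  have e3 := eff_emitBalanced (O := O) (ω := ω) (I := Below 35) (V := Below 7) (by simp [Below])
    (by simp [Below]) (i := 31) (j := 21) (r := 6) r2.idx12 r2.val1 (by decide)
  rw [e2.idx 21 (by simp [Below]), e2.idx 31 (by simp [Below]), e2.val 6 (by simp [Below])] at e3
  rw [h21, h31, h6] at e2 e3
  exact e1.trans ((e2.trans e3).weaken (fun i hi => hi.trans (by decide)) fun i hi => hi.trans (by decide))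

/-- Append the border entries of the row whose number is in index register `20`. -/
def rowCode : Prog :=
  .seq (block ([.idxCopy 21 20, .idxSucc 21, .gauss 5, .mul 5 5 0] ++ emitBalanced 21 12 5))
    (forLoop 30 5 (block pickCode))

/-- The order of the draws agrees with the layout of `gCell`, `cCell` and `yCell`; the number of
cells consumed so far therefore identifies each sample with its place in the probabilistic analysis.
-/
theorem spec_rowCode (h : Ready N s (s + s) d H row col v st) (hκ0 : 0 < κ) (hκ : κ ≤ s + s)
    (h10 : st.idx 10 = κ) {o x : ℕ} (hx : st.idx 20 = x)
    (ho : st.drawn = o + x * (d * 2 + 1)) :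
    Spec O ω rowCode st (d * 100 + 50) fun st' => Eff (Below 21) (Below 5) st st'
      (borderTriples (s + s) d H x (gDraw o d ω x) (cDraw o d κ ω x) (yDraw o d ω x))
      (d * 2 + 1) := by
  refine Spec.seq 30 (d * 100 + 3) (Spec.block ?_ (by simp [emitBalanced, emit]))
  rw [execs_append]
  have e1 : Eff (Below 21) (Below 5) st (execs O ω [.idxCopy 21 20, .idxSucc 21, .gauss 5,
      .mul 5 5 0] st) [] 1 := by
    have e2 := eff_execs (O := O) (ω := ω) (I := Below 21) (V := Below 5)
      (l := [.idxCopy 21 20, .idxSucc 21]) (by simp [Instr.Keeps]) st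
    have e3 := eff_gauss (O := O) (ω := ω) (I := Below 21) (V := Below 5) (r := 5)
      (by simp [Below]) (execs O ω [.idxCopy 21 20, .idxSucc 21] st)
    exact (e2.trans e3).trans (eff_exec (O := O) (ω := ω) (a := .mul 5 5 0) (by simp [Instr.Keeps]) _)
  have h21 : (execs O ω [.idxCopy 21 20, .idxSucc 21, .gauss 5, .mul 5 5 0] st).idx 21 = x + 1 := by
    simp [execs, Instr.exec, hx]
  have h5 : (execs O ω [.idxCopy 21 20, .idxSucc 21, .gauss 5, .mul 5 5 0] st).val 5 =
      gDraw o d ω x * H := by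
    simp [execs, Instr.exec, h.val0, gDraw, gCell, ho]
  set s₁ := execs O ω [.idxCopy 21 20, .idxSucc 21, .gauss 5, .mul 5 5 0] st
  have r1 := h.of_eff e1 (by simp [Below]) (by simp [Below])
  have e2 := eff_emitBalanced (O := O) (ω := ω) (I := Below 30) (V := Below 6) (by simp [Below])
    (by simp [Below]) (i := 21) (j := 12) (r := 5) r1.idx12 r1.val1 (by decide)
  rw [h21, h5, r1.idx12] at e2
  set s₂ := execs O ω (emitBalanced 21 12 5) s₁
  have r2 := r1.of_eff e2 (by simp [Below]) (by simp [Below])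
  have h21' : s₂.idx 21 = x + 1 := (e2.idx 21 (by simp [Below])).trans h21
  have h10' : s₂.idx 10 = κ := (e2.idx 10 (by simp [Below])).trans
    ((e1.idx 10 (by simp [Below])).trans h10)
  have hdrawn : s₂.drawn = o + x * (d * 2 + 1) + 1 := by rw [e2.drawn, e1.drawn, ho]
  have e12 := e1.trans (e2.weaken (fun i (hi : i < 21) => hi.trans (by decide : 21 < 30))
    fun i (hi : i < 5) => hi.trans (by decide : 5 < 6))
  let f : ℕ → List Triple := fun k =>
    balanced (x + 1) (cDraw o d κ ω x k + 1 + (s + s)) (yDraw o d ω x k) ++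
      balanced (cDraw o d κ ω x k + 1 + (s + s)) (x + 1) (yDraw o d ω x k)
  refine (Spec.forLoop (by decide) (fun k st' => Eff (Below 30) (Below 5) s₂ st'
    ((List.range k).flatMap f) (k * 2)) d 90 r2.idx5
    (by simpa using eff_exec (by simp [Instr.Keeps]) s₂) ?_ (by omega)).mono le_rfl ?_
  · intro k hk s₃ e3 h30 h5'
    refine Spec.block ?_ (by simp [pickCode, emitBalanced, emit])
    have h10'' : s₃.idx 10 = κ := (e3.idx 10 (by simp [Below])).trans h10'
    have h21'' : s₃.idx 21 = x + 1 := (e3.idx 21 (by simp [Below])).trans h21'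
    have hd3 : s₃.drawn = cCell o d x k := by rw [e3.drawn, hdrawn, cCell]
    have hd3' : s₃.drawn + 1 = yCell o d x k := by rw [hd3, cCell, yCell]
    have hlt := uniformIdx_lt hκ0 (ω s₃.drawn).2
    have e4 := eff_pickCode (O := O) (ω := ω) (r2.of_eff e3 (by simp [Below]) (by simp [Below]))
      (by rw [h10'']; omega)
    rw [h10'', h21'', hd3', hd3] at e4
    refine ⟨(e4.idx 30 (by simp [Below])).trans h30, (e4.idx 5 (by simp [Below])).trans h5', ?_⟩
    have := (e3.trans (e4.weaken (fun i hi => hi.trans (by decide)) fun _ h => h)).trans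
      (eff_exec (O := O) (ω := ω) (a := .idxSucc 30) (by simp [Instr.Keeps]) _)
    rw [List.append_nil, Nat.add_zero, ← Nat.succ_mul] at this
    rw [List.range_succ, List.flatMap_append, List.flatMap_singleton]
    exact this
  · intro s₃ e3
    have := e12.trans (e3.weaken (fun i (hi : i < 21) => hi.trans (by decide : 21 < 30)) fun _ h => h)
    rw [show 1 + 0 + d * 2 = d * 2 + 1 by omega] at this
    exact this

theorem spec_rows (h : Ready N s (s + s) d H row col v st) (hκ0 : 0 < κ) (hκ : κ ≤ s + s)
    (h10 : st.idx 10 = κ) {o : ℕ} (ho : st.drawn = o) :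
    Spec O ω (forLoop 20 3 rowCode) st ((s + s) * (d * 100 + 53) + 3) fun st' =>
      Eff (Below 20) (Below 5) st st' ((List.range (s + s)).flatMap fun x =>
        borderTriples (s + s) d H x (gDraw o d ω x) (cDraw o d κ ω x) (yDraw o d ω x))
      ((s + s) * (d * 2 + 1)) := by
  refine Spec.forLoop (by decide) (fun i st' => Eff (Below 20) (Below 5) st st'
    ((List.range i).flatMap fun x =>
        borderTriples (s + s) d H x (gDraw o d ω x) (cDraw o d κ ω x) (yDraw o d ω x))
    (i * (d * 2 + 1))) (s + s) (d * 100 + 50) h.idx3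
    (by simpa using eff_exec (by simp [Instr.Keeps]) st) ?_ le_rfl
  intro i hi s₁ hs₁ h20 h3
  refine (spec_rowCode (h.of_eff hs₁ (by simp [Below]) (by simp [Below])) hκ0 hκ
    ((hs₁.idx 10 (by simp [Below])).trans h10) h20 (by rw [hs₁.drawn, ho])).mono le_rfl ?_
  intro s₂ e
  refine ⟨(e.idx 20 (by simp [Below])).trans h20, (e.idx 3 (by simp [Below])).trans h3, ?_⟩
  have := (hs₁.trans (e.weaken (fun i hi => hi.trans (by decide)) fun _ h => h)).trans
    (eff_exec (O := O) (ω := ω) (a := .idxSucc 20) (by simp [Instr.Keeps]) _)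
  rw [List.append_nil, Nat.add_zero, ← Nat.succ_mul] at this
  rw [List.range_succ, List.flatMap_append, List.flatMap_singleton]
  exact this

end
end RealRAM

end

/-! ### Assembling a query, and the binary search -/

section

namespace RealRAM

variable {O : SquareOracle} {ω : Tape}

theorem spec_iterate {r bd k : ℕ} {l : List Instr} {F : ℕ → ℕ} {st : State}
    (hl : ∀ s, execs O ω l s = { s with idx := Function.update s.idx r (F (s.idx r)) })
    (hk : st.idx bd = k) (hr : r ≠ 30) (hbd : bd ≠ 30) (hrb : r ≠ bd) {t : ℕ}
    (ht : k * (2 * l.length + 4) + 3 ≤ t := by simp) :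
    Spec O ω (forLoop 30 bd (block l)) st t fun st' => st' =
      { st with idx := Function.update (Function.update st.idx r (F^[k] (st.idx r))) 30 k } := by
  refine Spec.forLoop hbd.symm (fun i st' => st' =
    { st with idx := Function.update (Function.update st.idx r (F^[i] (st.idx r))) 30 i })
    k (2 * l.length + 1) hk (by simp [Instr.exec]) ?_ ht
  rintro i hi _ rfl - -
  refine Spec.block ?_ le_rfl
  rw [hl]
  refine ⟨by simp [hr.symm], by simp [hbd, hrb.symm, hk], ?_⟩
  simp only [Instr.exec, Function.iterate_succ_apply']
  congr 1
  ext j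
  by_cases h1 : j = 30
  · subst h1; simp [hr.symm]
  · by_cases h2 : j = r
    · subst h2; simp [hr]
    · simp [h1, h2]

theorem iterate_pred_pred (k x : ℕ) : (fun y => y - 1 - 1)^[k] x = x - 2 * k := by
  induction k with
  | zero => rfl
  | succ k ih => rw [Function.iterate_succ_apply', ih]; omega

theorem iterate_succ_nat (k x : ℕ) : (fun y => y + 1)^[k] x = x + k := by
  induction k with
  | zero => rfl
  | succ k ih => rw [Function.iterate_succ_apply', ih]; omega

/-- Add the content of index register `b` to index register `r`. -/
def addCode (r b : ℕ) : Prog := forLoop 30 b (block [.idxSucc r])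

theorem spec_addCode {r bd k : ℕ} {st : State} (hk : st.idx bd = k) (hr : r ≠ 30) (hbd : bd ≠ 30)
    (hrb : r ≠ bd) {t : ℕ} (ht : k * 6 + 3 ≤ t := by omega) :
    Spec O ω (addCode r bd) st t fun st' => st' =
      { st with idx := Function.update (Function.update st.idx r (st.idx r + k)) 30 k } := by
  have := spec_iterate (O := O) (ω := ω) (l := [.idxSucc r]) (F := fun y => y + 1) (fun _ => rfl)
    hk hr hbd hrb (t := t) (by simpa using ht)
  rwa [iterate_succ_nat] at this

/-- Move index registers `8` and `9` towards each other until they meet. -/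
def midCode : Prog := .loop (.idxLt 8 9) (block [.idxSucc 8, .idxPred 9])

/-- Halving without division. Register 8 stops at the upper midpoint of `a` and `b`, so the tested
number exceeds `a` whenever a < b. -/
theorem spec_midCode {st : State} {a b : ℕ} (ha : st.idx 8 = a) (hb : st.idx 9 = b) {t : ℕ}
    (ht : (b - a) * 6 + 7 ≤ t) :
    Spec O ω midCode st t fun st' => st' =
      { st with idx := Function.update (Function.update st.idx 8 (a + (b - a + 1) / 2)) 9
                  (b - (b - a + 1) / 2) } := by
  refine Spec.loop (fun i st' => st' =
    { st with idx := Function.update (Function.update st.idx 8 (a + i)) 9 (b - i) })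
    ((b - a + 1) / 2) 5 ?_ ?_ ?_ (by omega)
  · rintro i hi _ rfl
    refine ⟨by simp [Test.Holds]; omega, Spec.block ?_⟩
    simp only [execs, Instr.exec]
    congr 1
    ext j
    by_cases h1 : j = 9
    · subst h1; simp; omega
    · by_cases h2 : j = 8
      · subst h2; simp; omega
      · simp [h1, h2]
  · rintro _ rfl
    simp [Test.Holds]; omega
  · simp [← ha, ← hb]

section
variable {m n : ℕ} (A : Matrix (Fin m) (Fin n) ℝ) (e : Listing A) (d : ℕ) (H : ℝ)

/-- The store is ready for rank tests of the input matrix `A`. -/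
abbrev ReadyFor (st : State) : Prop :=
  Ready (nnz A) (m + n) ((m + n) + (m + n)) d H ((inputState A e).idxArr 0)
    ((inputState A e).idxArr 1) ((inputState A e).valArr 0) st

/-- The query `q` is the rank test of `A` for the number `r` with the random samples from cell `o`
on. -/
structure IsTest (ω : Tape) (o r : ℕ) (q : Query) : Prop where
  dim_eq : q.dim = ((m + n) + (m + n) - 2 * r) + 1 + ((m + n) + (m + n))
  triples_eq : q.triples = matrixTriples A e d H (gDraw o d ω)
    (cDraw o d ((m + n) + (m + n) - 2 * r) ω) (yDraw o d ω)

/-- Produce the list for the rank test for the number in index register `8`. -/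
def buildCode : Prog :=
  .seq (block [.idxCopy 10 3]) <| .seq (forLoop 30 8 (block [.idxPred 10, .idxPred 10])) <|
  .seq (block [.idxCopy 11 10, .idxSucc 11]) <| .seq (addCode 11 3) <|
  .seq (block ([.idxConst 40 0, .idxConst 21 1, .ofIdx 5 21] ++ emit 12 12 5)) <|
  .seq (forLoop 20 2 (block entryCode)) (forLoop 20 3 rowCode)

variable {A e d H}

/-- The bound on `r` makes κ = n₀ - 2r positive, so random columns can be drawn. -/
theorem spec_buildCode {st : State} {r : ℕ} (h : ReadyFor A e d H st) (h8 : st.idx 8 = r)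
    (hr : r < m + n) :
    Spec O ω buildCode st (nnz A * 100 + ((m + n) + (m + n)) * (d * 100 + 70) + 100) fun st' =>
      ReadyFor A e d H st' ∧ (∀ i < 10, st'.idx i = st.idx i) ∧
      st'.drawn = st.drawn + ((m + n) + (m + n)) * (d * 2 + 1) ∧ st'.queries = st.queries ∧
      st'.idx 11 = ((m + n) + (m + n) - 2 * r) + 1 + ((m + n) + (m + n)) ∧
      st'.triples = matrixTriples A e d H (gDraw st.drawn d ω)
        (cDraw st.drawn d ((m + n) + (m + n) - 2 * r) ω) (yDraw st.drawn d ω) := by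
  set n₀ := (m + n) + (m + n) with hn₀
  set κ := n₀ - 2 * r with hκ
  refine Spec.seq 3 (nnz A * 100 + n₀ * (d * 100 + 70) + 96) (Spec.block ?_) (by omega)
  simp only [execs, Instr.exec]
  refine Spec.seq (n₀ * 4 + 3) (nnz A * 100 + n₀ * (d * 100 + 66) + 92)
    ((spec_iterate (k := r) (F := fun y => y - 1 - 1) (r := 10) (fun s => by
      simp [execs, Instr.exec]) (by simp [h8]) (by decide) (by decide) (by decide)
      (by simp; omega)).mono le_rfl ?_) (by nlinarith)
  rintro _ rfl
  rw [iterate_pred_pred]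
  refine Spec.seq 5 (nnz A * 100 + n₀ * (d * 100 + 66) + 86) (Spec.block ?_) (by omega)
  simp only [execs, Instr.exec]
  refine Spec.seq (n₀ * 6 + 3) (nnz A * 100 + n₀ * (d * 100 + 60) + 82)
    ((spec_addCode (k := n₀) (by simp [h.idx3, hn₀]) (by decide) (by decide)
      (by decide)).mono le_rfl ?_) (by nlinarith)
  rintro _ rfl
  refine Spec.seq 15 (nnz A * 100 + n₀ * (d * 100 + 53) + 10) (Spec.block ?_ (by simp [emit]))
    (by nlinarith)
  rw [execs_append]
  set s₁ : State := execs O ω [.idxConst 40 0, .idxConst 21 1, .ofIdx 5 21] _ with hs₁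
  have i₁ : ∀ i < 20, i ≠ 10 → i ≠ 11 → s₁.idx i = st.idx i := by
    intro i hi h10 h11
    rw [hs₁]
    simp [execs, Instr.exec, h10, h11, show i ≠ 30 by omega, show i ≠ 40 by omega,
      show i ≠ 21 by omega]
  have t₁ : s₁.triples = [] := by
    simp [hs₁, State.triples, execs, Instr.exec]
  have r₁ : ReadyFor A e d H s₁ :=
    { idx2 := (i₁ 2 (by decide) (by decide) (by decide)).trans h.idx2
      idx3 := (i₁ 3 (by decide) (by decide) (by decide)).trans h.idx3
      idx5 := (i₁ 5 (by decide) (by decide) (by decide)).trans h.idx5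
      idx12 := (i₁ 12 (by decide) (by decide) (by decide)).trans h.idx12
      val0 := by simp [hs₁, execs, Instr.exec, h.val0]
      val1 := by simp [hs₁, execs, Instr.exec, h.val1]
      idxArr0 := h.idxArr0
      idxArr1 := h.idxArr1
      valArr0 := h.valArr0
      idxArr4 := h.idxArr4 }
  have h10 : s₁.idx 10 = κ := by
    simp [hs₁, execs, Instr.exec, h.idx3, hκ, hn₀]
  have h11 : s₁.idx 11 = κ + 1 + n₀ := by
    simp [hs₁, execs, Instr.exec, h.idx3, hκ, hn₀]
  have h5 : s₁.val 5 = 1 := by simp [hs₁, execs, Instr.exec]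
  have e₁ := eff_emit (O := O) (ω := ω) (I := Below 20) (V := Below 5) (by simp [Below]) 12 12 5 s₁
  rw [r₁.idx12, h5] at e₁
  have r₂ := r₁.of_eff e₁ (by simp [Below]) (by simp [Below])
  refine Spec.seq (nnz A * 100 + 3) (n₀ * (d * 100 + 53) + 3)
    ((spec_entries r₂ ?_).mono le_rfl ?_) (by omega)
  · intro t ht
    have := (e ⟨t, ht⟩).1.2.2
    simp only [inputState, ht, dif_pos, if_true, one_ne_zero, if_false]; omega
  intro s₃ e₂
  have r₃ := r₂.of_eff e₂ (by simp [Below]) (by simp [Below])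
  have e₁₂ := e₁.trans e₂
  refine (spec_rows (κ := κ) r₃ (by omega) (by omega) ((e₁₂.idx 10 (by simp [Below])).trans h10)
    (e₁₂.drawn)).mono le_rfl ?_
  intro s₄ e₃
  have e₁₂₃ := e₁₂.trans e₃
  have hd : s₁.drawn = st.drawn := rfl
  refine ⟨r₃.of_eff e₃ (by simp [Below]) (by simp [Below]), fun i hi => ?_, ?_, ?_, ?_, ?_⟩
  · exact (e₁₂₃.idx i (by simp only [Below]; omega)).trans
      (i₁ i (by omega) (by omega) (by omega))
  · rw [e₁₂₃.drawn, hd, Nat.zero_add, hn₀]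
  · exact e₁₂₃.queries
  · exact (e₁₂₃.idx 11 (by simp [Below])).trans h11
  · rw [e₁₂₃.triples, t₁, hd]
    rfl

/-- One round of the binary search. -/
def roundCode : Prog :=
  .seq (block [.idxCopy 8 6, .idxCopy 9 7]) <| .seq midCode <| .seq buildCode <|
  .seq (.op (.query 16 11 40 2 3 1))
    (.ite (.idxLt 12 16) (.op (.idxCopy 6 8)) (block [.idxCopy 7 8, .idxPred 7]))

/-- The oracle answers correctly to all tests that may occur in the first `J` rounds. -/
def Reliable (O : SquareOracle) (ω : Tape) (A : Matrix (Fin m) (Fin n) ℝ) (e : Listing A) (d : ℕ)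
    (H : ℝ) (J : ℕ) : Prop :=
  ∀ j < J, ∀ r ≤ min m n, ∀ q, IsTest A e d H ω (j * (((m + n) + (m + n)) * (d * 2 + 1))) r q →
    (O q.dim q.matrix = true ↔ r ≤ A.rank)

/-- The invariant of the binary search after `j` rounds. -/
structure Search (O : SquareOracle) (ω : Tape) (A : Matrix (Fin m) (Fin n) ℝ) (e : Listing A)
    (d : ℕ) (H : ℝ) (J j : ℕ) (st : State) : Prop where
  ready : ReadyFor A e d H st
  le : st.idx 6 ≤ st.idx 7
  le_min : st.idx 7 ≤ min m n
  drawn : st.drawn = j * (((m + n) + (m + n)) * (d * 2 + 1))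
  length : st.queries.length = j
  isTest : ∀ q ∈ st.queries, ∃ j' < j, ∃ r ≤ min m n,
    IsTest A e d H ω (j' * (((m + n) + (m + n)) * (d * 2 + 1))) r q
  rank : Reliable O ω A e d H J → st.idx 6 ≤ A.rank ∧ A.rank ≤ st.idx 7

/-- A positive answer raises the lower end to the upper midpoint `r`, a negative one lowers the
upper end to r - 1; a gap g becomes ⌊g/2⌋ or ⌈g/2⌉ - 1. Only the enclosure of the rank needs a
reliable oracle; the halving, and so the running time, does not. -/
theorem spec_roundCode {st : State} {J j : ℕ} (hm : 0 < m) (hn : 0 < n)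
    (h : Search O ω A e d H J j st) (hj : j < J) (hlt : st.idx 6 < st.idx 7) :
    Spec O ω roundCode st (nnz A * 100 + ((m + n) + (m + n)) * (d * 100 + 80) + 200) fun st' =>
      Search O ω A e d H J (j + 1) st' ∧ st'.idx 7 - st'.idx 6 ≤ (st.idx 7 - st.idx 6) / 2 := by
  set n₀ := (m + n) + (m + n) with hn₀
  have hle := h.le_min
  have hmin := min_le_left m n
  refine Spec.seq 5 (nnz A * 100 + n₀ * (d * 100 + 80) + 190) (Spec.block ?_) (by omega)
  simp only [execs, Instr.exec]
  refine Spec.seq (n₀ * 6 + 7) (nnz A * 100 + n₀ * (d * 100 + 70) + 150)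
    ((spec_midCode (a := st.idx 6) (b := st.idx 7) (by simp) (by simp) (by omega)).mono le_rfl ?_)
    (by nlinarith)
  intro s₁ hs₁
  set r := st.idx 6 + (st.idx 7 - st.idx 6 + 1) / 2 with hr
  have r₁ : ReadyFor A e d H s₁ :=
    { idx2 := by simp [hs₁, h.ready.idx2]
      idx3 := by simp [hs₁, h.ready.idx3]
      idx5 := by simp [hs₁, h.ready.idx5]
      idx12 := by simp [hs₁, h.ready.idx12]
      val0 := by rw [hs₁]; exact h.ready.val0
      val1 := by rw [hs₁]; exact h.ready.val1
      idxArr0 := by rw [hs₁]; exact h.ready.idxArr0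
      idxArr1 := by rw [hs₁]; exact h.ready.idxArr1
      valArr0 := by rw [hs₁]; exact h.ready.valArr0
      idxArr4 := by rw [hs₁]; exact h.ready.idxArr4 }
  have hd₁ : s₁.drawn = j * (n₀ * (d * 2 + 1)) := by rw [hs₁]; exact h.drawn
  have h8₁ : s₁.idx 8 = r := by simp [hs₁, hr]
  have h6₁ : s₁.idx 6 = st.idx 6 := by simp [hs₁]
  have h7₁ : s₁.idx 7 = st.idx 7 := by simp [hs₁]
  have hq₁ : s₁.queries = st.queries := by rw [hs₁]
  refine Spec.seq (nnz A * 100 + n₀ * (d * 100 + 70) + 100) 20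
    ((spec_buildCode (r := r) r₁ h8₁ (by omega)).mono le_rfl ?_) (by omega)
  rintro s₂ ⟨r₂, i₂, d₂, q₂, h11, tr₂⟩
  let q : Query := ⟨s₂.idx 11, s₂.idx 40, s₂.idxArr 2, s₂.idxArr 3, s₂.valArr 1⟩
  have hq : IsTest A e d H ω (j * (n₀ * (d * 2 + 1))) r q := by
    refine ⟨h11, ?_⟩
    change s₂.triples = _
    rw [tr₂, hd₁]
  have h8 : s₂.idx 8 = r := (i₂ 8 (by decide)).trans h8₁
  have h6 : s₂.idx 6 = st.idx 6 := (i₂ 6 (by decide)).trans h6₁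
  have h7 : s₂.idx 7 = st.idx 7 := (i₂ 7 (by decide)).trans h7₁
  have hready : ∀ f : ℕ → ℕ, (∀ i, i ≠ 6 → i ≠ 7 → i ≠ 16 → f i = s₂.idx i) →
      ReadyFor A e d H { s₂ with idx := f, queries := q :: s₂.queries } := fun f hf =>
    { idx2 := (hf 2 (by decide) (by decide) (by decide)).trans r₂.idx2
      idx3 := (hf 3 (by decide) (by decide) (by decide)).trans r₂.idx3
      idx5 := (hf 5 (by decide) (by decide) (by decide)).trans r₂.idx5
      idx12 := (hf 12 (by decide) (by decide) (by decide)).trans r₂.idx12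
      val0 := r₂.val0
      val1 := r₂.val1
      idxArr0 := r₂.idxArr0
      idxArr1 := r₂.idxArr1
      valArr0 := r₂.valArr0
      idxArr4 := r₂.idxArr4 }
  have hfinal : ∀ f : ℕ → ℕ, (∀ i, i ≠ 6 → i ≠ 7 → i ≠ 16 → f i = s₂.idx i) →
      f 6 ≤ f 7 → f 7 ≤ min m n →
      (Reliable O ω A e d H J → f 6 ≤ A.rank ∧ A.rank ≤ f 7) →
      Search O ω A e d H J (j + 1) { s₂ with idx := f, queries := q :: s₂.queries } := by
    intro f hf h1 h2 h3
    refine ⟨hready f hf, h1, h2, ?_, ?_, ?_, h3⟩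
    · change s₂.drawn = _
      rw [d₂, hd₁]; ring
    · simp [q₂, hq₁, h.length]
    · intro q' hq'
      rcases List.mem_cons.1 hq' with rfl | hq'
      · exact ⟨j, by omega, r, by omega, hq⟩
      · rw [q₂, hq₁] at hq'
        obtain ⟨j', hj', r', hr', ht⟩ := h.isTest q' hq'
        exact ⟨j', by omega, r', hr', ht⟩
  refine Spec.seq 1 15 (Spec.op ?_) (by omega)
  refine Spec.ite 8 (fun hb => ?_) (fun hb => ?_)
  · refine Spec.op ?_
    have hO : O q.dim q.matrix = true := by
      by_contra hO
      simp only [Test.Holds, Instr.exec] at hb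
      rw [if_neg hO] at hb
      simp at hb
    simp only [Instr.exec]
    refine ⟨hfinal _ ?_ ?_ ?_ ?_, ?_⟩
    · intro i h6 h7 h16
      simp [h6, h16]
    · simp [h8, h7]; omega
    · simp [h7]; omega
    · intro hrel
      have h9 := (hrel j hj r (by omega) q hq).1 hO
      have h10 := (h.rank hrel).2
      simpa [h8, h7] using ⟨h9, h10⟩
    · simp [h8, h7]; omega
  · refine Spec.block ?_
    have hO : ¬ O q.dim q.matrix = true := by
      intro hO
      simp only [Test.Holds, Instr.exec] at hb
      rw [if_pos hO] at hb
      simp [r₂.idx12] at hb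
    simp only [execs, Instr.exec]
    refine ⟨hfinal _ ?_ ?_ ?_ ?_, ?_⟩
    · intro i h6 h7 h16
      simp [h7, h16]
    · simp [h8, h6]; omega
    · simp [h8]; omega
    · intro hrel
      have h9 : ¬ r ≤ A.rank := fun h => hO ((hrel j hj r (by omega) q hq).2 h)
      have h10 := (h.rank hrel).1
      have h11 : A.rank ≤ r - 1 := by omega
      simpa [h8, h6] using ⟨h10, h11⟩
    · simp [h8, h6]; omega

/-- A gap below 2^k is exhausted after at most k halvings, whatever the oracle answers. -/
theorem spec_search {J : ℕ} (hm : 0 < m) (hn : 0 < n) (k : ℕ) :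
    ∀ {j : ℕ} {st : State}, Search O ω A e d H J j st → j + k ≤ J →
      st.idx 7 - st.idx 6 < 2 ^ k →
      Spec O ω (.loop (.idxLt 6 7) roundCode) st
        (k * (nnz A * 100 + ((m + n) + (m + n)) * (d * 100 + 80) + 201) + 1) fun st' =>
        (∃ j' ≤ J, Search O ω A e d H J j' st') ∧ st'.idx 6 = st'.idx 7 := by
  induction k with
  | zero =>
    intro j st h hj hgap
    have := h.le
    exact Spec.loop_of_not (by simp only [Test.Holds]; omega) ⟨⟨j, by omega, h⟩, by omega⟩
  | succ k ih =>
    intro j st h hj hgap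
    by_cases hlt : st.idx 6 < st.idx 7
    · refine Spec.loop_of_holds _ (k * (nnz A * 100 + ((m + n) + (m + n)) * (d * 100 + 80) + 201) + 1)
        hlt ((spec_roundCode hm hn h (by omega) hlt).mono le_rfl ?_) (by rw [Nat.succ_mul]; omega)
      rintro s' ⟨h', hgap'⟩
      exact ih h' (by omega) (by rw [pow_succ] at hgap; omega)
    · have := h.le
      exact Spec.loop_of_not (by simpa only [Test.Holds] using hlt) ⟨⟨j, by omega, h⟩, by omega⟩

end
end RealRAM

end

/-! ### Preparatory computations and the complete program -/

section

namespace RealRAM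

variable {O : SquareOracle} {ω : Tape}

/-- Index register `13` receives `m + n`, and `3` and `14` twice and four times that number. -/
def sizeCode : Prog :=
  .seq (block [.idxCopy 13 0]) <| .seq (addCode 13 1) <| .seq (block [.idxCopy 3 13]) <|
  .seq (addCode 3 13) <| .seq (block [.idxCopy 14 3]) (addCode 14 3)

/-- Index register `7` receives the minimum of `m` and `n`. -/
def minCode : Prog := .ite (.idxLt 0 1) (block [.idxCopy 7 0]) (block [.idxCopy 7 1])

/-- Tabulate the function `x ↦ x + s` in index array `4`, where `s` is in index register `13`. -/
def shiftCode : Prog :=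
  .seq (block [.idxCopy 15 13]) (forLoop 20 14 (block [.idxStore 4 20 15, .idxSucc 15]))

/-- Index register `4` receives the binary logarithm of one plus the content of `2`. -/
def logCode : Prog :=
  .seq (block [.idxCopy 15 2, .idxSucc 15, .ofIdx 5 15, .idxConst 15 1, .ofIdx 6 15])
    (.loop (.valLt 6 5) (block [.idxSucc 4, .add 6 6 6]))

/-- Index register `5` receives `K` times the square of `4`, and value register `0` the
corresponding power of two. -/
def powCode (K : ℕ) : Prog :=
  .seq (block [.idxConst 15 1, .ofIdx 0 15, .idxConst 15 K]) <|
  forLoop 20 4 (forLoop 30 4 (forLoop 35 15 (block [.idxSucc 5, .add 0 0 0])))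

/-- Agreement of stores, except for index registers in `I` and value registers in `V`. -/
structure Same (I V : ℕ → Prop) (s s' : State) : Prop where
  idx : ∀ i, ¬ I i → s'.idx i = s.idx i
  val : ∀ r, ¬ V r → s'.val r = s.val r
  idxArr : s'.idxArr = s.idxArr
  valArr : s'.valArr = s.valArr
  drawn : s'.drawn = s.drawn
  queries : s'.queries = s.queries

theorem Same.trans {I V : ℕ → Prop} {s s' s'' : State} (h : Same I V s s') (h' : Same I V s' s'') :
    Same I V s s'' :=
  ⟨fun i hi => (h'.idx i hi).trans (h.idx i hi), fun i hi => (h'.val i hi).trans (h.val i hi),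
    h'.idxArr.trans h.idxArr, h'.valArr.trans h.valArr, h'.drawn.trans h.drawn,
    h'.queries.trans h.queries⟩

theorem Same.weaken {I V I' V' : ℕ → Prop} {s s' : State} (h : Same I V s s')
    (hI : ∀ i, I i → I' i) (hV : ∀ i, V i → V' i) : Same I' V' s s' :=
  { h with
    idx := fun i hi => h.idx i fun h' => hi (hI i h')
    val := fun i hi => h.val i fun h' => hi (hV i h') }

theorem spec_sizeCode {st : State} {m n : ℕ} (h0 : st.idx 0 = m) (h1 : st.idx 1 = n) {t : ℕ}
    (ht : (m + n) * 24 + 40 ≤ t) :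
    Spec O ω sizeCode st t fun st' => Same (· ∈ [3, 13, 14, 30]) (fun _ => False) st st' ∧
      st'.idx 13 = m + n ∧ st'.idx 3 = (m + n) + (m + n) ∧
      st'.idx 14 = ((m + n) + (m + n)) + ((m + n) + (m + n)) := by
  refine Spec.seq 3 ((m + n) * 24 + 36) (Spec.block ?_) (by omega)
  simp only [execs, Instr.exec]
  refine Spec.seq (n * 6 + 3) ((m + n) * 18 + 30)
    ((spec_addCode (k := n) (by simp [h1]) (by decide) (by decide) (by decide)).mono le_rfl ?_)
  rintro _ rfl
  refine Spec.seq 3 ((m + n) * 18 + 26) (Spec.block ?_) (by omega)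
  simp only [execs, Instr.exec]
  refine Spec.seq ((m + n) * 6 + 3) ((m + n) * 12 + 20)
    ((spec_addCode (k := m + n) (by simp [h0]) (by decide) (by decide) (by decide)).mono le_rfl ?_)
  rintro _ rfl
  refine Spec.seq 3 ((m + n) * 12 + 16) (Spec.block ?_) (by omega)
  simp only [execs, Instr.exec]
  refine (spec_addCode (k := (m + n) + (m + n)) (by simp [h0]) (by decide) (by decide)
    (by decide)).mono le_rfl ?_
  rintro _ rfl
  refine ⟨⟨fun i hi => ?_, fun _ _ => rfl, rfl, rfl, rfl, rfl⟩, ?_, ?_, ?_⟩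
  · simp only [List.mem_cons, List.not_mem_nil, or_false, not_or] at hi
    simp [hi.1, hi.2.1, hi.2.2.1, hi.2.2.2]
  · simp [h0]
  · simp [h0]
  · simp [h0]

theorem spec_minCode {st : State} {m n : ℕ} (h0 : st.idx 0 = m) (h1 : st.idx 1 = n) {t : ℕ}
    (ht : 4 ≤ t) :
    Spec O ω minCode st t fun st' => Same (· = 7) (fun _ => False) st st' ∧
      st'.idx 7 = min m n := by
  refine Spec.ite 3 (fun hb => Spec.block ?_) (fun hb => Spec.block ?_)
  all_goals
    simp only [Test.Holds, h0, h1] at hb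
    refine ⟨⟨fun i hi => ?_, fun _ _ => rfl, rfl, rfl, rfl, rfl⟩, ?_⟩
    · simp [execs, Instr.exec, hi]
    · simp [execs, Instr.exec, h0, h1]; omega

theorem spec_shiftCode {st : State} {s k : ℕ} (h13 : st.idx 13 = s) (h14 : st.idx 14 = k) {t : ℕ}
    (ht : k * 8 + 10 ≤ t) :
    Spec O ω shiftCode st t fun st' => (∀ i, i ≠ 15 → i ≠ 20 → st'.idx i = st.idx i) ∧
      st'.val = st.val ∧ (∀ a, a ≠ 4 → st'.idxArr a = st.idxArr a) ∧
      (∀ x < k, st'.idxArr 4 x = x + s) ∧ st'.valArr = st.valArr ∧ st'.drawn = st.drawn ∧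
      st'.queries = st.queries := by
  refine Spec.seq 3 (k * 8 + 3) (Spec.block ?_) (by omega)
  simp only [execs, Instr.exec]
  refine (Spec.forLoop (by decide) (fun x st' => ((∀ i, i ≠ 15 → i ≠ 20 → st'.idx i = st.idx i) ∧
      st'.val = st.val ∧ (∀ a, a ≠ 4 → st'.idxArr a = st.idxArr a) ∧
      (∀ y < x, st'.idxArr 4 y = y + s) ∧ st'.valArr = st.valArr ∧ st'.drawn = st.drawn ∧
      st'.queries = st.queries) ∧ st'.idx 15 = x + s) k 5 (by simp [h14]) ?_ ?_).mono le_rfl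
      fun _ h => h.1
  · refine ⟨⟨fun i h h' => by simp [Instr.exec, h, h'], rfl, fun _ _ => rfl, by simp, rfl, rfl,
      rfl⟩, by simp [Instr.exec, h13]⟩
  · rintro x hx s₁ ⟨⟨i₁, v₁, a₁, b₁, va₁, d₁, q₁⟩, h15⟩ h20 h14'
    refine Spec.block ⟨by simp [execs, Instr.exec, h20], by simp [execs, Instr.exec, h14'],
      ⟨fun i h h' => ?_, v₁, fun a ha => ?_, fun y hy => ?_, va₁, d₁, q₁⟩, ?_⟩
    · simp [execs, Instr.exec, h, h', i₁ i h h']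
    · simp [execs, Instr.exec, ha, a₁ a ha]
    · rcases eq_or_ne y x with rfl | hne
      · simp [execs, Instr.exec, h20, h15]
      · have : y < x := by omega
        simp [execs, Instr.exec, h20, hne, b₁ y this]
    · simp [execs, Instr.exec, h15]; omega

/-- A value register runs through the powers of two; the first one that is at least N + 1 has
exponent `Nat.clog 2 (N + 1)`. -/
theorem spec_logCode {st : State} {N : ℕ} (h2 : st.idx 2 = N) (h4 : st.idx 4 = 0) {t : ℕ}
    (ht : Nat.clog 2 (N + 1) * 6 + 20 ≤ t) :
    Spec O ω logCode st t fun st' => Same (· ∈ [4, 15]) (· ∈ [5, 6]) st st' ∧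
      st'.idx 4 = Nat.clog 2 (N + 1) := by
  refine Spec.seq 11 (Nat.clog 2 (N + 1) * 6 + 1) (Spec.block ?_) (by omega)
  simp only [execs, Instr.exec]
  refine (Spec.loop (fun x st' => Same (· ∈ [4, 15]) (· ∈ [5, 6]) st st' ∧ st'.idx 4 = x ∧
    st'.val 5 = (N + 1 : ℕ) ∧ st'.val 6 = 2 ^ x) (Nat.clog 2 (N + 1)) 5 ?_ ?_ ?_).mono le_rfl
    fun _ h => ⟨h.1, h.2.1⟩
  · rintro x hx s₁ ⟨hs, h4', h5, h6⟩
    refine ⟨?_, Spec.block ⟨hs.trans ⟨fun i hi => ?_, fun i hi => ?_, rfl, rfl, rfl, rfl⟩, ?_, ?_, ?_⟩⟩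
    · simp only [Test.Holds, h5, h6]
      exact_mod_cast (Nat.lt_clog_iff_pow_lt Nat.one_lt_two).1 hx
    · simp only [List.mem_cons, List.not_mem_nil, or_false, not_or] at hi
      simp [execs, Instr.exec, hi.1]
    · simp only [List.mem_cons, List.not_mem_nil, or_false, not_or] at hi
      simp [execs, Instr.exec, hi.2]
    · simp [execs, Instr.exec, h4']
    · simp [execs, Instr.exec, h5]
    · simp only [execs, Instr.exec, Function.update_self, h6, pow_succ]; ring
  · rintro s₁ ⟨-, -, h5, h6⟩
    simp only [Test.Holds, h5, h6, not_lt]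
    exact_mod_cast Nat.le_pow_clog Nat.one_lt_two _
  · refine ⟨⟨fun i hi => ?_, fun i hi => ?_, rfl, rfl, rfl, rfl⟩, ?_, ?_, ?_⟩
    · simp only [List.mem_cons, List.not_mem_nil, or_false, not_or] at hi
      simp [hi.2]
    · simp only [List.mem_cons, List.not_mem_nil, or_false, not_or] at hi
      simp [hi.1, hi.2]
    · simp [h4]
    · simp [h2]
    · simp

/-- Index register `5` has grown by `x`, value register `0` by a factor `2 ^ x`; apart from that,
only index registers from `b` on have changed. -/
structure Grown (b x : ℕ) (s s' : State) : Prop where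
  same : Same (fun i => b ≤ i ∨ i = 5) (· = 0) s s'
  idx5 : s'.idx 5 = s.idx 5 + x
  val0 : s'.val 0 = s.val 0 * 2 ^ x

theorem Grown.trans {b x y : ℕ} {s s' s'' : State} (h : Grown b x s s') (h' : Grown b y s' s'') :
    Grown b (x + y) s s'' :=
  ⟨h.same.trans h'.same, by rw [h'.idx5, h.idx5, Nat.add_assoc],
    by rw [h'.val0, h.val0, pow_add, mul_assoc]⟩

theorem Grown.weaken {b b' x : ℕ} {s s' : State} (h : Grown b x s s') (hb : b' ≤ b) :
    Grown b' x s s' :=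
  { h with same := h.same.weaken (fun _ hi => hi.imp_left hb.trans) fun _ h => h }

/-- One level of nested counting loops. Apart from register 5, an inner loop changes only registers
above the outer counter, so the counter, its bound and the inputs in registers 4 and 15 survive each
round. -/
theorem spec_forLoop_grown {ctr bd L M τ x : ℕ} {p : Prog} (h16 : 16 ≤ ctr) (hbd : bd < 16)
    (hbd5 : bd ≠ 5) {k : ℕ} (hp : ∀ s, s.idx 4 = L → s.idx 15 = M → Spec O ω p s τ (Grown (ctr + 1) x s))
    {s : State} (h4 : s.idx 4 = L) (h15 : s.idx 15 = M) (hk : s.idx bd = k) :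
    Spec O ω (forLoop ctr bd p) s (k * (τ + 3) + 3) (Grown ctr (k * x) s) := by
  refine Spec.forLoop (by omega) (fun i => Grown ctr (i * x) s) k τ hk ?_ ?_ le_rfl
  · refine ⟨⟨fun i hi => ?_, fun _ _ => rfl, rfl, rfl, rfl, rfl⟩, ?_, by simp [Instr.exec]⟩
    · have : i ≠ ctr := by omega
      simp [Instr.exec, this]
    · have : 5 ≠ ctr := by omega
      simp [Instr.exec, this]
  · intro i hi s₁ g₁ hc hb
    refine (hp s₁ ((g₁.same.idx 4 (by omega)).trans h4)
      ((g₁.same.idx 15 (by omega)).trans h15)).mono le_rfl fun s₂ g₂ => ?_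
    refine ⟨(g₂.same.idx ctr (by omega)).trans hc, (g₂.same.idx bd (by omega)).trans hb, ?_⟩
    have g₃ : Grown ctr 0 s₂ ((Instr.idxSucc ctr).exec O ω s₂) := by
      refine ⟨⟨fun i hi => ?_, fun _ _ => rfl, rfl, rfl, rfl, rfl⟩, ?_, by simp [Instr.exec]⟩
      · have : i ≠ ctr := by omega
        simp [Instr.exec, this]
      · have : 5 ≠ ctr := by omega
        simp [Instr.exec, this]
    have := (g₁.trans (g₂.weaken (Nat.le_succ ctr))).trans g₃
    rwa [← Nat.succ_mul, Nat.add_zero] at this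

theorem spec_powCode {K : ℕ} {st : State} {L : ℕ} (h4 : st.idx 4 = L) (h5 : st.idx 5 = 0) {t : ℕ}
    (ht : L * (L * (K * 8 + 6) + 6) + 20 ≤ t) :
    Spec O ω (powCode K) st t fun st' =>
      Same (fun i => 20 ≤ i ∨ i = 5 ∨ i = 15) (· = 0) st st' ∧
      st'.idx 5 = L * (L * K) ∧ st'.val 0 = 2 ^ (L * (L * K)) := by
  refine Spec.seq 7 (L * (L * (K * 8 + 6) + 6) + 3) (Spec.block ?_) (by omega)
  set s₁ := execs O ω [.idxConst 15 1, .ofIdx 0 15, .idxConst 15 K] st with hs₁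
  have h4' : s₁.idx 4 = L := by simp [hs₁, execs, Instr.exec, h4]
  have h15 : s₁.idx 15 = K := by simp [hs₁, execs, Instr.exec]
  refine (spec_forLoop_grown (L := L) (M := K) (τ := L * (K * 8 + 6) + 3) (x := L * K)
    (by decide) (by decide) (by decide) (fun s h4 h15 => ?_) h4' h15 h4').mono le_rfl ?_
  · refine (spec_forLoop_grown (L := L) (M := K) (τ := K * 8 + 3) (x := K) (by decide) (by decide)
      (by decide) (fun s h4 h15 => ?_) h4 h15 h4).mono le_rfl fun s' h => h.weaken (by decide)
    refine (spec_forLoop_grown (L := L) (M := K) (τ := 5) (x := 1) (by decide) (by decide)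
      (by decide) (fun s h4 h15 => ?_) h4 h15 h15).mono le_rfl fun s' h => by
        rw [mul_one] at h; exact h.weaken (by decide)
    refine Spec.block ⟨⟨fun i hi => ?_, fun r hr => ?_, rfl, rfl, rfl, rfl⟩, ?_, ?_⟩
    · have : i ≠ 5 := by omega
      simp [execs, Instr.exec, this]
    · simp [execs, Instr.exec, hr]
    · simp [execs, Instr.exec]
    · simp [execs, Instr.exec]; ring
  · intro s₂ g
    refine ⟨?_, ?_, ?_⟩
    · have : Same (fun i => 20 ≤ i ∨ i = 5 ∨ i = 15) (· = 0) st s₁ := by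
        refine ⟨fun i hi => ?_, fun r hr => ?_, rfl, rfl, rfl, rfl⟩
        · have : i ≠ 15 := by omega
          simp [hs₁, execs, Instr.exec, this]
        · simp [hs₁, execs, Instr.exec, hr]
      exact this.trans (g.same.weaken (fun i hi => by omega) fun _ h => h)
    · rw [g.idx5]; simp [hs₁, execs, Instr.exec, h5]
    · rw [g.val0]; simp [hs₁, execs, Instr.exec]

/-- The preparations for the binary search. -/
def initCode (K : ℕ) : Prog :=
  .seq sizeCode <| .seq minCode <| .seq shiftCode <| .seq logCode (powCode K)

/-- Compute the rank of the input matrix; the program depends on the constant `K`. -/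
def rankCode (K : ℕ) : Prog :=
  .seq (initCode K) <| .seq (.loop (.idxLt 6 7) roundCode) (.op (.idxCopy 0 6))

section
variable {m n : ℕ} (A : Matrix (Fin m) (Fin n) ℝ) (e : Listing A) (K J : ℕ)

theorem spec_initCode {L : ℕ} (hL : L = Nat.clog 2 (nnz A + 1)) :
    Spec O ω (initCode K) (inputState A e)
      ((m + n) * 56 + L * 6 + L * (L * (K * 8 + 6) + 6) + 100)
      (Search O ω A e (L * (L * K)) (2 ^ (L * (L * K))) J 0) := by
  refine Spec.seq ((m + n) * 24 + 40) ((m + n) * 32 + L * 6 + L * (L * (K * 8 + 6) + 6) + 59)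
    ((spec_sizeCode (m := m) (n := n) rfl rfl le_rfl).mono le_rfl ?_) (by omega)
  rintro s₁ ⟨e₁, h13, h3, h14⟩
  refine Spec.seq 4 ((m + n) * 32 + L * 6 + L * (L * (K * 8 + 6) + 6) + 54)
    ((spec_minCode (m := m) (n := n) (e₁.idx 0 (by decide)) (e₁.idx 1 (by decide))
      le_rfl).mono le_rfl ?_) (by omega)
  rintro s₂ ⟨e₂, h7⟩
  refine Spec.seq ((m + n) * 32 + 10) (L * 6 + L * (L * (K * 8 + 6) + 6) + 43)
    ((spec_shiftCode ((e₂.idx 13 (by decide)).trans h13) ((e₂.idx 14 (by decide)).trans h14)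
      (by omega)).mono le_rfl ?_) (by omega)
  rintro s₃ ⟨i₃, v₃, a₃, b₃, va₃, d₃, q₃⟩
  have hi₃ : ∀ i < 20, i ≠ 3 → i ≠ 7 → i ≠ 13 → i ≠ 14 → i ≠ 15 →
      s₃.idx i = (inputState A e).idx i := by
    intro i hi h3 h7 h13 h14 h15
    rw [i₃ i h15 (by omega), e₂.idx i h7, e₁.idx i]
    simp only [List.mem_cons, List.not_mem_nil, or_false]; omega
  refine Spec.seq (L * 6 + 20) (L * (L * (K * 8 + 6) + 6) + 20)
    ((spec_logCode (N := nnz A)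
      (hi₃ 2 (by decide) (by decide) (by decide) (by decide) (by decide) (by decide))
      (hi₃ 4 (by decide) (by decide) (by decide) (by decide) (by decide) (by decide))
      (by rw [hL])).mono le_rfl ?_) (by omega)
  rintro s₄ ⟨e₄, h4⟩
  rw [← hL] at h4
  have hi₄ : ∀ i < 20, i ≠ 3 → i ≠ 4 → i ≠ 7 → i ≠ 13 → i ≠ 14 → i ≠ 15 →
      s₄.idx i = (inputState A e).idx i := by
    intro i hi h3 h4 h7 h13 h14 h15
    rw [e₄.idx i, hi₃ i hi h3 h7 h13 h14 h15]
    simp only [List.mem_cons, List.not_mem_nil, or_false]; omega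
  refine (spec_powCode h4
    (hi₄ 5 (by decide) (by decide) (by decide) (by decide) (by decide) (by decide) (by decide))
    le_rfl).mono le_rfl ?_
  rintro s₅ ⟨e₅, h5, h0⟩
  have hi₅ : ∀ i < 20, i ≠ 3 → i ≠ 4 → i ≠ 5 → i ≠ 7 → i ≠ 13 → i ≠ 14 → i ≠ 15 →
      s₅.idx i = (inputState A e).idx i := by
    intro i hi h3 h4 h5 h7 h13 h14 h15
    rw [e₅.idx i (by omega), hi₄ i hi h3 h4 h7 h13 h14 h15]
  have h35 : ∀ i, i = 3 ∨ i = 7 → s₅.idx i = s₂.idx i := by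
    intro i hi
    rw [e₅.idx i (by omega), e₄.idx i, i₃ i (by omega) (by omega)]
    simp only [List.mem_cons, List.not_mem_nil, or_false]; omega
  have ha₅ : ∀ a, a ≠ 4 → s₅.idxArr a = (inputState A e).idxArr a := by
    intro a ha
    rw [e₅.idxArr, e₄.idxArr, a₃ a ha, e₂.idxArr, e₁.idxArr]
  have h6 : s₅.idx 6 = 0 :=
    hi₅ 6 (by decide) (by decide) (by decide) (by decide) (by decide) (by decide) (by decide) (by decide)
  have h7' : s₅.idx 7 = min m n := (h35 7 (Or.inr rfl)).trans h7
  have hq : s₅.queries = [] := by rw [e₅.queries, e₄.queries, q₃, e₂.queries, e₁.queries]; rfl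
  refine
    { ready :=
      { idx2 := hi₅ 2 (by decide) (by decide) (by decide) (by decide) (by decide) (by decide)
          (by decide) (by decide)
        idx3 := (h35 3 (Or.inl rfl)).trans ((e₂.idx 3 (by decide)).trans h3)
        idx5 := h5
        idx12 := hi₅ 12 (by decide) (by decide) (by decide) (by decide) (by decide) (by decide)
          (by decide) (by decide)
        val0 := h0
        val1 := by
          rw [e₅.val 1 (by decide), e₄.val 1 (by decide), v₃, e₂.val 1 not_false,
            e₁.val 1 not_false]; rfl
        idxArr0 := ha₅ 0 (by decide)
        idxArr1 := ha₅ 1 (by decide)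
        valArr0 := by rw [e₅.valArr, e₄.valArr, va₃, e₂.valArr, e₁.valArr]
        idxArr4 := fun x hx => by rw [e₅.idxArr, e₄.idxArr]; exact b₃ x hx }
      le := by omega
      le_min := by omega
      drawn := by rw [e₅.drawn, e₄.drawn, d₃, e₂.drawn, e₁.drawn]; simp [inputState]
      length := by rw [hq]; rfl
      isTest := by rw [hq]; simp
      rank := fun _ => ⟨by omega, ?_⟩ }
  rw [h7']
  exact le_min (by simpa using A.rank_le_card_height) (by simpa using A.rank_le_card_width)

theorem spec_rankCode (hm : 0 < m) (hn : 0 < n) (hN : min m n ≤ nnz A) {L : ℕ}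
    (hL : L = Nat.clog 2 (nnz A + 1)) :
    Spec O ω (rankCode K) (inputState A e)
      ((m + n) * 56 + L * 6 + L * (L * (K * 8 + 6) + 6) +
        L * (nnz A * 100 + ((m + n) + (m + n)) * (L * (L * K) * 100 + 80) + 201) + 110) fun st' =>
      (∃ j ≤ L, st'.queries.length = j) ∧
      (∀ q ∈ st'.queries, ∃ j < L, ∃ r ≤ min m n, IsTest A e (L * (L * K)) (2 ^ (L * (L * K))) ω
        (j * (((m + n) + (m + n)) * (L * (L * K) * 2 + 1))) r q) ∧
      (Reliable O ω A e (L * (L * K)) (2 ^ (L * (L * K))) L → st'.idx 0 = A.rank) := by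
  refine Spec.seq _ (L * (nnz A * 100 + ((m + n) + (m + n)) * (L * (L * K) * 100 + 80) + 201) + 5)
    ((spec_initCode A e K L hL).mono le_rfl ?_) (by omega)
  intro s₁ hs
  -- The initial gap is at most min(m, n) ≤ N < 2^L, so L rounds suffice.
  have hgap : s₁.idx 7 - s₁.idx 6 < 2 ^ L := by
    have h1 := hs.le_min
    have h2 : nnz A + 1 ≤ 2 ^ L := hL ▸ Nat.le_pow_clog Nat.one_lt_two _
    omega
  refine Spec.seq _ 1 ((spec_search hm hn L hs (by omega) hgap).mono le_rfl ?_) (by omega)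
  rintro s₂ ⟨⟨j, hj, h⟩, h67⟩
  refine Spec.op ⟨⟨j, hj, h.length⟩, fun q hq => ?_, fun hrel => ?_⟩
  · obtain ⟨j', hj', r, hr, ht⟩ := h.isTest q hq
    exact ⟨j', by omega, r, hr, ht⟩
  · have := h.rank hrel
    simp [Instr.exec]; omega

end
end RealRAM

end

/-! ### Quantitative estimates and the union bound -/

section

open MeasureTheory ProbabilityTheory Matrix
namespace RealRAM

section
variable {O : SquareOracle} {ω : Tape}
variable {m n : ℕ} {A : Matrix (Fin m) (Fin n) ℝ} {e : Listing A} {d o r : ℕ} {H δ : ℝ}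

open Classical in
/-- The tapes on which the rank test for `r` with the samples from cell `o` on may go wrong. -/
def failure (A : Matrix (Fin m) (Fin n) ℝ) (d : ℕ) (δ : ℝ) (o r : ℕ) : Set Tape :=
  if r ≤ A.rank then
    {ω | (bordered (pad A) (randomSparse ((m + n) + (m + n)) ((m + n) + (m + n) - 2 * r) d o ω)).det
      = 0}
  else
    {ω | ¬ ∃ u : Fin ((m + n) + (m + n)) → ℝ, ‖u‖ = 1 ∧ u ᵥ* pad A = 0 ∧
      u ᵥ* randomSparse ((m + n) + (m + n)) ((m + n) + (m + n) - 2 * r) d o ω = 0 ∧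
      δ ≤ |∑ x : Fin ((m + n) + (m + n)), gDraw o d ω x * u x|}

theorem tapeLaw_failure_le (hs : 0 < m + n) (hr : r ≤ min m n)
    (hd : ((m + n + (m + n) : ℕ) : ℝ) ^ 2 * Real.exp (-(d / 2)) ≤ 1) {p : ℝ}
    (h₁ : ((m + n + (m + n) : ℕ) : ℝ) ^ 3 * Real.exp (-(d / 2)) ≤ p) (h₂ : 2 * δ ≤ p) :
    tapeLaw (failure A d δ o r) ≤ ENNReal.ofReal p := by
  have hκ : (((m + n + (m + n) - 2 * r : ℕ)) : ℝ) ≤ ((m + n + (m + n) : ℕ) : ℝ) := by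
    exact_mod_cast Nat.sub_le _ _
  unfold failure
  split_ifs with h
  · refine (tapeLaw_det_eq_zero_le A h _ d o (by omega) (by omega) (le_trans ?_ hd)).trans
      (ENNReal.ofReal_le_ofReal (le_trans ?_ h₁)) <;> gcongr
  · exact (tapeLaw_abs_lt_of_rank_lt A _ d o (by omega) δ).trans (ENNReal.ofReal_le_ofReal h₂)

theorem IsTest.det_ne_zero {q : Query} (hq : IsTest A e d H ω o r q) (hs : 0 < m + n)
    (hr : r ≤ min m n) (hω : ω ∉ failure A d δ o r) (h : r ≤ A.rank) : q.matrix.det ≠ 0 := by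
  rw [failure, if_pos h] at hω
  exact det_matrix_ne_zero hq.dim_eq hq.triples_eq
    (fun x k => uniformIdx_lt (by omega) _) hω

theorem IsTest.aldNo {q : Query} (hq : IsTest A e d H ω o r q) (hs : 0 < m + n)
    (hr : r ≤ min m n) (hω : ω ∉ failure A d δ o r) (h : ¬ r ≤ A.rank) (hδ : 0 < δ) (hH : 0 < H)
    {ε : ℝ} (hε : 2 < ε * (H * δ)) (E : ℕ → ℝ) (hE : E q.dim = 1 - ε) : ALDNo E q.matrix 1 := by
  rw [failure, if_neg h] at hω
  obtain ⟨u, hu, huM, huW, hg⟩ := not_not.1 hω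
  exact aldNo_matrix hq.dim_eq hq.triples_eq (fun x k => uniformIdx_lt (by omega) _)
    hu huM huW hδ hH hg hε E hE

theorem aldYes_one_of_det_ne_zero {k : ℕ} {B : Matrix (Fin k) (Fin k) ℝ} (h : B.det ≠ 0) :
    ALDYes B 1 ∧ B.rank = k := by
  have hu : IsUnit B.det := isUnit_iff_ne_zero.2 h
  refine ⟨⟨B⁻¹ *ᵥ 1, by rw [mulVec_mulVec, mul_nonsing_inv _ hu, one_mulVec]⟩, ?_⟩
  simpa using rank_of_isUnit B ((isUnit_iff_isUnit_det _).2 hu)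

theorem IsTest.len_eq {q : Query} (hq : IsTest A e d H ω o r q) :
    q.len = nnz A * 4 + ((m + n) + (m + n)) * (2 + d * 4) + 1 := by
  rw [← q.length_triples, hq.triples_eq, matrixTriples, length_testTriples]

/-- This fixes the threshold δ = 4 D^c₀ / H, with `D` a bound for all query dimensions `k`: the
product becomes 4 D^c₀ / k^c ≥ 4. -/
theorem two_lt_inv_rpow_mul {c : ℝ} {c₀ D k : ℕ} (hc : c ≤ c₀) (hk : 0 < k) (hD : k ≤ D)
    (hH : 0 < H) : 2 < 1 / (k : ℝ) ^ c * (H * (4 * (D : ℝ) ^ c₀ / H)) := by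
  have hk1 : (1 : ℝ) ≤ k := by exact_mod_cast hk
  have h1 : (k : ℝ) ^ c ≤ (D : ℝ) ^ c₀ := calc
    (k : ℝ) ^ c ≤ (k : ℝ) ^ (c₀ : ℝ) := Real.rpow_le_rpow_of_exponent_le hk1 hc
    _ = (k : ℝ) ^ c₀ := Real.rpow_natCast _ _
    _ ≤ (D : ℝ) ^ c₀ := by gcongr
  have h0 : 0 < (k : ℝ) ^ c := by positivity
  rw [mul_div_cancel₀ _ hH.ne', one_div, ← div_eq_inv_mul, lt_div_iff₀ h0]
  linarith

theorem nnz_le_mul (A : Matrix (Fin m) (Fin n) ℝ) : nnz A ≤ m * n := by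
  have h := Finite.card_subtype_le fun p : Fin m × Fin n => A p.1 p.2 ≠ 0
  rwa [Nat.card_prod, Nat.card_fin, Nat.card_fin] at h

theorem one_le_log_add_two {N : ℕ} (hN : 0 < N) : 1 ≤ Real.log ((N : ℝ) + 2) := by
  rw [Real.le_log_iff_exp_le (by positivity)]
  have : (1 : ℝ) ≤ N := by exact_mod_cast hN
  linarith [Real.exp_one_lt_d9]

/-- If l + 1 is the rounded logarithm then 2^l < N + 1, so l is at most log(N + 2)/0.69; the extra 1
is absorbed since log(N + 2) ≥ 1. -/
theorem clog_le_log {N : ℕ} (hN : 0 < N) :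
    (Nat.clog 2 (N + 1) : ℝ) ≤ 3 * Real.log ((N : ℝ) + 2) := by
  have h := Nat.pow_pred_clog_lt_self Nat.one_lt_two (show 1 < N + 1 by omega)
  have h0 : 0 < Nat.clog 2 (N + 1) := Nat.clog_pos Nat.one_lt_two (by omega)
  obtain ⟨l, hl⟩ := Nat.exists_eq_succ_of_ne_zero h0.ne'
  rw [hl] at h ⊢
  have h2 : (2 : ℝ) ^ l ≤ N + 2 := by
    have : 2 ^ l ≤ N + 2 := by simpa using h.le.trans (Nat.le_succ _)
    exact_mod_cast this
  have h3 := Real.log_le_log (by positivity) h2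
  rw [Real.log_pow] at h3
  have h4 := one_le_log_add_two hN
  have h5 := Real.log_two_gt_d9
  have h6 : (l : ℝ) * 0.69 ≤ l * Real.log 2 := by gcongr; linarith
  push_cast
  linarith

theorem exp_neg_le_inv_two_pow (k : ℕ) : Real.exp (-(k : ℝ)) ≤ ((2 : ℝ) ^ k)⁻¹ := by
  rw [Real.exp_neg]
  gcongr
  calc (2 : ℝ) ^ k ≤ Real.exp 1 ^ k := by gcongr; linarith [Real.exp_one_gt_d9]
    _ = Real.exp k := by rw [← Real.exp_nat_mul, mul_one]

theorem inv_two_pow_sq_le {N L : ℕ} (hN : 0 < N) (hL : N ≤ 2 ^ L) :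
    (((2 : ℝ) ^ L) ^ L)⁻¹ ≤ (N : ℝ) ^ (-Real.logb 2 N) := by
  have hN1 : (1 : ℝ) ≤ N := by exact_mod_cast hN
  have hN0 : (0 : ℝ) < N := by positivity
  have hl : Real.logb 2 N ≤ L := by
    rw [Real.logb_le_iff_le_rpow one_lt_two hN0, Real.rpow_natCast]
    exact_mod_cast hL
  have hl0 : 0 ≤ Real.logb 2 N := Real.logb_nonneg one_lt_two hN1
  rw [Real.rpow_neg hN0.le]
  gcongr
  calc (N : ℝ) ^ Real.logb 2 N ≤ (N : ℝ) ^ (L : ℝ) := Real.rpow_le_rpow_of_exponent_le hN1 hl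
    _ = (N : ℝ) ^ L := Real.rpow_natCast _ _
    _ ≤ ((2 : ℝ) ^ L) ^ L := by gcongr; exact_mod_cast hL

/-- The dominant term has order K s L³: L rounds, each writing of order d = K L² entries in each of
2s rows. All other terms are also at most a multiple of N L³. -/
theorem steps_le {N s L K : ℕ} (hN : 0 < N) (hL : 0 < L) (hs : s ≤ 2 * N) :
    s * 56 + L * 6 + L * (L * (K * 8 + 6) + 6) +
      L * (N * 100 + (s + s) * (L * (L * K) * 100 + 80) + 201) + 110 ≤
    (1000 * K + 1000) * (N * L ^ 3) := by
  have a1 : 1 ≤ N * L ^ 3 := Nat.mul_pos hN (by positivity)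
  have a2 : N ≤ N * L ^ 3 := Nat.le_mul_of_pos_right _ (by positivity)
  have hL3 : L ≤ L ^ 3 := Nat.le_self_pow (by omega) _
  have hL23 : L ^ 2 ≤ L ^ 3 := Nat.pow_le_pow_right hL (by omega)
  have a3 : L * N ≤ N * L ^ 3 := by rw [mul_comm]; gcongr
  have a4 : L ≤ N * L ^ 3 := hL3.trans (Nat.le_mul_of_pos_left _ hN)
  have a5 : L ^ 2 ≤ N * L ^ 3 := hL23.trans (Nat.le_mul_of_pos_left _ hN)
  have a6 : K * L ^ 2 ≤ K * (N * L ^ 3) := by gcongr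
  have a7 : s * L ≤ 2 * (N * L ^ 3) := by
    calc s * L ≤ 2 * N * L := by gcongr
      _ ≤ 2 * (N * L ^ 3) := by rw [mul_assoc, mul_comm N L]; gcongr
  have a8 : K * (s * L ^ 3) ≤ K * (2 * (N * L ^ 3)) := by
    rw [← mul_assoc 2]; gcongr
  nlinarith

theorem length_le {N s L K : ℕ} (hN : 0 < N) (hL : 0 < L) (hs : s ≤ 2 * N) :
    N * 4 + (s + s) * (2 + L * (L * K) * 4) + 1 ≤ (1000 * K + 1000) * (N * L ^ 3) := by
  have a1 : 1 ≤ N * L ^ 3 := Nat.mul_pos hN (by positivity)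
  have a2 : N ≤ N * L ^ 3 := Nat.le_mul_of_pos_right _ (by positivity)
  have hL23 : L ^ 2 ≤ L ^ 3 := Nat.pow_le_pow_right hL (by omega)
  have a8 : K * (s * L ^ 2) ≤ K * (2 * (N * L ^ 3)) := by
    rw [← mul_assoc 2]; gcongr
  nlinarith

theorem mul_cube_le_softO {N L K : ℕ} (hN : 0 < N) (hL : L = Nat.clog 2 (N + 1)) {x : ℕ}
    (hx : x ≤ (1000 * K + 1000) * (N * L ^ 3)) :
    (x : ℝ) ≤ softO (27 * (1000 * K + 1000)) 3 N := by
  have h : (x : ℝ) ≤ (1000 * K + 1000) * (N * L ^ 3) := by exact_mod_cast hx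
  have hl : (L : ℝ) ≤ 3 * Real.log ((N : ℝ) + 2) := hL ▸ clog_le_log hN
  calc (x : ℝ) ≤ (1000 * K + 1000) * (N * L ^ 3) := h
    _ ≤ (1000 * K + 1000) * (N * (3 * Real.log ((N : ℝ) + 2)) ^ 3) := by gcongr
    _ = softO (27 * (1000 * K + 1000)) 3 N := by rw [softO]; ring

/-- The union bound over all tests that may occur. -/
theorem tapeLaw_biUnion_failure_le {N L c₀ D K : ℕ} (hN : 0 < N) (hL : L = Nat.clog 2 (N + 1))
    (hmn : max m n ≤ N) (hm : 0 < m) (hK : K = 2 * (12 + 5 * c₀))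
    (hD : D = 2 * ((m + n) + (m + n)) + 1) (f : ℕ → ℕ) :
    tapeLaw (⋃ p ∈ Finset.range L ×ˢ Finset.range (min m n + 1),
      failure A (L * (L * K)) (4 * (D : ℝ) ^ c₀ / 2 ^ (L * (L * K))) (f p.1) p.2)
      ≤ ENNReal.ofReal ((N : ℝ) ^ (-Real.logb 2 N)) := by
  have hL0 : 0 < L := hL ▸ Nat.clog_pos Nat.one_lt_two (by omega)
  have hNL : N + 1 ≤ 2 ^ L := hL ▸ Nat.le_pow_clog Nat.one_lt_two _
  -- All quantities are compared with powers of P = 2^L > N: n₀ ≤ P³, D ≤ P⁵, exp(-d/2) ≤ P^(-k₀)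
  -- and 1/H ≤ P^(-k₀).
  set P : ℝ := 2 ^ L with hP
  have hP2 : 2 ≤ P := by
    simpa using pow_le_pow_right₀ (one_le_two : (1 : ℝ) ≤ 2) (show 1 ≤ L from hL0)
  have hP1 : 1 ≤ P := by linarith
  have hPN : (N : ℝ) + 1 ≤ P := by rw [hP]; exact_mod_cast hNL
  -- Chosen so that d/2 = L k₀. One test fails with probability at most P^(9 + 5c₀ - k₀) and there
  -- are at most P² tests; the total is at most P^(-L) because k₀ ≥ 11 + 5c₀ + L.
  set k₀ := (12 + 5 * c₀) * L with hk₀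
  have hmN : (m : ℝ) ≤ N := by exact_mod_cast (le_max_left m n).trans hmn
  have hnN : (n : ℝ) ≤ N := by exact_mod_cast (le_max_right m n).trans hmn
  have hd2 : ((L * (L * K) : ℕ) : ℝ) / 2 = ((L * k₀ : ℕ) : ℝ) := by
    rw [hk₀, hK]; push_cast; ring
  have hPpow : (2 : ℝ) ^ (L * k₀) = P ^ k₀ := by rw [hP, pow_mul]
  have hexp : Real.exp (-(((L * (L * K) : ℕ) : ℝ) / 2)) ≤ (P ^ k₀)⁻¹ := by
    rw [hd2, ← hPpow]; exact exp_neg_le_inv_two_pow _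
  have hH : P ^ k₀ ≤ (2 : ℝ) ^ (L * (L * K)) := by
    rw [← hPpow]
    refine pow_le_pow_right₀ one_le_two ?_
    rw [hk₀, hK]
    refine Nat.mul_le_mul_left _ ?_
    rw [mul_comm]
    exact Nat.mul_le_mul_left _ (by omega)
  have hP4 : 4 ≤ P ^ 2 := by nlinarith
  have hP8 : 8 ≤ P ^ 3 := by nlinarith
  have hn₀ : ((m + n + (m + n) : ℕ) : ℝ) ≤ P ^ 3 := by
    push_cast; nlinarith
  have hD5 : (D : ℝ) ≤ P ^ 5 := by
    have h1 : (D : ℝ) ≤ 8 * P := by rw [hD]; push_cast; linarith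
    have h2 : 8 * P ≤ P ^ 3 * P := by gcongr
    have h3 : P ^ 3 * P ≤ P ^ 5 := by
      rw [← pow_succ]; exact pow_le_pow_right₀ hP1 (by omega)
    linarith
  have hk12 : 12 ≤ k₀ := by nlinarith
  have hpos : 0 < P := by linarith
  have hd : ((m + n + (m + n) : ℕ) : ℝ) ^ 2 * Real.exp (-(((L * (L * K) : ℕ) : ℝ) / 2)) ≤ 1 := by
    calc _ ≤ (P ^ 3) ^ 2 * (P ^ k₀)⁻¹ := by gcongr
      _ ≤ 1 := by
        rw [← div_eq_mul_inv, div_le_one (by positivity), ← pow_mul]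
        exact pow_le_pow_right₀ hP1 (by omega)
  have h₁ : ((m + n + (m + n) : ℕ) : ℝ) ^ 3 * Real.exp (-(((L * (L * K) : ℕ) : ℝ) / 2))
      ≤ P ^ (9 + 5 * c₀) * (P ^ k₀)⁻¹ := by
    calc _ ≤ (P ^ 3) ^ 3 * (P ^ k₀)⁻¹ := by gcongr
      _ ≤ _ := by
        rw [← pow_mul]
        exact mul_le_mul_of_nonneg_right (pow_le_pow_right₀ hP1 (by omega)) (by positivity)
  have h₂ : 2 * (4 * (D : ℝ) ^ c₀ / 2 ^ (L * (L * K))) ≤ P ^ (9 + 5 * c₀) * (P ^ k₀)⁻¹ := by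
    calc 2 * (4 * (D : ℝ) ^ c₀ / 2 ^ (L * (L * K)))
        = 8 * (D : ℝ) ^ c₀ * (2 ^ (L * (L * K)))⁻¹ := by ring
      _ ≤ P ^ 3 * (P ^ 5) ^ c₀ * (P ^ k₀)⁻¹ := by gcongr
      _ ≤ _ := by
        rw [← pow_mul P 5, ← pow_add P]
        exact mul_le_mul_of_nonneg_right (pow_le_pow_right₀ hP1 (by omega)) (by positivity)
  refine (measure_biUnion_finset_le _ _).trans ?_
  refine (Finset.sum_le_card_nsmul _ _ (ENNReal.ofReal (P ^ (9 + 5 * c₀) * (P ^ k₀)⁻¹))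
    fun p hp => ?_).trans ?_
  · rw [Finset.mem_product, Finset.mem_range, Finset.mem_range] at hp
    exact tapeLaw_failure_le (by omega) (by omega) hd h₁ h₂
  rw [nsmul_eq_mul, ← ENNReal.ofReal_natCast, ← ENNReal.ofReal_mul (by positivity),
    Finset.card_product, Finset.card_range, Finset.card_range]
  refine ENNReal.ofReal_le_ofReal (le_trans ?_ (inv_two_pow_sq_le hN (by omega : N ≤ 2 ^ L)))
  have hLP : (L : ℝ) ≤ P := by rw [hP]; exact_mod_cast Nat.lt_two_pow_self.le
  have hmin : ((min m n + 1 : ℕ) : ℝ) ≤ P := by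
    refine le_trans ?_ hPN
    have : min m n + 1 ≤ N + 1 := by omega
    exact_mod_cast this
  calc ((L * (min m n + 1) : ℕ) : ℝ) * (P ^ (9 + 5 * c₀) * (P ^ k₀)⁻¹)
      ≤ (P * P) * (P ^ (9 + 5 * c₀) * (P ^ k₀)⁻¹) := by
        rw [Nat.cast_mul]; gcongr
    _ = P ^ (11 + 5 * c₀) * (P ^ k₀)⁻¹ := by ring
    _ ≤ (P ^ L)⁻¹ := by
        rw [← div_eq_mul_inv, div_le_iff₀ (by positivity), ← div_eq_inv_mul,
          le_div_iff₀ (by positivity), ← pow_add]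
        refine pow_le_pow_right₀ hP1 ?_
        nlinarith [Nat.zero_le (c₀ * (L - 1))]

end
end RealRAM

end

/-! ### The reduction -/

theorem theorem3p1 (c : ℝ) (hc : 0 < c) :
    ∃ (P : RealRAM.Prog) (C : ℝ) (k : ℕ),
      ∀ (m n : ℕ), 0 < m → 0 < n →
      ∀ A : Matrix (Fin m) (Fin n) ℝ, max m n ≤ nnz A →
      ∀ (e : RealRAM.Listing A) (O : SquareOracle),
        SolvesALD (fun d => 1 - 1 / (d : ℝ) ^ c) O →
        -- on every random tape: running time, number of queries, dimension and sparsity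
        (∀ ω : RealRAM.Tape, ∃ (T : ℕ) (s : RealRAM.State),
          RealRAM.HaltsIn O ω P (RealRAM.inputState A e) T s ∧
          (T : ℝ) ≤ softO C k (nnz A) ∧
          (s.queries.length : ℝ) ≤ C * Real.log ((m * n : ℕ) + 2) ^ k ∧
          ∀ q ∈ s.queries,
            (q.dim : ℝ) ≤ C * (max m n : ℕ) ∧
            (nnz q.matrix : ℝ) ≤ softO C k (nnz A) ∧
            (q.len : ℝ) ≤ softO C k (nnz A)) ∧
        -- with high probability: the output is the rank, and each query is a NO instance or
        -- a YES instance with a matrix of full rank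
        RealRAM.tapeLaw {ω | ¬ ∃ (T : ℕ) (s : RealRAM.State),
          RealRAM.HaltsIn O ω P (RealRAM.inputState A e) T s ∧
          s.idx 0 = A.rank ∧
          ∀ q ∈ s.queries,
            (ALDYes q.matrix 1 ∧ q.matrix.rank = q.dim) ∨
            ALDNo (fun d => 1 - 1 / (d : ℝ) ^ c) q.matrix 1}
          ≤ ENNReal.ofReal ((nnz A : ℝ) ^ (-Real.logb 2 (nnz A))) := by
  obtain ⟨c₀, hc₀⟩ := exists_nat_ge c
  obtain ⟨K, hK⟩ : ∃ K, K = 2 * (12 + 5 * c₀) := ⟨_, rfl⟩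
  -- Lengths and running times are of order N L³; the bound L ≤ 3 log(N + 2) explains the factor 27
  -- and the exponent 3.
  refine ⟨RealRAM.rankCode K, 27 * (1000 * K + 1000), 3, fun m n hm hn A hA e O hO => ?_⟩
  obtain ⟨L, hL⟩ : ∃ L, L = Nat.clog 2 (nnz A + 1) := ⟨_, rfl⟩
  have hN : 0 < nnz A := by omega
  have hL0 : 0 < L := hL ▸ Nat.clog_pos Nat.one_lt_two (by omega)
  refine ⟨fun ω => ?_, ?_⟩
  · obtain ⟨T, hT, s, hs, ⟨j, hj, hlen⟩, htest, -⟩ :=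
      (RealRAM.spec_rankCode (O := O) (ω := ω) A e K hm hn (by omega) hL).haltsIn
    refine ⟨T, s, hs, RealRAM.mul_cube_le_softO hN hL (hT.trans (RealRAM.steps_le hN hL0 (by omega))), ?_,
      fun q hq => ?_⟩
    · have h1 : (L : ℝ) ≤ 3 * Real.log ((nnz A : ℝ) + 2) := hL ▸ RealRAM.clog_le_log hN
      have h2 : Real.log ((nnz A : ℝ) + 2) ≤ Real.log ((m * n : ℕ) + 2) := by
        gcongr; exact RealRAM.nnz_le_mul A
      have h3 : 1 ≤ Real.log (((m * n : ℕ) : ℝ) + 2) := RealRAM.one_le_log_add_two (Nat.mul_pos hm hn)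
      have h4 : (s.queries.length : ℝ) ≤ L := by rw [hlen]; exact_mod_cast hj
      have h5 := le_self_pow₀ h3 (by omega : 3 ≠ 0)
      have h6 : (0 : ℝ) ≤ K := by positivity
      calc (s.queries.length : ℝ) ≤ 3 * Real.log ((m * n : ℕ) + 2) ^ 3 := by linarith
        _ ≤ _ := by gcongr; linarith
    · obtain ⟨j', hj', r, hr, ht⟩ := htest q hq
      have hl := RealRAM.mul_cube_le_softO (K := K) hN hL
        (ht.len_eq.le.trans (RealRAM.length_le hN hL0 (by omega : m + n ≤ 2 * nnz A)))
      refine ⟨?_, le_trans (by exact_mod_cast RealRAM.nnz_matrix_le q) hl, hl⟩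
      -- The dimension is at most 2n₀ + 1 = 4(m + n) + 1.
      have h1 : q.dim ≤ 9 * max m n := by rw [ht.dim_eq]; omega
      have h6 : (0 : ℝ) ≤ K := by positivity
      calc (q.dim : ℝ) ≤ 9 * (max m n : ℕ) := by exact_mod_cast h1
        _ ≤ _ := by gcongr; linarith
  · refine (MeasureTheory.measure_mono ?_).trans (RealRAM.tapeLaw_biUnion_failure_le (A := A) hN hL hA hm hK rfl
      fun j => j * (((m + n) + (m + n)) * (L * (L * K) * 2 + 1)))
    intro ω
    contrapose
    intro hω
    simp only [Set.mem_iUnion, not_exists, Finset.mem_product, Finset.mem_range, Prod.forall] at hω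
    -- Outside the failure events every possible test satisfies the promise. This gives the required
    -- form of the queries and also forces the oracle to answer correctly.
    have hgood : ∀ j < L, ∀ r ≤ min m n, ∀ q,
        RealRAM.IsTest A e (L * (L * K)) (2 ^ (L * (L * K))) ω
          (j * (((m + n) + (m + n)) * (L * (L * K) * 2 + 1))) r q →
        (r ≤ A.rank → ALDYes q.matrix 1 ∧ q.matrix.rank = q.dim) ∧
        (¬ r ≤ A.rank → ALDNo (fun d => 1 - 1 / (d : ℝ) ^ c) q.matrix 1) := by
      intro j hj r hr q ht
      have hf := hω j r ⟨hj, by omega⟩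
      refine ⟨fun h => RealRAM.aldYes_one_of_det_ne_zero (ht.det_ne_zero (by omega) hr hf h), fun h => ?_⟩
      exact ht.aldNo (by omega) hr hf h (by positivity) (by positivity)
        (RealRAM.two_lt_inv_rpow_mul hc₀ (by rw [ht.dim_eq]; omega) (by rw [ht.dim_eq]; omega)
          (by positivity)) _ rfl
    obtain ⟨T, -, s, hs, -, htest, hrank⟩ :=
      (RealRAM.spec_rankCode (O := O) (ω := ω) A e K hm hn (by omega) hL).haltsIn
    refine not_not.2 ⟨T, s, hs, hrank fun j hj r hr q ht => ?_, fun q hq => ?_⟩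
    · obtain ⟨h1, h2⟩ := hgood j hj r hr q ht
      by_cases h : r ≤ A.rank
      · exact iff_of_true ((hO _ _).1 (h1 h).1) h
      · exact iff_of_false (by rw [(hO _ _).2 (h2 h)]; exact Bool.false_ne_true) h
    · obtain ⟨j, hj, r, hr, ht⟩ := htest q hq
      obtain ⟨h1, h2⟩ := hgood j hj r hr q ht
      by_cases h : r ≤ A.rank
      · exact Or.inl (h1 h)
      · exact Or.inr (h2 h)
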